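/- **Setting.** Let $k'>0$ and $k=k'+\tfrac14$. Let $\mathcal F$ be the Fock space with orthonormal basis $\varphi_n$ ($n\ge 0$) and boson operators $\mathbf a\varphi_n=\sqrt n\,\varphi_{n-1}$, $\mathbf a^\dagger\varphi_n=\sqrt{n+1}\,\varphi_{n+1}$. For $l>0$ let $D^+_l$ be the positive discrete series representation, with orthonormal basis $\phi_{lm}$ ($m\ge0$) and generators $K_0\phi_{lm}=(l+m)\phi_{lm}$, $K_+\phi_{lm}=[(m+1)(m+2l)]^{1/2}\phi_{l,m+1}$, $K_-\phi_{lm}=[m(m+2l-1)]^{1/2}\phi_{l,m-1}$. For $|w|<1$ put $S(w)=\exp(wK_+)\exp(\eta K_0)\exp(-\bar wK_-)$, $\eta=\ln(1-|w|^2)$, and $S_{lm'm}(w)=\langle\phi_{lm'}|S(w)|\phi_{lm}\rangle$ in $D_l^+$. On the Hilbert tensor product $\mathcal F\otimes D^+_{k'}$ let $D(\alpha)=\exp(\alpha\mathbf a^\dagger-\bar\alpha\mathbf a)$ and $$\mathbf K_+=\tfrac12(\mathbf a^\dagger)^2+\mathbf K_+',\quad \mathbf K_-=\tfrac12\mathbf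 a^2+\mathbf K_-',\quad \mathbf K_0=\tfrac12(\mathbf a^\dagger\mathbf a+\tfrac12)+\mathbf K'_0,$$ where the $\mathbf K'$ are the generators of $D^+_{k'}$ acting on the second factor. Let $S(w)=\exp(w\mathbf K_+)\exp(\eta\mathbf K_0)\exp(-\bar w\mathbf K_-)$, and let $S(w,w')$ be the tensor product of $\exp(\tfrac w2(\mathbf a^\dagger)^2)\exp(\tfrac\eta2(\mathbf a^\dagger\mathbf a+\tfrac12))\exp(-\tfrac{\bar w}2\mathbf a^2)$ on $\mathcal F$ with $\exp(w'K'_+)\exp(\eta'K'_0)\exp(-\overline{w'}K'_-)$ on $D^+_{k'}$, $\eta'=\ln(1-|w'|^2)$. (All products of exponentials are applied successively to finite linear combinations of basis vectors and extended by continuity.) An element of the universal cover of $\mathrm{SU}(1,1)$ is given by $a,b\in\mathbb C$, $|a|^2-|b|^2=1$, and $\omega\in\mathbb R$ with $a=|a|e^{i\omega}$; write $(a/|a|)^{2r}=e^{2ir\omega}$ and $(\bar a+\bar bw)^{-2r}=e^{2ir\omega}|a|^{-2r}(1+\tfrac{\bar b}{\bar a}w)^{-2r}$ (principal power) for $|w|<1$.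 In $D^+_l$, $T(g)_l$ is the bounded operator with $T(g)_le_w=(\bar a+\bar bw)^{-2l}e_{w_1}$ for $|w|<1$, where $e_w=\exp(wK_+)\phi_{l0}$ and $w_1=\frac{aw+b}{\bar bw+\bar a}$. On $\mathcal F\otimes D^+_{k'}$, $T(g)$ is the bounded operator with $$T(g)e_{z,w}=(\bar a+\bar bw)^{-2k}\exp\Big(-\frac{\bar bz^2}{2(\bar a+\bar bw)}\Big)e_{z_1,w_1},\qquad z_1=\frac{z}{\bar bw+\bar a},$$ for $z\in\mathbb C$, $|w|<1$, where $e_{z,w}=\exp(z\mathbf a^\dagger+w\mathbf K_+)(\varphi_0\otimes\phi_{k'0})$. For $h=(g,\alpha)$ put $\pi(h)=T(g)D(\alpha)$. **Statement.** All these exponential series converge on the vectors indicated, and each of the operators above exists as a bounded operator and is uniquely determined. Moreover: 1. The Heisenberg–Weyl matrix elements are $\langle\varphi_m|D(\alpha)|\varphi_n\rangle=\sqrt{\tfrac{n!}{m!}}\,\alpha^{m-n}L_n^{m-n}(|\alpha|^2)e^{-|\alpha|^2/2}$ for $m\ge n$, with $L_n^s$ the associated Laguerre polynomials, and $\langle\varphi_m|D(\alpha)|\varphi_n\rangle=\langle\varphi_n|D(-\bar\alpha)|\varphi_m\rangle$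 for all $m,n$. 2. For $l>0$, $|w|<1$ and $m'\ge m$, $$S_{lm'm}(w)=\Big[\tfrac{m'!\,\Gamma(2l+m')}{m!\,\Gamma(2l+m)}\Big]^{1/2}\tfrac{w^{m'-m}}{(m'-m)!}(1-|w|^2)^{l+m}F\Big(-m,1-2l-m;m'-m+1;\tfrac{-|w|^2}{1-|w|^2}\Big)$$ $$=\Big[\tfrac{m'!\,\Gamma(2l+m')}{m!\,\Gamma(2l+m)}\Big]^{1/2}\tfrac{w^{m'-m}}{(m'-m)!}(1-|w|^2)^{l}F(-m,2l+m';m'-m+1;|w|^2),$$ and $S_{lm'm}(w)=S_{lmm'}(-\bar w)$ for all $m,m'$. 3. For $\alpha\in\mathbb C$, $|w|,|w'|<1$, $\varepsilon\in\{0,1\}$ and $n',m',s,m\ge0$, with an absolutely convergent sum, $$\langle\varphi_{n'}\otimes\phi_{k'm'}|D(\alpha)S(w,w')|\varphi_{2s+\varepsilon}\otimes\phi_{k'm}\rangle=S_{k'm'm}(w')\sum_{s'\ge0}\langle\varphi_{n'}|D(\alpha)|\varphi_{2s'+\varepsilon}\rangle\,S_{1/4+\varepsilon/2,\,s's}(w).$$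 4. $S(w)=S(w,w)$; hence $\langle\varphi_{n'}\otimes\phi_{k'm'}|D(\alpha)S(w)|\varphi_{2s+\varepsilon}\otimes\phi_{k'm}\rangle$ is given by the right-hand side of 3 with $w'=w$. 5. $T(g)_l\phi_{lm}=(a/|a|)^{2(l+m)}S(b/\bar a)\phi_{lm}$ for every $l>0$, $m\ge 0$, and on $\mathcal F\otimes D^+_{k'}$ $$T(g)(\varphi_{2s+\varepsilon}\otimes\phi_{k'm})=(a/|a|)^{2(1/4+\varepsilon/2+s)}(a/|a|)^{2(k'+m)}\,S(b/\bar a)(\varphi_{2s+\varepsilon}\otimes\phi_{k'm}).$$ 6. For $h=(g,\alpha)$, $$\langle\varphi_{n'}\otimes\phi_{k'm'}|\pi(h)|\varphi_{2s+\varepsilon}\otimes\phi_{k'm}\rangle=\Big(\tfrac a{|a|}\Big)^{2(1/4+\varepsilon/2+s)}\Big(\tfrac a{|a|}\Big)^{2(k'+m)}S_{k'm'm}(\tfrac b{\bar a})\sum_{s'\ge0}\langle\varphi_{n'}|D(a\alpha+b\bar\alpha)|\varphi_{2s'+\varepsilon}\rangle\,S_{1/4+\varepsilon/2,\,s's}(\tfrac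 b{\bar a}).$$ -/

import Mathlib

open scoped ComplexConjugate TensorProduct
open UniformSpace (Completion)

noncomputable section

namespace JacobiGroup

/-! ### Exponentials of unbounded operators

An unbounded operator is given by a linear endomorphism `A` of a core `E`, where `j : E → H` embeds
the core in the Hilbert space `H`. -/

section Exponentials

variable {E H : Type*} [AddCommMonoid E] [Module ℂ E] [NormedAddCommGroup H] [InnerProductSpace ℂ H]

/-- `exp(A) x = y`: the vector `x` lies in the core and the exponential series
`∑ Aⁿ x / n!` converges in `H` to `y`. -/
def ExpMaps (j : E →ₗ[ℂ] H) (A : Module.End ℂ E) (x y : H) : Prop :=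
  ∃ u : E, j u = x ∧ HasSum (fun n : ℕ => (n.factorial : ℂ)⁻¹ • j ((A ^ n) u)) y

/-- The sum `exp(A) u = ∑ Aⁿ u / n!` of the exponential series at a core vector. -/
def expVec (j : E →ₗ[ℂ] H) (A : Module.End ℂ E) (u : E) : H :=
  ∑' n : ℕ, (n.factorial : ℂ)⁻¹ • j ((A ^ n) u)

/-- The bounded operator characterized by `P` (used only where there is exactly one). -/
def theOp (P : (H →L[ℂ] H) → Prop) : H →L[ℂ] H := Classical.epsilon P

/-- `U` is the displacement operator `exp(α a† - ᾱ a)`. -/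
def IsDisplacement (j : E →ₗ[ℂ] H) (ad a : Module.End ℂ E) (α : ℂ) (U : H →L[ℂ] H) : Prop :=
  ∀ u : E, ExpMaps j (α • ad + (-(conj α)) • a) (j u) (U (j u))

/-- `U` is the squeeze operator `exp(w K₊) exp(η K₀) exp(-w̄ K₋)`, `η = ln(1 - |w|²)`; the three
exponentials are applied successively to each vector of the core. -/
def IsSqueeze (j : E →ₗ[ℂ] H) (Kp K0 Km : Module.End ℂ E) (w : ℂ) (U : H →L[ℂ] H) : Prop :=
  ∀ u : E, ∃ x y : H,
    ExpMaps j (-(conj w) • Km) (j u) x ∧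
    ExpMaps j (((Real.log (1 - ‖w‖ ^ 2) : ℝ) : ℂ) • K0) x y ∧
    ExpMaps j (w • Kp) y (U (j u))

end Exponentials

/-! ### One mode: Fock space and the discrete series -/

/-- The finite linear combinations of the basis vectors. -/
abbrev Core : Type := ℕ →₀ ℂ

/-- The space `ℓ²(ℕ)`. It carries both the Fock space, with `φ n` the `n`-particle vector `φ_n`,
and the representation space of `D⁺_k`, with `φ m` the canonical basis vector `φ_{km}`. -/
abbrev Ell2 : Type := lp (fun _ : ℕ => ℂ) 2

/-- The canonical orthonormal basis. -/
def φ (n : ℕ) : Ell2 := lp.single 2 n 1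

/-- The basis vector as an element of the core. -/
def δ (n : ℕ) : Core := Finsupp.single n 1

/-- The embedding `δ n ↦ φ n` of the core. -/
def emb : Core →ₗ[ℂ] Ell2 := Finsupp.linearCombination ℂ φ

/-- Annihilation: `a φ_n = √n φ_{n-1}`. -/
def ann : Module.End ℂ Core :=
  Finsupp.linearCombination ℂ (fun n : ℕ => ((√(n : ℝ) : ℝ) : ℂ) • δ (n - 1))

/-- Creation: `a† φ_n = √(n+1) φ_{n+1}`. -/
def cre : Module.End ℂ Core :=
  Finsupp.linearCombination ℂ (fun n : ℕ => ((√((n : ℝ) + 1) : ℝ) : ℂ) • δ (n + 1))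

/-- The generator `K₊` in `D⁺_k`: `K₊ φ_{km} = [(m+1)(m+2k)]^{1/2} φ_{k,m+1}`. -/
def discKp (k : ℝ) : Module.End ℂ Core :=
  Finsupp.linearCombination ℂ
    (fun m : ℕ => ((√(((m : ℝ) + 1) * (m + 2 * k)) : ℝ) : ℂ) • δ (m + 1))

/-- The generator `K₀` in `D⁺_k`: `K₀ φ_{km} = (k+m) φ_{km}`. -/
def discK0 (k : ℝ) : Module.End ℂ Core :=
  Finsupp.linearCombination ℂ (fun m : ℕ => ((k + m : ℝ) : ℂ) • δ m)

/-- The generator `K₋` in `D⁺_k`: `K₋ φ_{km} = [m(m+2k-1)]^{1/2} φ_{k,m-1}`. -/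
def discKm (k : ℝ) : Module.End ℂ Core :=
  Finsupp.linearCombination ℂ
    (fun m : ℕ => ((√((m : ℝ) * (m + 2 * k - 1)) : ℝ) : ℂ) • δ (m - 1))

/-- The oscillator part `½ (a†)²` of `K₊`. -/
def oscKp : Module.End ℂ Core := (1 / 2 : ℂ) • cre ^ 2

/-- The oscillator part `½ (a†a + ½)` of `K₀`. -/
def oscK0 : Module.End ℂ Core := (1 / 2 : ℂ) • (cre * ann + (1 / 2 : ℂ) • 1)

/-- The oscillator part `½ a²` of `K₋`. -/
def oscKm : Module.End ℂ Core := (1 / 2 : ℂ) • ann ^ 2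

/-- The displacement operator `D(α)` on Fock space. -/
def fockD (α : ℂ) : Ell2 →L[ℂ] Ell2 := theOp (IsDisplacement emb cre ann α)

/-- The squeeze operator `S(w)` of `D⁺_k`. -/
def discS (k : ℝ) (w : ℂ) : Ell2 →L[ℂ] Ell2 :=
  theOp (IsSqueeze emb (discKp k) (discK0 k) (discKm k) w)

/-- The squeeze operator of the oscillator realization `K₊ = ½ (a†)²` etc. on Fock space. -/
def oscS (w : ℂ) : Ell2 →L[ℂ] Ell2 := theOp (IsSqueeze emb oscKp oscK0 oscKm w)

/-- The Heisenberg-Weyl matrix element `⟨φ_m| D(α) |φ_n⟩`. -/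
def elemD (α : ℂ) (m n : ℕ) : ℂ := inner ℂ (φ m) (fockD α (φ n))

/-- The matrix element `S_{k m' m}(w) = ⟨φ_{km'}| S(w) |φ_{km}⟩`. -/
def elemS (k : ℝ) (w : ℂ) (m' m : ℕ) : ℂ := inner ℂ (φ m') (discS k w (φ m))

/-- The associated Laguerre polynomial `L_n^s(x) = ∑ᵢ (-1)ⁱ C(n+s, n-i) xⁱ / i!`. -/
def laguerre (n s : ℕ) (x : ℝ) : ℝ :=
  ∑ i ∈ Finset.range (n + 1), (-1) ^ i * ((n + s).choose (n - i) : ℝ) * x ^ i / (i.factorial : ℝ)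

/-! ### The Hilbert tensor product of Fock space and `D⁺_κ`

The total Bargmann index is `κ + 1/4`. -/

/-- The Hilbert space tensor product. -/
abbrev TotalSpace : Type := Completion (Ell2 ⊗[ℂ] Ell2)

/-- The finite linear combinations of the vectors `φ_n ⊗ φ_{κm}`. -/
abbrev TotalCore : Type := Core ⊗[ℂ] Core

/-- The embedding of the core. -/
def totalEmb : TotalCore →ₗ[ℂ] TotalSpace :=
  (Completion.toComplL (𝕜 := ℂ) (E := Ell2 ⊗[ℂ] Ell2)).toLinearMap ∘ₗ TensorProduct.map emb emb

/-- The vector `u ⊗ v`. -/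
def tens (u v : Ell2) : TotalSpace := ((u ⊗ₜ[ℂ] v : Ell2 ⊗[ℂ] Ell2) : TotalSpace)

/-- The tensor product of two bounded operators. -/
def tensOp (A B : Ell2 →L[ℂ] Ell2) : TotalSpace →L[ℂ] TotalSpace :=
  (TensorProduct.mapL A B).completion

/-- The boson operator `a` on the total space. -/
def totalAnn : Module.End ℂ TotalCore := TensorProduct.map ann 1

/-- The boson operator `a†` on the total space. -/
def totalCre : Module.End ℂ TotalCore := TensorProduct.map cre 1

/-- `K₊ = ½ (a†)² + K'₊`, where `K'₊` acts in `D⁺_κ`. -/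
def totalKp (κ : ℝ) : Module.End ℂ TotalCore :=
  (1 / 2 : ℂ) • totalCre ^ 2 + TensorProduct.map 1 (discKp κ)

/-- `K₀ = ½ (a†a + ½) + K'₀`. -/
def totalK0 (κ : ℝ) : Module.End ℂ TotalCore :=
  (1 / 2 : ℂ) • (totalCre * totalAnn + (1 / 2 : ℂ) • 1) + TensorProduct.map 1 (discK0 κ)

/-- `K₋ = ½ a² + K'₋`. -/
def totalKm (κ : ℝ) : Module.End ℂ TotalCore :=
  (1 / 2 : ℂ) • totalAnn ^ 2 + TensorProduct.map 1 (discKm κ)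

/-- The displacement operator `D(α)` on the total space. -/
def totalD (α : ℂ) : TotalSpace →L[ℂ] TotalSpace :=
  theOp (IsDisplacement totalEmb totalCre totalAnn α)

/-- The squeeze operator `S(w)` built from the total generators `K₊, K₀, K₋`. -/
def totalS (κ : ℝ) (w : ℂ) : TotalSpace →L[ℂ] TotalSpace :=
  theOp (IsSqueeze totalEmb (totalKp κ) (totalK0 κ) (totalKm κ) w)

/-- The auxiliary operator `S(w, w')`: the squeeze operator of the oscillator part with parameter
`w`, tensored with that of the primed part with parameter `w'`. -/
def auxS (κ : ℝ) (w w' : ℂ) : TotalSpace →L[ℂ] TotalSpace := tensOp (oscS w) (discS κ w')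

/-! ### The representation of the Jacobi group -/

/-- An element of the universal covering group of `SU(1,1)`: a matrix `(a b; b̄ ā)` of
determinant one together with a value `ω` of the argument of `a`. The elements with `ω = arg a`
represent `SU(1,1)` itself. -/
structure CoverSU11 where
  a : ℂ
  b : ℂ
  ω : ℝ
  det_eq : ‖a‖ ^ 2 - ‖b‖ ^ 2 = 1
  arg_eq : a = (‖a‖ : ℂ) * Complex.exp (ω * Complex.I)

/-- The phase `(a/|a|)^{2r} = e^{2irω}`. -/
def phase (g : CoverSU11) (r : ℝ) : ℂ := Complex.exp (2 * r * g.ω * Complex.I)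

/-- The multiplier `(ā + b̄w)^{-2k} = e^{2ikω} |a|^{-2k} (1 + (b̄/ā) w)^{-2k}` on the disk; the last
power is the principal one. -/
def multiplier (k : ℝ) (g : CoverSU11) (w : ℂ) : ℂ :=
  phase g k * ((‖g.a‖ ^ (-2 * k) : ℝ) : ℂ) *
    (1 + conj g.b / conj g.a * w) ^ (((-2 * k : ℝ)) : ℂ)

/-- The action `w ↦ (aw + b)/(b̄w + ā)` on the disk. -/
def mobius (g : CoverSU11) (w : ℂ) : ℂ := (g.a * w + g.b) / (conj g.b * w + conj g.a)

/-- The coherent state `e_w = exp(w K₊) φ_{k0}` of `D⁺_k`. -/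
def discCoh (k : ℝ) (w : ℂ) : Ell2 := expVec emb (w • discKp k) (δ 0)

/-- The coherent state `e_{z,w} = exp(z a† + w K₊)(φ_0 ⊗ φ_{κ0})`. -/
def totalCoh (κ : ℝ) (z w : ℂ) : TotalSpace :=
  expVec totalEmb (z • totalCre + w • totalKp κ) (δ 0 ⊗ₜ[ℂ] δ 0)

/-- `U` acts on the coherent states of `D⁺_k` as `T(g)_k`. -/
def IsDiscT (k : ℝ) (g : CoverSU11) (U : Ell2 →L[ℂ] Ell2) : Prop :=
  ∀ w : ℂ, ‖w‖ < 1 → U (discCoh k w) = multiplier k g w • discCoh k (mobius g w)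

/-- `U` acts on the coherent states `e_{z,w}` as `T(g)_k` does, where `k = κ + 1/4`:
`T(g) e_{z,w} = (ā + b̄w)^{-2k} exp(-b̄z² / (2(ā + b̄w))) e_{z₁,w₁}`, `z₁ = z/(ā + b̄w)`. -/
def IsTotalT (κ : ℝ) (g : CoverSU11) (U : TotalSpace →L[ℂ] TotalSpace) : Prop :=
  ∀ z w : ℂ, ‖w‖ < 1 →
    U (totalCoh κ z w) =
      (multiplier (κ + 1 / 4) g w *
        Complex.exp (-(conj g.b * z ^ 2 / (2 * (conj g.a + conj g.b * w))))) •
        totalCoh κ (z / (conj g.a + conj g.b * w)) (mobius g w)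

/-- The operator `T(g)_k` in `D⁺_k`. -/
def discT (k : ℝ) (g : CoverSU11) : Ell2 →L[ℂ] Ell2 := theOp (IsDiscT k g)

/-- The operator `T(g)` on the total space. -/
def totalT (κ : ℝ) (g : CoverSU11) : TotalSpace →L[ℂ] TotalSpace := theOp (IsTotalT κ g)

/-- `π(h) = T(g) D(α)` for `h = (g, α)` in the covering Jacobi group. -/
def piOp (κ : ℝ) (g : CoverSU11) (α : ℂ) : TotalSpace →L[ℂ] TotalSpace :=
  (totalT κ g).comp (totalD α)

end JacobiGroup

end

open JacobiGroup

noncomputable section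

namespace JacobiGroup

/-! ### Basis vectors, cores and density -/

/-! The squeeze operators are given by successive exponential series on finite combinations of basis
vectors, a form in which boundedness is invisible. It becomes visible on coherent states. In the
discrete series the assignment `e_x ↦ diskMul · e_{diskMap x}` preserves the reproducing kernel `(1
- x̄y)^(-2k)` (`gram_disk`), and coherent states are total, so it extends to an isometry
(`exists_clm_of_gram`). Expanding the image of `e_x` in powers of `x` gives its matrix elements in
two shapes (`disc_apply_phi`): one is the entry of the product of exponentials
(`disc_apply_phi_eq`), so the isometry is the squeeze operator, and both turn into terminating
hypergeometric sums.

The displacement operator is treated likewise with the kernel `exp(x̄y)`. The Bargmann transform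
turns `a†` into multiplication by `x` and `a` into `d/dx`, which identifies the exponential series
with the isometry (`barg_expVec_dispGen`).

Fock space is `D⁺_{1/4} ⊕ D⁺_{3/4}`, the even and the odd levels, so the oscillator squeeze operator
is a sum of two discrete-series ones (`exists_osc_squeeze`). On the tensor product each generator is
a sum of two commuting parts, hence every exponential factorizes and `S(w) = S(w, w)`
(`SqueezeMaps.tens`, `isSqueeze_total`). Inserting the basis of the parity sector between `D(α)` and
`S(w)` gives the sum over `s'`.

With `ζ = b/ā`, the operator `T(g)` is `S(ζ)` after the rotation `exp(2iωK₀)`, which is diagonal in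
the basis and produces the phases. On Fock space this requires the action on Gaussian vectors
(`oscS_fockE`), obtained from the composition law `discS_comp`; uniqueness on the total space is
totality of the `e_{z,w}` (`eq_zero_of_totalCoh`). The last matrix elements follow from the
covariance `T(g) D(α) = D(aα + bᾱ) T(g)` (`totalT_totalD`). -/

lemma inner_phi_left (n : ℕ) (v : Ell2) : inner ℂ (φ n) v = v n := by
  rw [φ, lp.inner_single_left]; simp

lemma phi_apply (n m : ℕ) : φ n m = if m = n then 1 else 0 := by
  rw [φ, lp.single_apply, Pi.single_apply]

lemma inner_phi_phi (n m : ℕ) : inner ℂ (φ n) (φ m) = if n = m then 1 else 0 := by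
  rw [inner_phi_left, phi_apply]

@[simp] lemma norm_phi (n : ℕ) : ‖φ n‖ = 1 := by
  rw [φ, lp.norm_single (by norm_num)]; simp

lemma hasSum_phi (v : Ell2) : HasSum (fun n => v n • φ n) v := by
  convert lp.hasSum_single (p := 2) (by norm_num) v using 2 with n
  rw [φ, ← lp.single_smul]; simp

lemma ell2_ext {u v : Ell2} (h : ∀ n, u n = v n) : u = v := lp.ext (funext h)

@[simp] lemma emb_delta (n : ℕ) : emb (δ n) = φ n := by simp [emb, δ]

lemma emb_apply (u : Core) (n : ℕ) : emb u n = u n := by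
  induction u using Finsupp.induction_linear with
  | zero => simp
  | add f g hf hg => rw [map_add, lp.coeFn_add, Pi.add_apply, hf, hg, Finsupp.add_apply]
  | single m c =>
    simp only [emb, Finsupp.linearCombination_single, lp.coeFn_smul, Pi.smul_apply, phi_apply,
      Finsupp.single_apply, eq_comm (a := n)]
    simp

lemma emb_injective : Function.Injective emb := fun u v h => by
  ext n; rw [← emb_apply, ← emb_apply, h]

lemma dense_span_phi : Dense (Submodule.span ℂ (Set.range φ) : Set Ell2) := by
  intro v
  refine mem_closure_of_tendsto (hasSum_phi v) (Filter.Eventually.of_forall fun s => ?_)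
  exact Submodule.sum_mem _ fun n _ => Submodule.smul_mem _ _ (Submodule.subset_span ⟨n, rfl⟩)

lemma clm_ext_phi {H : Type*} [NormedAddCommGroup H] [NormedSpace ℂ H] {U V : Ell2 →L[ℂ] H}
    (h : ∀ n, U (φ n) = V (φ n)) : U = V :=
  ContinuousLinearMap.ext_on dense_span_phi (by rintro _ ⟨n, rfl⟩; exact h n)

lemma core_induction {P : Core → Prop} (u : Core) (zero : P 0)
    (add : ∀ u v, P u → P v → P (u + v)) (smul : ∀ (c : ℂ) u, P u → P (c • u))
    (delta : ∀ n, P (δ n)) : P u := by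
  induction u using Finsupp.induction_linear with
  | zero => exact zero
  | add f g hf hg => exact add _ _ hf hg
  | single m c =>
    have := smul c _ (delta m)
    rwa [δ, Finsupp.smul_single, smul_eq_mul, mul_one] at this

/-! ### The total space -/

/-- The vector `u ⊗ v`, as a continuous bilinear map. -/
def tensL : Ell2 →L[ℂ] Ell2 →L[ℂ] TotalSpace :=
  (ContinuousLinearMap.compL ℂ Ell2 (Ell2 ⊗[ℂ] Ell2) TotalSpace
    (Completion.toComplL (𝕜 := ℂ) (E := Ell2 ⊗[ℂ] Ell2))).comp (TensorProduct.mkL ℂ Ell2 Ell2)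

lemma tensL_apply (u v : Ell2) : tensL u v = tens u v := rfl

lemma inner_tens (u v u' v' : Ell2) :
    inner ℂ (tens u v) (tens u' v') = inner ℂ u u' * inner ℂ v v' := by
  rw [tens, tens, Completion.inner_coe, TensorProduct.inner_tmul]

lemma norm_tens (u v : Ell2) : ‖tens u v‖ = ‖u‖ * ‖v‖ := by
  rw [tens, Completion.norm_coe, TensorProduct.norm_tmul]

lemma totalEmb_tmul (u v : Core) : totalEmb (u ⊗ₜ v) = tens (emb u) (emb v) := rfl

lemma tensOp_tens (A B : Ell2 →L[ℂ] Ell2) (u v : Ell2) :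
    tensOp A B (tens u v) = tens (A u) (B v) := by
  rw [tensOp, tens, ContinuousLinearMap.completion_apply_coe, TensorProduct.mapL_tmul]; rfl

lemma totalEmb_injective : Function.Injective totalEmb := by
  refine (Completion.coe_injective _).comp ?_
  exact TensorProduct.map_injective_of_flat_flat _ _ emb_injective emb_injective

lemma clm_ext_tens {H : Type*} [NormedAddCommGroup H] [NormedSpace ℂ H] {U V : TotalSpace →L[ℂ] H}
    (h : ∀ n m, U (tens (φ n) (φ m)) = V (tens (φ n) (φ m))) : U = V := by
  have h1 : ∀ u v, U (tens u v) = V (tens u v) := by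
    intro u v
    have h2 : (U.comp (tensL.flip v)) = (V.comp (tensL.flip v)) := clm_ext_phi fun n => by
      have h3 : U.comp (tensL (φ n)) = V.comp (tensL (φ n)) := clm_ext_phi fun m => h n m
      exact DFunLike.congr_fun h3 v
    exact DFunLike.congr_fun h2 u
  ext x
  refine Completion.induction_on x (isClosed_eq U.continuous V.continuous) fun a => ?_
  induction a using TensorProduct.induction_on with
  | zero => exact (map_zero U).trans (map_zero V).symm
  | tmul u v => exact h1 u v
  | add a b ha hb => rw [Completion.coe_add, map_add, map_add, ha, hb]

/-! ### Operators determined by Gram matrices -/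

/-- Equal Gram matrices make the linear extension of `f i ↦ g i` well defined and isometric on the
span of `f`, hence extendable by density. The squeeze, displacement, parity and rotation operators
below all rest on this construction. -/
lemma exists_clm_of_gram {ι H K : Type*} [NormedAddCommGroup H] [InnerProductSpace ℂ H]
    [NormedAddCommGroup K] [InnerProductSpace ℂ K] [CompleteSpace K] (f : ι → H) (g : ι → K)
    (hf : Dense (Submodule.span ℂ (Set.range f) : Set H))
    (h : ∀ i j, inner ℂ (f i) (f j) = inner ℂ (g i) (g j)) :
    ∃ U : H →L[ℂ] K, ∀ i, U (f i) = g i := by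
  let F := Finsupp.linearCombination ℂ f
  let G := Finsupp.linearCombination ℂ g
  have hin : ∀ u v, inner ℂ (F u) (F v) = inner ℂ (G u) (G v) := by
    intro u v
    simp only [F, G, Finsupp.linearCombination_apply, Finsupp.sum_inner, Finsupp.inner_sum,
      inner_smul_left, inner_smul_right, h]
  have hd : DenseRange F := by
    rw [DenseRange, ← LinearMap.coe_range, Finsupp.range_linearCombination]; exact hf
  have hn : ∀ u, ‖G u‖ ≤ 1 * ‖F u‖ := fun u => by
    rw [one_mul, @norm_eq_sqrt_re_inner ℂ, @norm_eq_sqrt_re_inner ℂ, hin]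
  refine ⟨G.extendOfNorm F, fun i => ?_⟩
  have := LinearMap.extendOfNorm_eq hd ⟨1, hn⟩ (Finsupp.single i 1)
  simpa [F, G] using this

/-! ### Uniqueness of power series coefficients -/

/-- Used both to read off matrix elements from generating functions and to prove that coherent
states are total. -/
lemma hasSum_pow_unique {r : ℝ} (hr : 0 < r) {a b : ℕ → ℂ} {f : ℂ → ℂ}
    (ha : ∀ x : ℂ, ‖x‖ < r → HasSum (fun n => x ^ n * a n) (f x))
    (hb : ∀ x : ℂ, ‖x‖ < r → HasSum (fun n => x ^ n * b n) (f x)) (n : ℕ) : a n = b n := by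
  have key : ∀ c : ℕ → ℂ, (∀ x : ℂ, ‖x‖ < r → HasSum (fun n => x ^ n * c n) (f x)) →
      HasFPowerSeriesAt f (FormalMultilinearSeries.ofScalars ℂ c) 0 := by
    intro c hc
    rw [hasFPowerSeriesAt_iff]
    filter_upwards [Metric.ball_mem_nhds (0 : ℂ) hr] with x hx
    simpa using hc x (by simpa using hx)
  have := (key a ha).eq_formalMultilinearSeries (key b hb)
  rw [FormalMultilinearSeries.ofScalars_series_eq_iff] at this
  exact congrFun this n

/-! ### Absolutely convergent exponential series -/

section Exponentials

variable {E H E' H' : Type*} [AddCommMonoid E] [Module ℂ E] [NormedAddCommGroup H]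
  [InnerProductSpace ℂ H] [AddCommMonoid E'] [Module ℂ E'] [NormedAddCommGroup H']
  [InnerProductSpace ℂ H']

/-- The exponential series `∑ Aⁿ u / n!` converges absolutely. -/
def AbsExp (j : E →ₗ[ℂ] H) (A : Module.End ℂ E) (u : E) : Prop :=
  Summable fun n : ℕ => ‖(n.factorial : ℂ)⁻¹ • j ((A ^ n) u)‖

variable {j : E →ₗ[ℂ] H} {j' : E' →ₗ[ℂ] H'} {A X Y Kp K0 Km : Module.End ℂ E}
  {A' Kp' K0' Km' : Module.End ℂ E'} {u v : E} {w : ℂ} {x y : H}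

lemma AbsExp.hasSum [CompleteSpace H] (h : AbsExp j A u) :
    HasSum (fun n : ℕ => (n.factorial : ℂ)⁻¹ • j ((A ^ n) u)) (expVec j A u) :=
  (Summable.of_norm h).hasSum

lemma AbsExp.expMaps [CompleteSpace H] (h : AbsExp j A u) :
    ExpMaps j A (j u) (expVec j A u) := ⟨u, rfl, h.hasSum⟩

lemma AbsExp.zero : AbsExp j A 0 := by simp [AbsExp, summable_zero]

lemma expVec_zero : expVec j A 0 = 0 := by simp [expVec]

lemma AbsExp.add (hu : AbsExp j A u) (hv : AbsExp j A v) : AbsExp j A (u + v) := by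
  refine Summable.of_nonneg_of_le (fun _ => norm_nonneg _) (fun n => ?_) (Summable.add hu hv)
  rw [map_add, map_add, smul_add]
  exact norm_add_le _ _

lemma expVec_add [CompleteSpace H] (hu : AbsExp j A u) (hv : AbsExp j A v) :
    expVec j A (u + v) = expVec j A u + expVec j A v := by
  refine HasSum.tsum_eq ?_
  convert hu.hasSum.add hv.hasSum using 2 with n
  rw [map_add, map_add, smul_add]

lemma AbsExp.smul (c : ℂ) (hu : AbsExp j A u) : AbsExp j A (c • u) := by
  refine (Summable.mul_left ‖c‖ hu).congr fun n => ?_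
  rw [← norm_smul, map_smul, map_smul, smul_comm]

lemma expVec_smul [CompleteSpace H] (c : ℂ) (hu : AbsExp j A u) :
    expVec j A (c • u) = c • expVec j A u := by
  refine HasSum.tsum_eq ?_
  convert hu.hasSum.const_smul c using 2 with n
  rw [map_smul, map_smul, smul_comm]

lemma intertwine_pow {J : E →ₗ[ℂ] E'} (hA : ∀ u, J (A u) = A' (J u)) (n : ℕ) (u : E) :
    J ((A ^ n) u) = (A' ^ n) (J u) := by
  induction n generalizing u with
  | zero => rfl
  | succ n ih => rw [pow_succ, pow_succ, Module.End.mul_apply, Module.End.mul_apply, ih, hA]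

lemma AbsExp.intertwine {J : E →ₗ[ℂ] E'} {L : H →L[ℂ] H'} (hj : ∀ u, L (j u) = j' (J u))
    (hA : ∀ u, J (A u) = A' (J u)) (h : AbsExp j A u) : AbsExp j' A' (J u) := by
  refine Summable.of_nonneg_of_le (fun _ => norm_nonneg _) (fun n => ?_)
    (Summable.mul_left ‖L‖ h)
  rw [← intertwine_pow hA, ← hj, ← map_smul]
  exact L.le_opNorm _

lemma expVec_intertwine [CompleteSpace H] {J : E →ₗ[ℂ] E'} {L : H →L[ℂ] H'}
    (hj : ∀ u, L (j u) = j' (J u)) (hA : ∀ u, J (A u) = A' (J u)) (h : AbsExp j A u) :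
    expVec j' A' (J u) = L (expVec j A u) := by
  refine HasSum.tsum_eq ?_
  convert h.hasSum.mapL L using 2 with n
  rw [map_smul, hj, intertwine_pow hA]

lemma hasSum_antidiagonal {V : Type*} [NormedAddCommGroup V] {f : ℕ × ℕ → V}
    {s : V} (h : HasSum f s) :
    HasSum (fun n => ∑ p ∈ Finset.HasAntidiagonal.antidiagonal n, f p) s := by
  have h1 := (Finset.HasAntidiagonal.sigmaAntidiagonalEquivProd (A := ℕ)).hasSum_iff.mpr h
  refine (h1.sigma fun n => hasSum_fintype _).congr_fun fun n => ?_
  rw [← Finset.sum_coe_sort]; rfl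

/-- The binomial theorem for commuting `X` and `Y`: after division by `n!` the binomial coefficient
splits into the two factorials of a Cauchy product. -/
lemma smul_add_pow_apply (hXY : Commute X Y) (n : ℕ) :
    (n.factorial : ℂ)⁻¹ • j (((X + Y) ^ n) u) = ∑ p ∈ Finset.HasAntidiagonal.antidiagonal n,
      ((p.1.factorial : ℂ)⁻¹ * (p.2.factorial : ℂ)⁻¹) • j ((X ^ p.1) ((Y ^ p.2) u)) := by
  rw [hXY.add_pow', LinearMap.sum_apply, map_sum, Finset.smul_sum]
  refine Finset.sum_congr rfl fun p hp => ?_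
  rw [Finset.HasAntidiagonal.mem_antidiagonal] at hp
  rw [LinearMap.smul_apply, ← Nat.cast_smul_eq_nsmul ℂ, map_smul, smul_smul, Module.End.mul_apply]
  congr 1
  have h := Nat.add_choose_mul_factorial_mul_factorial p.1 p.2
  rw [hp, ← Nat.choose_symm_of_eq_add hp.symm] at h
  rw [← h]
  have h1 := Nat.cast_ne_zero (R := ℂ).mpr p.1.factorial_ne_zero
  have h2 := Nat.cast_ne_zero (R := ℂ).mpr p.2.factorial_ne_zero
  have h3 : (n.choose p.1 : ℂ) ≠ 0 :=
    Nat.cast_ne_zero.mpr (Nat.choose_pos (by omega)).ne'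
  push_cast
  field_simp

lemma AbsExp.of_commute (hXY : Commute X Y)
    (h : Summable fun p : ℕ × ℕ =>
      ‖((p.1.factorial : ℂ)⁻¹ * (p.2.factorial : ℂ)⁻¹) • j ((X ^ p.1) ((Y ^ p.2) u))‖) :
    AbsExp j (X + Y) u := by
  refine Summable.of_nonneg_of_le (fun _ => norm_nonneg _) (fun n => ?_)
    (hasSum_antidiagonal h.hasSum).summable
  rw [smul_add_pow_apply hXY]
  exact norm_sum_le _ _

lemma expVec_of_commute (hXY : Commute X Y) (h : HasSum (fun p : ℕ × ℕ =>
      ((p.1.factorial : ℂ)⁻¹ * (p.2.factorial : ℂ)⁻¹) • j ((X ^ p.1) ((Y ^ p.2) u))) x) :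
    expVec j (X + Y) u = x := by
  have h2 := hasSum_antidiagonal h
  simp only [← smul_add_pow_apply hXY] at h2
  exact h2.tsum_eq

/-! ### Squeeze operators -/

/-- `y = exp(w K₊) exp(η K₀) exp(-w̄ K₋) u`, with absolutely convergent series. -/
def SqueezeMaps (j : E →ₗ[ℂ] H) (Kp K0 Km : Module.End ℂ E) (w : ℂ) (u : E) (y : H) : Prop :=
  ∃ u₁ u₂ : E,
    (AbsExp j (-(conj w) • Km) u ∧ expVec j (-(conj w) • Km) u = j u₁) ∧
    (AbsExp j (((Real.log (1 - ‖w‖ ^ 2) : ℝ) : ℂ) • K0) u₁ ∧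
      expVec j (((Real.log (1 - ‖w‖ ^ 2) : ℝ) : ℂ) • K0) u₁ = j u₂) ∧
    (AbsExp j (w • Kp) u₂ ∧ expVec j (w • Kp) u₂ = y)

lemma SqueezeMaps.zero : SqueezeMaps j Kp K0 Km w 0 0 :=
  ⟨0, 0, ⟨.zero, by rw [expVec_zero, map_zero]⟩, ⟨.zero, by rw [expVec_zero, map_zero]⟩,
    .zero, expVec_zero⟩

lemma SqueezeMaps.add [CompleteSpace H] (hu : SqueezeMaps j Kp K0 Km w u x)
    (hv : SqueezeMaps j Kp K0 Km w v y) : SqueezeMaps j Kp K0 Km w (u + v) (x + y) := by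
  obtain ⟨u₁, u₂, ⟨a1, b1⟩, ⟨a2, b2⟩, a3, b3⟩ := hu
  obtain ⟨v₁, v₂, ⟨c1, d1⟩, ⟨c2, d2⟩, c3, d3⟩ := hv
  exact ⟨u₁ + v₁, u₂ + v₂, ⟨a1.add c1, by rw [expVec_add a1 c1, b1, d1, map_add]⟩,
    ⟨a2.add c2, by rw [expVec_add a2 c2, b2, d2, map_add]⟩,
    a3.add c3, by rw [expVec_add a3 c3, b3, d3]⟩

lemma SqueezeMaps.smul [CompleteSpace H] (c : ℂ) (hu : SqueezeMaps j Kp K0 Km w u x) :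
    SqueezeMaps j Kp K0 Km w (c • u) (c • x) := by
  obtain ⟨u₁, u₂, ⟨a1, b1⟩, ⟨a2, b2⟩, a3, b3⟩ := hu
  exact ⟨c • u₁, c • u₂, ⟨a1.smul c, by rw [expVec_smul c a1, b1, map_smul]⟩,
    ⟨a2.smul c, by rw [expVec_smul c a2, b2, map_smul]⟩,
    a3.smul c, by rw [expVec_smul c a3, b3]⟩

/-- Transports squeeze operators along the parity isometries, which carry the generators of
`D⁺_{1/4}` and `D⁺_{3/4}` to those of Fock space. -/
lemma SqueezeMaps.intertwine [CompleteSpace H] {J : E →ₗ[ℂ] E'} {L : H →L[ℂ] H'}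
    (hj : ∀ u, L (j u) = j' (J u)) (hp : ∀ u, J (Kp u) = Kp' (J u))
    (h0 : ∀ u, J (K0 u) = K0' (J u)) (hm : ∀ u, J (Km u) = Km' (J u))
    (hu : SqueezeMaps j Kp K0 Km w u x) : SqueezeMaps j' Kp' K0' Km' w (J u) (L x) := by
  have hc : ∀ (c : ℂ) {A : Module.End ℂ E} {A' : Module.End ℂ E'},
      (∀ u, J (A u) = A' (J u)) → ∀ u, J ((c • A) u) = (c • A') (J u) := by
    intro c A A' h u
    rw [LinearMap.smul_apply, LinearMap.smul_apply, map_smul, h]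
  obtain ⟨u₁, u₂, ⟨a1, b1⟩, ⟨a2, b2⟩, a3, b3⟩ := hu
  exact ⟨J u₁, J u₂,
    ⟨a1.intertwine hj (hc _ hm), by rw [expVec_intertwine hj (hc _ hm) a1, b1, hj]⟩,
    ⟨a2.intertwine hj (hc _ h0), by rw [expVec_intertwine hj (hc _ h0) a2, b2, hj]⟩,
    a3.intertwine hj (hc _ hp), by rw [expVec_intertwine hj (hc _ hp) a3, b3]⟩

lemma IsSqueeze.of_squeezeMaps [CompleteSpace H] {U : H →L[ℂ] H}
    (h : ∀ u, SqueezeMaps j Kp K0 Km w u (U (j u))) : IsSqueeze j Kp K0 Km w U := by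
  intro u
  obtain ⟨u₁, u₂, ⟨a1, b1⟩, ⟨a2, b2⟩, a3, b3⟩ := h u
  refine ⟨j u₁, j u₂, ?_, ?_, ?_⟩
  · rw [← b1]; exact a1.expMaps
  · rw [← b2]; exact a2.expMaps
  · rw [← b3]; exact a3.expMaps

/-- Injectivity of `j` is essential: `ExpMaps` sees only the image of the core vector, while the
series depends on the vector itself. -/
lemma ExpMaps.unique (hj : Function.Injective j) {x' : H} (h : ExpMaps j A x y)
    (h' : ExpMaps j A x x') : y = x' := by
  obtain ⟨u, rfl, h1⟩ := h
  obtain ⟨v, hv, h2⟩ := h'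
  obtain rfl := hj hv
  exact h1.unique h2

lemma IsSqueeze.unique (hj : Function.Injective j) {U V : H →L[ℂ] H}
    (hU : IsSqueeze j Kp K0 Km w U) (hV : IsSqueeze j Kp K0 Km w V) (u : E) :
    U (j u) = V (j u) := by
  obtain ⟨x, y, h1, h2, h3⟩ := hU u
  obtain ⟨x', y', h1', h2', h3'⟩ := hV u
  obtain rfl := h1.unique hj h1'
  obtain rfl := h2.unique hj h2'
  exact h3.unique hj h3'

lemma IsDisplacement.unique (hj : Function.Injective j) {α : ℂ} {U V : H →L[ℂ] H}
    (hU : IsDisplacement j Kp Km α U) (hV : IsDisplacement j Kp Km α V) (u : E) :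
    U (j u) = V (j u) := (hU u).unique hj (hV u)

lemma theOp_eq {P : (H →L[ℂ] H) → Prop} {U : H →L[ℂ] H} (h : ∃! V, P V) (hU : P U) :
    theOp P = U :=
  h.unique (Classical.epsilon_spec h.exists) hU

end Exponentials

/-! ### Tensor products of exponentials -/

variable {A B : Module.End ℂ Core} {u v : Core}

lemma map_one_pow (A : Module.End ℂ Core) (n : ℕ) :
    (TensorProduct.map A 1 : Module.End ℂ TotalCore) ^ n = TensorProduct.map (A ^ n) 1 := by
  rw [TensorProduct.map_pow, one_pow]

lemma one_map_pow (A : Module.End ℂ Core) (n : ℕ) :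
    (TensorProduct.map 1 A : Module.End ℂ TotalCore) ^ n = TensorProduct.map 1 (A ^ n) := by
  rw [TensorProduct.map_pow, one_pow]

lemma commute_map (A B : Module.End ℂ Core) :
    Commute (TensorProduct.map A 1 : Module.End ℂ TotalCore) (TensorProduct.map 1 B) := by
  rw [Commute, SemiconjBy, ← TensorProduct.map_mul, ← TensorProduct.map_mul]
  simp only [mul_one, one_mul]

lemma tens_exp_term (A B : Module.End ℂ Core) (u v : Core) (p : ℕ × ℕ) :
    ((p.1.factorial : ℂ)⁻¹ * (p.2.factorial : ℂ)⁻¹) •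
      totalEmb (((TensorProduct.map A 1 : Module.End ℂ TotalCore) ^ p.1)
        (((TensorProduct.map 1 B : Module.End ℂ TotalCore) ^ p.2) (u ⊗ₜ v))) =
    tensL ((p.1.factorial : ℂ)⁻¹ • emb ((A ^ p.1) u))
      ((p.2.factorial : ℂ)⁻¹ • emb ((B ^ p.2) v)) := by
  rw [map_one_pow, one_map_pow, TensorProduct.map_tmul, TensorProduct.map_tmul, totalEmb_tmul,
    map_smul, map_smul, smul_apply, tensL_apply, smul_smul, mul_comm]
  rfl

lemma summable_norm_tensL {a b : ℕ → Ell2} (ha : Summable fun n => ‖a n‖)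
    (hb : Summable fun n => ‖b n‖) : Summable fun p : ℕ × ℕ => ‖tensL (a p.1) (b p.2)‖ := by
  refine (Summable.mul_of_nonneg ha hb (fun _ => norm_nonneg _) (fun _ => norm_nonneg _)).congr ?_
  intro p
  rw [tensL_apply, norm_tens]

/-- Norms multiply on product vectors, so the double series converges absolutely and may be summed
one index at a time. -/
lemma hasSum_tensL {a b : ℕ → Ell2} {x y : Ell2} (ha : Summable fun n => ‖a n‖)
    (hb : Summable fun n => ‖b n‖) (hx : HasSum a x) (hy : HasSum b y) :
    HasSum (fun p : ℕ × ℕ => tensL (a p.1) (b p.2)) (tensL x y) := by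
  have h2 := (Summable.of_norm (summable_norm_tensL ha hb)).hasSum
  have h3 := HasSum.prod_fiberwise h2 fun i => hy.mapL (tensL (a i))
  have h4 := hx.mapL (tensL.flip y)
  rwa [h3.unique h4] at h2

lemma AbsExp.summable_tens (hA : AbsExp emb A u) (hB : AbsExp emb B v) :
    Summable fun p : ℕ × ℕ => ‖((p.1.factorial : ℂ)⁻¹ * (p.2.factorial : ℂ)⁻¹) •
      totalEmb (((TensorProduct.map A 1 : Module.End ℂ TotalCore) ^ p.1)
        (((TensorProduct.map 1 B : Module.End ℂ TotalCore) ^ p.2) (u ⊗ₜ v)))‖ :=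
  (summable_norm_tensL hA hB).congr fun p => by rw [tens_exp_term]

lemma AbsExp.tens (hA : AbsExp emb A u) (hB : AbsExp emb B v) :
    AbsExp totalEmb (TensorProduct.map A 1 + TensorProduct.map 1 B) (u ⊗ₜ v) :=
  .of_commute (commute_map A B) (hA.summable_tens hB)

lemma expVec_tens (hA : AbsExp emb A u) (hB : AbsExp emb B v) :
    expVec totalEmb (TensorProduct.map A 1 + TensorProduct.map 1 B) (u ⊗ₜ v) =
      JacobiGroup.tens (expVec emb A u) (expVec emb B v) := by
  refine expVec_of_commute (commute_map A B) ?_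
  have h2 := hasSum_tensL (a := fun n => (n.factorial : ℂ)⁻¹ • emb ((A ^ n) u))
    (b := fun n => (n.factorial : ℂ)⁻¹ • emb ((B ^ n) v)) hA hB hA.hasSum hB.hasSum
  simp only [tens_exp_term]
  exact h2

/-- Each generator is `A ⊗ 1 + 1 ⊗ B` with commuting summands, so each of the three exponentials
acts factor by factor. The intermediate vectors remain in the core, being tensor products of core
vectors. -/
lemma SqueezeMaps.tens {Kp K0 Km Kp' K0' Km' : Module.End ℂ Core} {w : ℂ} {x y : Ell2}
    (hu : SqueezeMaps emb Kp K0 Km w u x) (hv : SqueezeMaps emb Kp' K0' Km' w v y) :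
    SqueezeMaps totalEmb (TensorProduct.map Kp 1 + TensorProduct.map 1 Kp')
      (TensorProduct.map K0 1 + TensorProduct.map 1 K0')
      (TensorProduct.map Km 1 + TensorProduct.map 1 Km') w (u ⊗ₜ v) (JacobiGroup.tens x y) := by
  have hc : ∀ (c : ℂ) (A B : Module.End ℂ Core), c • (TensorProduct.map A 1 +
      TensorProduct.map 1 B : Module.End ℂ TotalCore) =
      TensorProduct.map (c • A) 1 + TensorProduct.map 1 (c • B) := by
    intro c A B
    rw [smul_add, TensorProduct.map_smul_left, TensorProduct.map_smul_right]
  obtain ⟨u₁, u₂, ⟨a1, b1⟩, ⟨a2, b2⟩, a3, b3⟩ := hu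
  obtain ⟨v₁, v₂, ⟨c1, d1⟩, ⟨c2, d2⟩, c3, d3⟩ := hv
  refine ⟨u₁ ⊗ₜ v₁, u₂ ⊗ₜ v₂, ?_, ?_, ?_⟩ <;> rw [hc]
  · exact ⟨a1.tens c1, by rw [expVec_tens a1 c1, b1, d1, totalEmb_tmul]⟩
  · exact ⟨a2.tens c2, by rw [expVec_tens a2 c2, b2, d2, totalEmb_tmul]⟩
  · exact ⟨a3.tens c3, by rw [expVec_tens a3 c3, b3, d3]⟩

/-! ### Weighted shifts -/

lemma hasSum_coord {ι : Type*} {f : ι → Ell2} {v : Ell2} (h : HasSum f v) (p : ℕ) :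
    HasSum (fun i => f i p) (v p) := by
  have := h.mapL (innerSL ℂ (φ p))
  simpa only [innerSL_apply_apply, inner_phi_left] using this

lemma absExp_of_delta {H : Type*} [NormedAddCommGroup H] [InnerProductSpace ℂ H] [CompleteSpace H]
    {j : Core →ₗ[ℂ] H} {A : Module.End ℂ Core} (F : Core →ₗ[ℂ] H)
    (h : ∀ m, AbsExp j A (δ m) ∧ expVec j A (δ m) = F (δ m)) (u : Core) :
    AbsExp j A u ∧ expVec j A u = F u := by
  refine core_induction (P := fun u => AbsExp j A u ∧ expVec j A u = F u) u ⟨.zero, by rw [expVec_zero, map_zero]⟩ ?_ ?_ h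
  · rintro u v ⟨h1, h2⟩ ⟨h3, h4⟩
    exact ⟨h1.add h3, by rw [expVec_add h1 h3, h2, h4, map_add]⟩
  · rintro c u ⟨h1, h2⟩
    exact ⟨h1.smul c, by rw [expVec_smul c h1, h2, map_smul]⟩

/-- The matrix elements of `exp(w K₊) exp(η K₀) exp(-w̄ K₋)` for weighted shifts `K₊`, `K₋` with
weights `γ (m + 1) / γ m` and diagonal `K₀` with entries `k + m`. -/
def squeezeCoef (γ : ℕ → ℝ) (k : ℝ) (w : ℂ) (p m : ℕ) : ℂ :=
  ∑ n ∈ Finset.range (min p m + 1),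
    ((γ p * γ m / γ n ^ 2 * (1 - ‖w‖ ^ 2) ^ (k + n) : ℝ) : ℂ) *
      (w ^ (p - n) / (p - n).factorial) * ((-conj w) ^ (m - n) / (m - n).factorial)

/-- Exchanging `p` and `m` swaps the raising and lowering factors, and `w ↦ -w̄` swaps their
parameters back. -/
lemma squeezeCoef_symm (γ : ℕ → ℝ) (k : ℝ) (w : ℂ) (p m : ℕ) :
    squeezeCoef γ k w p m = squeezeCoef γ k (-conj w) m p := by
  simp only [squeezeCoef, min_comm p m]
  refine Finset.sum_congr rfl fun n _ => ?_
  simp only [norm_neg, RCLike.norm_conj, map_neg, Complex.conj_conj, neg_neg]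
  rw [mul_comm (γ p)]
  ring

section Shift

variable {γ : ℕ → ℝ} {K L K0 : Module.End ℂ Core} (hγ : ∀ n, γ n ≠ 0)
  (hK : ∀ m, K (δ m) = ((γ (m + 1) / γ m : ℝ) : ℂ) • δ (m + 1))
  (hL : ∀ m, L (δ (m + 1)) = ((γ (m + 1) / γ m : ℝ) : ℂ) • δ m) (hL0 : L (δ 0) = 0)

include hγ hK in
-- Writing the weights as ratios `γ (m + 1) / γ m` makes their product telescope.
lemma shift_up_pow (i m : ℕ) :
    (K ^ i) (δ m) = ((γ (m + i) / γ m : ℝ) : ℂ) • δ (m + i) := by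
  induction i with
  | zero => simp [div_self (hγ m)]
  | succ i ih =>
    rw [pow_succ', Module.End.mul_apply, ih, map_smul, hK, smul_smul, ← Complex.ofReal_mul]
    congr 2
    have := hγ (m + i)
    field_simp
    rfl

include hγ hL in
lemma shift_down_pow (i n : ℕ) :
    (L ^ i) (δ (n + i)) = ((γ (n + i) / γ n : ℝ) : ℂ) • δ n := by
  induction i with
  | zero => simp [div_self (hγ n)]
  | succ i ih =>
    rw [pow_succ, Module.End.mul_apply, ← add_assoc, hL, map_smul, ih, smul_smul,
      ← Complex.ofReal_mul]
    congr 2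
    have := hγ (n + i)
    field_simp

include hγ hL hL0 in
lemma shift_down_pow_eq_zero {i m : ℕ} (h : m < i) : (L ^ i) (δ m) = 0 := by
  obtain ⟨d, rfl⟩ := Nat.exists_eq_add_of_lt h
  have h1 := shift_down_pow hγ hL m 0
  rw [zero_add] at h1
  rw [add_right_comm, add_assoc, add_comm, pow_add, Module.End.mul_apply, h1, map_smul,
    add_comm 1 d, pow_succ, Module.End.mul_apply, hL0, map_zero, smul_zero]

include hγ hL hL0 in
-- `L` is locally nilpotent, so the series is finite and its sum lies in the core, where the next
-- exponential can be applied.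
lemma exp_shift_down (v : ℂ) (m : ℕ) :
    AbsExp emb (v • L) (δ m) ∧ expVec emb (v • L) (δ m) =
      emb (∑ n ∈ Finset.range (m + 1),
        (((γ m / γ n : ℝ) : ℂ) * (v ^ (m - n) / (m - n).factorial)) • δ n) := by
  have h0 : ∀ i ∉ Finset.range (m + 1),
      (i.factorial : ℂ)⁻¹ • emb (((v • L) ^ i) (δ m)) = 0 := by
    intro i hi
    rw [smul_pow, LinearMap.smul_apply, shift_down_pow_eq_zero hγ hL hL0 (by simpa using hi)]
    simp
  refine ⟨summable_of_ne_finset_zero (s := Finset.range (m + 1)) fun i hi => by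
    rw [h0 i hi, norm_zero], ?_⟩
  -- Reflection replaces the number of lowering steps by the level `n` that is reached.
  rw [expVec, tsum_eq_sum h0, map_sum, ← Finset.sum_range_reflect]
  refine Finset.sum_congr rfl fun n hn => ?_
  have hn : n ≤ m := by simpa [Nat.lt_succ_iff] using hn
  have h1 := shift_down_pow hγ hL (m - n) n
  rw [Nat.add_sub_cancel' hn] at h1
  rw [add_tsub_cancel_right, smul_pow, LinearMap.smul_apply, h1, map_smul, map_smul, map_smul,
    smul_smul, smul_smul]
  congr 1
  ring

include hγ hK in
lemma exp_shift_up_term (w : ℂ) (m i : ℕ) :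
    (i.factorial : ℂ)⁻¹ • emb (((w • K) ^ i) (δ m)) =
      (w ^ i / i.factorial * ((γ (m + i) / γ m : ℝ) : ℂ)) • φ (m + i) := by
  rw [smul_pow, LinearMap.smul_apply, shift_up_pow hγ hK, map_smul, map_smul, smul_smul,
    smul_smul, emb_delta]
  congr 1
  ring

include hγ hK in
lemma absExp_shift_up (w : ℂ) (m : ℕ)
    (h : Summable fun i => ‖w‖ ^ i / i.factorial * |γ (m + i)|) : AbsExp emb (w • K) (δ m) := by
  refine (h.mul_right |(γ m)⁻¹|).congr fun i => ?_
  rw [exp_shift_up_term hγ hK, norm_smul, norm_phi, norm_mul, norm_div, norm_pow,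
    Complex.norm_natCast, Complex.norm_real, Real.norm_eq_abs, div_eq_mul_inv (γ _), abs_mul]
  ring

include hγ hK in
lemma expVec_shift_up_apply (w : ℂ) (m p : ℕ) (h : AbsExp emb (w • K) (δ m)) :
    expVec emb (w • K) (δ m) p =
      if m ≤ p then w ^ (p - m) / (p - m).factorial * ((γ p / γ m : ℝ) : ℂ) else 0 := by
  have h1 := hasSum_coord h.hasSum p
  simp only [exp_shift_up_term hγ hK, lp.coeFn_smul, Pi.smul_apply, phi_apply, smul_eq_mul] at h1
  refine h1.unique ?_
  split_ifs with hmp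
  · convert hasSum_single (p - m) ?_ using 1
    · rw [if_pos (by omega), Nat.add_sub_cancel' hmp, mul_one]
    · intro i hi
      rw [if_neg (by omega), mul_zero]
  · convert hasSum_zero with i
    rw [if_neg (by omega), mul_zero]

lemma exp_diagonal {c : ℕ → ℂ} (h0 : ∀ m, K0 (δ m) = c m • δ m) (t : ℂ) (m : ℕ) :
    AbsExp emb (t • K0) (δ m) ∧ expVec emb (t • K0) (δ m) = emb (Complex.exp (t * c m) • δ m) := by
  have hp : ∀ n, ((t • K0) ^ n) (δ m) = (t * c m) ^ n • δ m := by
    intro n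
    induction n with
    | zero => simp
    | succ n ih =>
      rw [pow_succ', Module.End.mul_apply, ih, map_smul, LinearMap.smul_apply, h0, smul_smul,
        smul_smul]
      congr 1; ring
  have ht : ∀ n : ℕ, (n.factorial : ℂ)⁻¹ • emb (((t • K0) ^ n) (δ m)) =
      ((t * c m) ^ n / n.factorial) • φ m := by
    intro n
    rw [hp, map_smul, emb_delta, smul_smul]
    congr 1; ring
  constructor
  · have := (NormedSpace.expSeries_div_summable (t * c m)).norm
    refine this.congr fun n => ?_
    rw [ht, norm_smul, norm_phi, mul_one]
  · rw [expVec]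
    simp only [ht]
    have := (NormedSpace.expSeries_div_hasSum_exp (t * c m)).smul_const (φ m)
    rw [← Complex.exp_eq_exp_ℂ] at this
    rw [this.tsum_eq, map_smul, emb_delta]

include hγ hK hL hL0 in
-- The level `m` is lowered to `n`, scaled by `exp(η(k + n)) = (1 - |w|²)^(k + n)`, and raised to
-- `p`; summing over the turning level `n` gives `squeezeCoef`.
lemma exists_squeezeMaps_shift {k : ℝ} (h0 : ∀ m : ℕ, K0 (δ m) = ((k + m : ℝ) : ℂ) • δ m)
    {w : ℂ} (hw : ‖w‖ < 1)
    (hs : ∀ m, Summable fun i => ‖w‖ ^ i / i.factorial * |γ (m + i)|) (m : ℕ) :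
    ∃ y, SqueezeMaps emb K K0 L w (δ m) y ∧ ∀ p, y p = squeezeCoef γ k w p m := by
  have hpos : 0 < 1 - ‖w‖ ^ 2 := by nlinarith [norm_nonneg w]
  set η : ℂ := ((Real.log (1 - ‖w‖ ^ 2) : ℝ) : ℂ) with hη
  have hd := absExp_of_delta (A := η • K0)
    (emb ∘ₗ Finsupp.linearCombination ℂ fun n => Complex.exp (η * ((k + n : ℝ) : ℂ)) • δ n)
    fun n => by
      have := exp_diagonal h0 η n
      simpa [δ] using this
  have hu := absExp_of_delta (A := w • K)
    (Finsupp.linearCombination ℂ fun n => expVec emb (w • K) (δ n))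
    fun n => ⟨absExp_shift_up hγ hK w n (hs n), by simp [δ]⟩
  obtain ⟨a1, b1⟩ := exp_shift_down hγ hL hL0 (-(conj w)) m
  obtain ⟨a2, b2⟩ := hd (∑ n ∈ Finset.range (m + 1),
    (((γ m / γ n : ℝ) : ℂ) * ((-(conj w)) ^ (m - n) / (m - n).factorial)) • δ n)
  refine ⟨_, ⟨_, _, ⟨a1, b1⟩, ⟨a2, b2⟩, (hu _).1, rfl⟩, fun p => ?_⟩
  rw [(hu _).2]
  simp only [map_sum, map_smul, δ, Finsupp.linearCombination_single, one_smul, lp.coeFn_sum,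
    Finset.sum_apply, lp.coeFn_smul, Pi.smul_apply, smul_eq_mul]
  rw [squeezeCoef]
  -- Levels `n > p` contribute nothing, since raising cannot bring them down to `p`.
  have hsub : Finset.range (min p m + 1) ⊆ Finset.range (m + 1) :=
    Finset.range_mono (by omega)
  rw [← Finset.sum_subset hsub]
  · refine Finset.sum_congr rfl fun n hn => ?_
    have hn : n ≤ p := by simp at hn; omega
    have h1 := expVec_shift_up_apply hγ hK w n p (absExp_shift_up hγ hK w n (hs n))
    simp only [δ] at h1
    rw [h1, if_pos hn, hη, ← Complex.ofReal_mul, ← Complex.ofReal_exp,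
      ← Real.rpow_def_of_pos hpos]
    push_cast
    field_simp
  · intro n hn hn'
    have h1 := expVec_shift_up_apply hγ hK w n p (absExp_shift_up hγ hK w n (hs n))
    simp only [δ] at h1
    rw [h1, if_neg (by simp at hn hn'; omega), mul_zero, mul_zero]

end Shift

/-- Ratio test: the ratio of successive terms is at most `‖w‖ (c(m + i) + C) / (i + 1)`, and this
bound tends to `‖w‖ c < 1`. -/
lemma summable_shift_weights {γ : ℕ → ℝ} (hγ : ∀ n, 0 < γ n) {c C : ℝ} {w : ℂ}
    (hb : ∀ i : ℕ, γ (i + 1) ≤ (c * i + C) * γ i) (hw : ‖w‖ * c < 1) (m : ℕ) :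
    Summable fun i => ‖w‖ ^ i / i.factorial * |γ (m + i)| := by
  obtain ⟨r, hr1, hr2⟩ := exists_between hw
  refine summable_of_ratio_norm_eventually_le (r := r) hr2 ?_
  -- This `N` solves the linear inequality `‖w‖ (c(m + i) + C) ≤ r (i + 1)` for `i`.
  obtain ⟨N, hN⟩ := exists_nat_gt ((‖w‖ * (c * m + C) - r) / (r - ‖w‖ * c))
  filter_upwards [Filter.eventually_ge_atTop N] with i hi
  have hi' : (N : ℝ) ≤ i := by exact_mod_cast hi
  have h1 : ‖w‖ * (c * ((m + i : ℕ) : ℝ) + C) ≤ r * (i + 1) := by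
    have h2 := hN.le.trans hi'
    rw [div_le_iff₀ (by linarith)] at h2
    push_cast
    linarith
  have hp := hγ (m + i)
  have hp' := hγ (m + (i + 1))
  have hf : (0 : ℝ) < i.factorial := by positivity
  rw [Real.norm_of_nonneg (by positivity), Real.norm_of_nonneg (by positivity), abs_of_pos hp,
    abs_of_pos hp', Nat.factorial_succ, pow_succ]
  push_cast
  calc ‖w‖ ^ i * ‖w‖ / ((i + 1) * i.factorial) * γ (m + (i + 1))
      ≤ ‖w‖ ^ i * ‖w‖ / ((i + 1) * i.factorial) * ((c * ((m + i : ℕ) : ℝ) + C) * γ (m + i)) := by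
        gcongr
        exact hb (m + i)
    _ = ‖w‖ * (c * ((m + i : ℕ) : ℝ) + C) * (‖w‖ ^ i / ((i + 1) * i.factorial) * γ (m + i)) := by
        ring
    _ ≤ r * (i + 1) * (‖w‖ ^ i / ((i + 1) * i.factorial) * γ (m + i)) := by gcongr
    _ = r * (‖w‖ ^ i / i.factorial * γ (m + i)) := by field_simp

/-! ### Weights of Fock space and of the discrete series -/

/-- The weights `√n!` of Fock space. -/
def fockW (n : ℕ) : ℝ := √(n.factorial : ℝ)

/-- The rising factorial `a (a + 1) ⋯ (a + n - 1)`. -/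
def rise (a : ℝ) (n : ℕ) : ℝ := (ascPochhammer ℝ n).eval a

/-- The weights `√(n! (2k)ₙ)` of the discrete series. -/
def discW (k : ℝ) (n : ℕ) : ℝ := √(n.factorial * rise (2 * k) n)

@[simp] lemma rise_zero (a : ℝ) : rise a 0 = 1 := by simp [rise]

lemma rise_succ (a : ℝ) (n : ℕ) : rise a (n + 1) = rise a n * (a + n) :=
  ascPochhammer_succ_eval n a

lemma rise_pos {a : ℝ} (ha : 0 < a) (n : ℕ) : 0 < rise a n := ascPochhammer_pos n a ha

lemma rise_add (a : ℝ) (n i : ℕ) : rise a (n + i) = rise a n * rise (a + n) i := by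
  induction i with
  | zero => simp
  | succ i ih => rw [← add_assoc, rise_succ, ih, rise_succ]; push_cast; ring

lemma Gamma_add_nat {a : ℝ} (ha : 0 < a) (n : ℕ) :
    Real.Gamma (a + n) = Real.Gamma a * rise a n := by
  induction n with
  | zero => simp
  | succ n ih =>
    have : a + (n + 1 : ℕ) = a + n + 1 := by push_cast; ring
    rw [this, Real.Gamma_add_one (by positivity), ih, rise_succ]
    ring

lemma hasSum_one_sub_cpow (a : ℝ) {y : ℂ} (hy : ‖y‖ < 1) :
    HasSum (fun n : ℕ => y ^ n * ((rise a n / n.factorial : ℝ) : ℂ)) ((1 - y) ^ (-(a : ℂ))) := by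
  have h := (Complex.one_div_one_sub_cpow_hasFPowerSeriesOnBall_zero (a : ℂ)).hasSum
    (y := y) (by simpa [enorm_eq_nnnorm, ← NNReal.coe_lt_coe] using hy)
  rw [zero_add, one_div, ← Complex.cpow_neg] at h
  refine HasSum.congr_fun h fun n => ?_
  rw [FormalMultilinearSeries.ofScalars_apply_eq, smul_eq_mul, mul_comm]
  congr 1
  rw [Ring.choose, show (a : ℂ) + n - 1 - n + 1 = a by ring]
  have h1 := Ring.factorial_nsmul_multichoose_eq_ascPochhammer (a : ℂ) n
  have h2 : (n.factorial : ℂ) ≠ 0 := Nat.cast_ne_zero.mpr n.factorial_ne_zero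
  rw [Polynomial.ascPochhammer_smeval_eq_eval, nsmul_eq_mul] at h1
  rw [Complex.ofReal_div, Complex.ofReal_natCast, div_eq_iff h2, mul_comm, h1, rise]
  rw [← ascPochhammer_map (algebraMap ℝ ℂ), Polynomial.eval_map_algebraMap,
    ← Complex.coe_algebraMap, Polynomial.aeval_algebraMap_apply, Polynomial.coe_aeval_eq_eval]

lemma fockW_pos (n : ℕ) : 0 < fockW n := Real.sqrt_pos.mpr (by positivity)

lemma fockW_sq (n : ℕ) : fockW n ^ 2 = n.factorial := Real.sq_sqrt (by positivity)

@[simp] lemma fockW_zero : fockW 0 = 1 := by simp [fockW]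

lemma fockW_succ (n : ℕ) : fockW (n + 1) = √((n : ℝ) + 1) * fockW n := by
  rw [fockW, fockW, ← Real.sqrt_mul (by positivity), Nat.factorial_succ]
  push_cast; rfl

lemma discW_arg_pos {k : ℝ} (hk : 0 < k) (n : ℕ) : 0 < n.factorial * rise (2 * k) n :=
  mul_pos (by positivity) (rise_pos (by positivity) n)

lemma discW_pos {k : ℝ} (hk : 0 < k) (n : ℕ) : 0 < discW k n :=
  Real.sqrt_pos.mpr (discW_arg_pos hk n)

lemma discW_sq {k : ℝ} (hk : 0 < k) (n : ℕ) : discW k n ^ 2 = n.factorial * rise (2 * k) n :=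
  Real.sq_sqrt (discW_arg_pos hk n).le

@[simp] lemma discW_zero (k : ℝ) : discW k 0 = 1 := by simp [discW]

lemma discW_succ {k : ℝ} (hk : 0 < k) (n : ℕ) :
    discW k (n + 1) = √(((n : ℝ) + 1) * (n + 2 * k)) * discW k n := by
  rw [discW, discW, ← Real.sqrt_mul (by positivity), Nat.factorial_succ, rise_succ]
  congr 1
  push_cast; ring

/-- Since `c` may be arbitrarily small, the growth rate is compatible with every `z`; the constant
`c + 1/c` makes the square of the bound contain the cross term `2(i + 1)`. -/
lemma fockW_bound {c : ℝ} (hc : 0 < c) (i : ℕ) :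
    fockW (i + 1) ≤ (c * i + (c + 1 / c)) * fockW i := by
  rw [fockW_succ]
  refine mul_le_mul_of_nonneg_right ?_ (fockW_pos i).le
  refine Real.sqrt_le_iff.mpr ⟨by positivity, ?_⟩
  have h1 : (c * i + (c + 1 / c)) ^ 2 = (c * (i + 1)) ^ 2 + 2 * (i + 1) + (1 / c) ^ 2 := by
    field_simp; ring
  rw [h1]
  nlinarith [sq_nonneg (c * (i + 1)), sq_nonneg (1 / c), (Nat.cast_nonneg i : (0 : ℝ) ≤ i)]

/-- Here the growth rate is exactly `1`, which is why the discrete series needs `‖w‖ < 1`. -/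
lemma discW_bound {k : ℝ} (hk : 0 < k) (i : ℕ) :
    discW k (i + 1) ≤ (1 * i + (1 + 2 * k)) * discW k i := by
  rw [discW_succ hk]
  refine mul_le_mul_of_nonneg_right ?_ (discW_pos hk i).le
  refine Real.sqrt_le_iff.mpr ⟨by positivity, ?_⟩
  have : (0 : ℝ) ≤ i := Nat.cast_nonneg i
  nlinarith [mul_nonneg this hk.le]

lemma summable_fockW (z : ℂ) (m : ℕ) :
    Summable fun i => ‖z‖ ^ i / i.factorial * |fockW (m + i)| :=
  summable_shift_weights fockW_pos (fockW_bound (c := 1 / (‖z‖ + 1)) (by positivity))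
    (by rw [mul_one_div, div_lt_one (by positivity)]; linarith) m

lemma summable_discW {k : ℝ} (hk : 0 < k) {w : ℂ} (hw : ‖w‖ < 1) (m : ℕ) :
    Summable fun i => ‖w‖ ^ i / i.factorial * |discW k (m + i)| :=
  summable_shift_weights (discW_pos hk) (discW_bound hk) (by rwa [mul_one]) m

lemma cre_delta (m : ℕ) : cre (δ m) = ((fockW (m + 1) / fockW m : ℝ) : ℂ) • δ (m + 1) := by
  rw [fockW_succ, mul_div_cancel_right₀ _ (fockW_pos m).ne']
  simp [cre, δ]

lemma ann_delta_succ (m : ℕ) : ann (δ (m + 1)) = ((fockW (m + 1) / fockW m : ℝ) : ℂ) • δ m := by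
  rw [fockW_succ, mul_div_cancel_right₀ _ (fockW_pos m).ne']
  simp [ann, δ]

lemma ann_delta_zero : ann (δ 0) = 0 := by simp [ann, δ]

lemma discKp_delta {k : ℝ} (hk : 0 < k) (m : ℕ) :
    discKp k (δ m) = ((discW k (m + 1) / discW k m : ℝ) : ℂ) • δ (m + 1) := by
  rw [discW_succ hk, mul_div_cancel_right₀ _ (discW_pos hk m).ne']
  simp [discKp, δ]

lemma discKm_delta_succ {k : ℝ} (hk : 0 < k) (m : ℕ) :
    discKm k (δ (m + 1)) = ((discW k (m + 1) / discW k m : ℝ) : ℂ) • δ m := by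
  rw [discW_succ hk, mul_div_cancel_right₀ _ (discW_pos hk m).ne']
  rw [discKm, δ, Finsupp.linearCombination_single, one_smul, Nat.add_sub_cancel]
  congr 3
  push_cast
  ring_nf

lemma discKm_delta_zero (k : ℝ) : discKm k (δ 0) = 0 := by simp [discKm, δ]

lemma discK0_delta (k : ℝ) (m : ℕ) : discK0 k (δ m) = ((k + m : ℝ) : ℂ) • δ m := by
  simp [discK0, δ]

/-! ### Coherent states -/

lemma inner_of_coords {γ : ℕ → ℝ} {x y : ℂ} {u v : Ell2}
    (hu : ∀ n, u n = x ^ n / n.factorial * (γ n : ℂ))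
    (hv : ∀ n, v n = y ^ n / n.factorial * (γ n : ℂ)) :
    HasSum (fun n : ℕ => (conj x * y) ^ n * ((γ n ^ 2 / n.factorial ^ 2 : ℝ) : ℂ))
      (inner ℂ u v) := by
  refine HasSum.congr_fun (lp.hasSum_inner (𝕜 := ℂ) u v) fun n => ?_
  rw [hu, hv, RCLike.inner_apply]
  simp only [map_mul, map_div₀, map_pow, Complex.conj_natCast, Complex.conj_ofReal]
  push_cast
  ring

/-- For `v` orthogonal to every `e x`, the inner product is a vanishing power series in `x` whose
coefficients are the conjugate coordinates of `v` times nonzero weights. -/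
lemma dense_span_of_coords {γ : ℕ → ℝ} (hγ : ∀ n, γ n ≠ 0) {r : ℝ} (hr : 0 < r) {e : ℂ → Ell2}
    (he : ∀ x : ℂ, ‖x‖ < r → ∀ n, e x n = x ^ n / n.factorial * (γ n : ℂ)) :
    Dense (Submodule.span ℂ (Set.range fun x : {x : ℂ // ‖x‖ < r} => e x) : Set Ell2) := by
  rw [Submodule.dense_iff_topologicalClosure_eq_top, Submodule.topologicalClosure_eq_top_iff,
    Submodule.eq_bot_iff]
  intro v hv
  have h0 : ∀ x : ℂ, ‖x‖ < r →
      HasSum (fun n : ℕ => x ^ n * (conj (v n) * ((γ n / n.factorial : ℝ) : ℂ))) 0 := by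
    intro x hx
    have h1 : inner ℂ v (e x) = 0 := Submodule.inner_left_of_mem_orthogonal
      (K := Submodule.span ℂ (Set.range fun x : {x : ℂ // ‖x‖ < r} => e x))
      (Submodule.subset_span ⟨⟨x, hx⟩, rfl⟩) hv
    rw [← h1]
    refine HasSum.congr_fun (lp.hasSum_inner (𝕜 := ℂ) v (e x)) fun n => ?_
    rw [he x hx, RCLike.inner_apply]
    push_cast
    ring
  refine ell2_ext fun n => ?_
  have h2 := hasSum_pow_unique hr h0 (fun x _ => by simp) n
    (b := fun _ => 0)
  have h3 : ((γ n / n.factorial : ℝ) : ℂ) ≠ 0 :=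
    Complex.ofReal_ne_zero.mpr (div_ne_zero (hγ n) (by positivity))
  simpa [h3] using (mul_eq_zero.mp h2).resolve_right h3

/-- The coherent state `exp(z a†) φ₀` of Fock space. -/
def fockCoh (z : ℂ) : Ell2 := expVec emb (z • cre) (δ 0)

lemma absExp_cre (z : ℂ) (m : ℕ) : AbsExp emb (z • cre) (δ m) :=
  absExp_shift_up (fun n => (fockW_pos n).ne') cre_delta z m (summable_fockW z m)

lemma absExp_discKp {k : ℝ} (hk : 0 < k) {w : ℂ} (hw : ‖w‖ < 1) (m : ℕ) :
    AbsExp emb (w • discKp k) (δ m) :=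
  absExp_shift_up (fun n => (discW_pos hk n).ne') (discKp_delta hk) w m (summable_discW hk hw m)

lemma fockCoh_apply (z : ℂ) (n : ℕ) : fockCoh z n = z ^ n / n.factorial * (fockW n : ℂ) := by
  rw [fockCoh, expVec_shift_up_apply (fun n => (fockW_pos n).ne') cre_delta z 0 n (absExp_cre z 0)]
  simp

lemma discCoh_apply {k : ℝ} (hk : 0 < k) {w : ℂ} (hw : ‖w‖ < 1) (n : ℕ) :
    discCoh k w n = w ^ n / n.factorial * (discW k n : ℂ) := by
  rw [discCoh, expVec_shift_up_apply (fun n => (discW_pos hk n).ne') (discKp_delta hk) w 0 n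
    (absExp_discKp hk hw 0)]
  simp

lemma inner_fockCoh (x y : ℂ) : inner ℂ (fockCoh x) (fockCoh y) = Complex.exp (conj x * y) := by
  refine (inner_of_coords (fockCoh_apply x) (fockCoh_apply y)).unique ?_
  rw [Complex.exp_eq_exp_ℂ]
  refine HasSum.congr_fun (NormedSpace.expSeries_div_hasSum_exp (conj x * y)) fun n => ?_
  rw [fockW_sq, sq, div_mul_cancel_left₀ (by positivity)]
  push_cast; rfl

lemma inner_discCoh {k : ℝ} (hk : 0 < k) {x y : ℂ} (hx : ‖x‖ < 1) (hy : ‖y‖ < 1) :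
    inner ℂ (discCoh k x) (discCoh k y) = (1 - conj x * y) ^ (-((2 * k : ℝ) : ℂ)) := by
  refine (inner_of_coords (discCoh_apply hk hx) (discCoh_apply hk hy)).unique ?_
  have h := hasSum_one_sub_cpow (2 * k) (y := conj x * y) (by
    rw [norm_mul, RCLike.norm_conj]; nlinarith [norm_nonneg x, norm_nonneg y])
  refine HasSum.congr_fun h fun n => ?_
  rw [discW_sq hk, sq, mul_div_mul_left _ _ (by positivity)]

lemma dense_span_fockCoh : Dense (Submodule.span ℂ (Set.range fockCoh) : Set Ell2) := by
  refine (dense_span_of_coords (fun n => (fockW_pos n).ne') one_pos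
    fun x _ => fockCoh_apply x).mono (Submodule.span_mono ?_)
  rintro _ ⟨x, rfl⟩
  exact ⟨x, rfl⟩

lemma dense_span_discCoh {k : ℝ} (hk : 0 < k) :
    Dense (Submodule.span ℂ (Set.range fun x : {x : ℂ // ‖x‖ < 1} => discCoh k x) : Set Ell2) :=
  dense_span_of_coords (fun n => (discW_pos hk n).ne') one_pos fun _ hx => discCoh_apply hk hx

lemma clm_ext_fockCoh {H : Type*} [NormedAddCommGroup H] [NormedSpace ℂ H] {U V : Ell2 →L[ℂ] H}
    (h : ∀ z, U (fockCoh z) = V (fockCoh z)) : U = V :=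
  ContinuousLinearMap.ext_on dense_span_fockCoh (by rintro _ ⟨z, rfl⟩; exact h z)

lemma clm_ext_discCoh {H : Type*} [NormedAddCommGroup H] [NormedSpace ℂ H] {k : ℝ} (hk : 0 < k)
    {U V : Ell2 →L[ℂ] H} (h : ∀ z, ‖z‖ < 1 → U (discCoh k z) = V (discCoh k z)) : U = V :=
  ContinuousLinearMap.ext_on (dense_span_discCoh hk) (by rintro _ ⟨⟨z, hz⟩, rfl⟩; exact h z hz)

/-! ### Principal powers on the right half-plane -/

lemma abs_arg_lt_pi_div_two {z : ℂ} (hz : 0 < z.re) : |z.arg| < Real.pi / 2 :=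
  Complex.abs_arg_lt_pi_div_two_iff.mpr (Or.inl hz)

lemma ne_zero_of_re_pos {z : ℂ} (hz : 0 < z.re) : z ≠ 0 := by
  rintro rfl; simp at hz

lemma arg_ne_pi_of_re_pos {z : ℂ} (hz : 0 < z.re) : z.arg ≠ Real.pi := by
  have := abs_lt.mp (abs_arg_lt_pi_div_two hz)
  linarith [this.2, Real.pi_pos]

/-- Controls the branches: principal powers multiply without a correction as long as all factors lie
in the right half-plane. -/
lemma log_add_log {a b c d : ℂ} {e : ℝ} (ha : 0 < a.re) (hb : 0 < b.re) (hc : 0 < c.re)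
    (hd : 0 < d.re) (he : 0 < e) (h : a * b * e = c * d) :
    Complex.log a + Complex.log b + Complex.log e = Complex.log c + Complex.log d := by
  have h1 : Complex.exp (Complex.log a + Complex.log b + Complex.log e) =
      Complex.exp (Complex.log c + Complex.log d) := by
    rw [Complex.exp_add, Complex.exp_add, Complex.exp_add, Complex.exp_log (ne_zero_of_re_pos ha),
      Complex.exp_log (ne_zero_of_re_pos hb), Complex.exp_log (ne_zero_of_re_pos hc),
      Complex.exp_log (ne_zero_of_re_pos hd), Complex.exp_log (Complex.ofReal_ne_zero.mpr he.ne'), h]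
  obtain ⟨n, hn⟩ := Complex.exp_eq_exp_iff_exists_int.mp h1
  have h2 := congrArg Complex.im hn
  simp only [Complex.add_im, Complex.log_im, Complex.arg_ofReal_of_nonneg he.le, Complex.mul_im,
    Complex.intCast_re, Complex.intCast_im, Complex.mul_re, Complex.I_im, Complex.I_re,
    Complex.ofReal_im, Complex.ofReal_re, Complex.re_ofNat, Complex.im_ofNat] at h2
  have a1 := abs_lt.mp (abs_arg_lt_pi_div_two ha)
  have b1 := abs_lt.mp (abs_arg_lt_pi_div_two hb)
  have c1 := abs_lt.mp (abs_arg_lt_pi_div_two hc)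
  have d1 := abs_lt.mp (abs_arg_lt_pi_div_two hd)
  have hpi := Real.pi_pos
  -- All four arguments lie in `(-π/2, π/2)`, so the discrepancy `2πn` is smaller than `2π` in
  -- absolute value.
  have hn0 : n = 0 := by
    have h3 : (n : ℝ) < 1 := by
      by_contra h; nlinarith [not_lt.mp h]
    have h4 : (-1 : ℝ) < n := by
      by_contra h; nlinarith [not_lt.mp h]
    have h3' : n < 1 := by exact_mod_cast h3
    have h4' : -1 < n := by exact_mod_cast h4
    omega
  rw [hn, hn0]; simp

lemma cpow_mul_cpow_eq {a b c d : ℂ} {e : ℝ} (ha : 0 < a.re) (hb : 0 < b.re) (hc : 0 < c.re)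
    (hd : 0 < d.re) (he : 0 < e) (h : a * b * e = c * d) (s : ℂ) :
    a ^ s * b ^ s * (e : ℂ) ^ s = c ^ s * d ^ s := by
  rw [Complex.cpow_def_of_ne_zero (ne_zero_of_re_pos ha),
    Complex.cpow_def_of_ne_zero (ne_zero_of_re_pos hb),
    Complex.cpow_def_of_ne_zero (ne_zero_of_re_pos hc),
    Complex.cpow_def_of_ne_zero (ne_zero_of_re_pos hd),
    Complex.cpow_def_of_ne_zero (Complex.ofReal_ne_zero.mpr he.ne'),
    ← Complex.exp_add, ← Complex.exp_add, ← Complex.exp_add, ← add_mul, ← add_mul, ← add_mul,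
    log_add_log ha hb hc hd he h]

/-! ### The action of the disk on coherent states -/

/-- The disk automorphism `x ↦ (x + w) / (1 + w̄ x)`. -/
def diskMap (w x : ℂ) : ℂ := (x + w) / (1 + conj w * x)

/-- The multiplier `(1 - |w|²)ᵏ (1 + w̄ x)^(-2k)`. -/
def diskMul (k : ℝ) (w x : ℂ) : ℂ :=
  (((1 - ‖w‖ ^ 2) ^ k : ℝ) : ℂ) * (1 + conj w * x) ^ (-((2 * k : ℝ) : ℂ))

lemma one_sub_norm_sq_pos {w : ℂ} (hw : ‖w‖ < 1) : 0 < 1 - ‖w‖ ^ 2 := by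
  nlinarith [norm_nonneg w]

lemma re_one_add_pos {y : ℂ} (hy : ‖y‖ < 1) : 0 < (1 + y).re := by
  have := (abs_le.mp (Complex.abs_re_le_norm y)).1
  rw [Complex.add_re, Complex.one_re]
  linarith

lemma norm_conj_mul_lt {w x : ℂ} (hw : ‖w‖ < 1) (hx : ‖x‖ < 1) : ‖conj w * x‖ < 1 := by
  rw [norm_mul, RCLike.norm_conj]; nlinarith [norm_nonneg w, norm_nonneg x]

lemma one_add_conj_mul_ne_zero {w x : ℂ} (hw : ‖w‖ < 1) (hx : ‖x‖ < 1) : 1 + conj w * x ≠ 0 :=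
  ne_zero_of_re_pos (re_one_add_pos (norm_conj_mul_lt hw hx))

lemma norm_sq_one_sub (w : ℂ) : ((1 - ‖w‖ ^ 2 : ℝ) : ℂ) = 1 - w * conj w := by
  rw [Complex.mul_conj']; push_cast; rfl

lemma one_sub_conj_diskMap {w x y : ℂ} (hw : ‖w‖ < 1) (hx : ‖x‖ < 1) (hy : ‖y‖ < 1) :
    (1 - conj (diskMap w x) * diskMap w y) * (1 + w * conj x) * (1 + conj w * y) =
      ((1 - ‖w‖ ^ 2 : ℝ) : ℂ) * (1 - conj x * y) := by
  have h1 := one_add_conj_mul_ne_zero hw hy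
  have h2 : 1 + w * conj x ≠ 0 := by
    have := (map_ne_zero (starRingEnd ℂ)).mpr (one_add_conj_mul_ne_zero hw hx)
    simpa using this
  have h3 : 1 + conj x * w ≠ 0 := by rwa [mul_comm]
  rw [norm_sq_one_sub, diskMap, diskMap]
  simp only [map_div₀, map_add, map_mul, map_one, Complex.conj_conj]
  field_simp
  ring

lemma one_sub_norm_sq_diskMap {w x : ℂ} (hw : ‖w‖ < 1) (hx : ‖x‖ < 1) :
    (1 - ‖diskMap w x‖ ^ 2) * ‖1 + conj w * x‖ ^ 2 = (1 - ‖w‖ ^ 2) * (1 - ‖x‖ ^ 2) := by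
  have h := one_sub_conj_diskMap hw hx hx
  have h2 : ((1 - ‖diskMap w x‖ ^ 2 : ℝ) : ℂ) = 1 - conj (diskMap w x) * diskMap w x := by
    rw [norm_sq_one_sub, mul_comm]
  have h3 : ((1 - ‖x‖ ^ 2 : ℝ) : ℂ) = 1 - conj x * x := by rw [norm_sq_one_sub, mul_comm]
  have h4 : ((‖1 + conj w * x‖ ^ 2 : ℝ) : ℂ) = (1 + w * conj x) * (1 + conj w * x) := by
    rw [Complex.ofReal_pow, ← Complex.mul_conj']; simp; ring
  rw [← h2, ← h3, mul_assoc, ← h4] at h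
  exact_mod_cast h

lemma norm_diskMap_lt {w x : ℂ} (hw : ‖w‖ < 1) (hx : ‖x‖ < 1) : ‖diskMap w x‖ < 1 := by
  have h := one_sub_norm_sq_diskMap hw hx
  have h1 := mul_pos (one_sub_norm_sq_pos hw) (one_sub_norm_sq_pos hx)
  rw [← h] at h1
  have h2 := pos_of_mul_pos_left h1 (by positivity)
  nlinarith [norm_nonneg (diskMap w x)]

lemma conj_diskMul (k : ℝ) {w x : ℂ} (hw : ‖w‖ < 1) (hx : ‖x‖ < 1) :
    conj (diskMul k w x) = (((1 - ‖w‖ ^ 2) ^ k : ℝ) : ℂ) *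
      (1 + w * conj x) ^ (-((2 * k : ℝ) : ℂ)) := by
  have h := arg_ne_pi_of_re_pos (re_one_add_pos (norm_conj_mul_lt hw hx))
  have h1 := Complex.conj_cpow _ (-((2 * k : ℝ) : ℂ)) h
  rw [map_neg, Complex.conj_ofReal] at h1
  rw [diskMul, map_mul, Complex.conj_ofReal, ← h1]
  simp

/-- This is `one_sub_conj_diskMap` raised to the power `-2k`. The identity is rearranged so that
every non-real factor has positive real part, where `cpow_mul_cpow_eq` applies. -/
lemma gram_disk {k : ℝ} (hk : 0 < k) {w x y : ℂ} (hw : ‖w‖ < 1) (hx : ‖x‖ < 1) (hy : ‖y‖ < 1) :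
    inner ℂ (discCoh k x) (discCoh k y) =
      inner ℂ (diskMul k w x • discCoh k (diskMap w x))
        (diskMul k w y • discCoh k (diskMap w y)) := by
  have hwx := norm_diskMap_lt hw hx
  have hwy := norm_diskMap_lt hw hy
  rw [inner_smul_left, inner_smul_right, inner_discCoh hk hx hy, inner_discCoh hk hwx hwy,
    conj_diskMul k hw hx, diskMul]
  have hneg : ∀ {u v : ℂ}, ‖u‖ < 1 → ‖v‖ < 1 → 0 < (1 - conj u * v).re := by
    intro u v hu hv
    rw [sub_eq_add_neg]
    exact re_one_add_pos (by rw [norm_neg]; exact norm_conj_mul_lt hu hv)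
  have hz := hneg hwx hwy
  have hz0 := ne_zero_of_re_pos hz
  have hinv : 0 < ((1 - conj (diskMap w x) * diskMap w y)⁻¹).re := by
    rw [Complex.inv_re]
    exact div_pos hz (Complex.normSq_pos.mpr hz0)
  have hρ := one_sub_norm_sq_pos hw
  have key := cpow_mul_cpow_eq (e := (1 - ‖w‖ ^ 2)⁻¹)
    (by simpa [mul_comm] using re_one_add_pos (norm_conj_mul_lt hx hw) : 0 < (1 + w * conj x).re)
    (re_one_add_pos (norm_conj_mul_lt hw hy)) (hneg hx hy) hinv (inv_pos.mpr hρ) (by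
      have := one_sub_conj_diskMap hw hx hy
      have h1 : ((1 - ‖w‖ ^ 2 : ℝ) : ℂ) ≠ 0 := Complex.ofReal_ne_zero.mpr hρ.ne'
      rw [Complex.ofReal_inv]
      field_simp
      linear_combination this) (-((2 * k : ℝ) : ℂ))
  rw [Complex.inv_cpow _ _ (arg_ne_pi_of_re_pos hz)] at key
  have hc0 : (1 - conj (diskMap w x) * diskMap w y) ^ (-((2 * k : ℝ) : ℂ)) ≠ 0 := by
    rw [Ne, Complex.cpow_eq_zero_iff]; tauto
  have hpow : (((1 - ‖w‖ ^ 2)⁻¹ : ℝ) : ℂ) ^ (-((2 * k : ℝ) : ℂ)) =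
      (((1 - ‖w‖ ^ 2) ^ k : ℝ) : ℂ) * (((1 - ‖w‖ ^ 2) ^ k : ℝ) : ℂ) := by
    rw [← Complex.ofReal_neg, ← Complex.ofReal_cpow (by positivity), ← Complex.ofReal_mul,
      ← Real.rpow_add hρ, Real.inv_rpow hρ.le, ← Real.rpow_neg hρ.le]
    congr 2; ring
  rw [hpow, eq_mul_inv_iff_mul_eq₀ hc0] at key
  rw [← key]
  ring

lemma exists_disk_operator {k : ℝ} (hk : 0 < k) {w : ℂ} (hw : ‖w‖ < 1) :
    ∃ U : Ell2 →L[ℂ] Ell2, ∀ x, ‖x‖ < 1 →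
      U (discCoh k x) = diskMul k w x • discCoh k (diskMap w x) := by
  obtain ⟨U, hU⟩ := exists_clm_of_gram
    (fun x : {x : ℂ // ‖x‖ < 1} => discCoh k x)
    (fun x : {x : ℂ // ‖x‖ < 1} => diskMul k w x • discCoh k (diskMap w x))
    (dense_span_discCoh hk) fun x y => gram_disk hk hw x.2 y.2
  exact ⟨U, fun x hx => hU ⟨x, hx⟩⟩

/-! ### Generating functions -/

/-- Collects the coefficient of `x^m` in `∑ aₙ xⁿ Bₙ(x)`, where the polynomial index `n` is at most
`p` and each `Bₙ` is a power series. -/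
lemma hasSum_generating {x : ℂ} {p : ℕ} {a B : ℕ → ℂ} {b : ℕ → ℕ → ℂ}
    (hb : ∀ n, n ≤ p → HasSum (fun i => x ^ i * b n i) (B n)) :
    HasSum (fun m => x ^ m * ∑ n ∈ Finset.range (min p m + 1), a n * b n (m - n))
      (∑ n ∈ Finset.range (p + 1), a n * x ^ n * B n) := by
  have h1 : ∀ n ∈ Finset.range (p + 1),
      HasSum (fun m => if n ≤ m then x ^ m * (a n * b n (m - n)) else 0) (a n * x ^ n * B n) := by
    intro n hn
    rw [← Function.Injective.hasSum_iff (add_left_injective n)]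
    · refine ((hb n (by simpa [Nat.lt_succ_iff] using hn)).mul_left (a n * x ^ n)).congr_fun ?_
      intro i
      simp only [Function.comp, le_add_iff_nonneg_left, zero_le, if_true, Nat.add_sub_cancel]
      ring
    · intro m hm
      rw [if_neg]
      intro hnm
      exact hm ⟨m - n, Nat.sub_add_cancel hnm⟩
  refine (hasSum_sum h1).congr_fun fun m => ?_
  rw [← Finset.sum_filter, Finset.mul_sum]
  refine Finset.sum_congr ?_ fun _ _ => rfl
  ext n
  simp only [Finset.mem_range, Finset.mem_filter]
  omega

/-- A coherent state is a generating function of the basis, so its image under `U` generates the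
matrix elements of `U`. -/
lemma hasSum_map_coh {γ : ℕ → ℝ} {x : ℂ} {v : Ell2}
    (hv : ∀ n, v n = x ^ n / n.factorial * (γ n : ℂ)) (U : Ell2 →L[ℂ] Ell2) (p : ℕ) :
    HasSum (fun m => x ^ m * (((γ m / m.factorial : ℝ) : ℂ) * U (φ m) p)) (U v p) := by
  refine (hasSum_coord ((hasSum_phi v).mapL U) p).congr_fun fun m => ?_
  rw [map_smul, lp.coeFn_smul, Pi.smul_apply, hv, smul_eq_mul]
  push_cast
  ring

lemma hasSum_one_add_cpow (a : ℝ) {x v : ℂ} (h : ‖v * x‖ < 1) :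
    HasSum (fun i : ℕ => x ^ i * ((-v) ^ i * ((rise a i / i.factorial : ℝ) : ℂ)))
      ((1 + v * x) ^ (-(a : ℂ))) := by
  have h1 := hasSum_one_sub_cpow a (y := -(v * x)) (by rwa [norm_neg])
  rw [sub_neg_eq_add] at h1
  refine h1.congr_fun fun i => ?_
  rw [← mul_assoc, ← mul_pow]
  ring_nf

lemma cpow_neg_add_nat (a : ℝ) (n : ℕ) {z : ℂ} (hz : z ≠ 0) :
    z ^ (-((a + n : ℝ) : ℂ)) = z ^ (-(a : ℂ)) * (z ^ n)⁻¹ := by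
  rw [Complex.ofReal_add, neg_add, Complex.cpow_add _ _ hz, Complex.ofReal_natCast,
    Complex.cpow_neg z n, Complex.cpow_natCast]

/-- Both formulas compare coefficients of `x^m` in the `p`-th coordinate of `U e_x`. The first
splits `(x + w)/(1 + w̄x)` as `(1 - |w|²) x/(1 + w̄x) + w` before taking the `p`-th power; the
second expands only the numerator `(x + w)^p`. They lead to the two hypergeometric forms. -/
lemma disc_apply_phi {k : ℝ} (hk : 0 < k) {w : ℂ} (hw : ‖w‖ < 1) {U : Ell2 →L[ℂ] Ell2}
    (hU : ∀ x, ‖x‖ < 1 → U (discCoh k x) = diskMul k w x • discCoh k (diskMap w x)) (p m : ℕ) :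
    ((discW k m / m.factorial : ℝ) : ℂ) * U (φ m) p =
      ∑ n ∈ Finset.range (min p m + 1),
        ((discW k p / (n.factorial * (p - n).factorial) * (1 - ‖w‖ ^ 2) ^ (k + n) : ℝ) : ℂ) *
          w ^ (p - n) *
          ((-(conj w)) ^ (m - n) * ((rise (2 * k + n) (m - n) / (m - n).factorial : ℝ) : ℂ)) ∧
    ((discW k m / m.factorial : ℝ) : ℂ) * U (φ m) p =
      ∑ n ∈ Finset.range (min p m + 1),
        ((discW k p / (n.factorial * (p - n).factorial) * (1 - ‖w‖ ^ 2) ^ k : ℝ) : ℂ) *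
          w ^ (p - n) *
          ((-(conj w)) ^ (m - n) * ((rise (2 * k + p) (m - n) / (m - n).factorial : ℝ) : ℂ)) := by
  have hρ := one_sub_norm_sq_pos hw
  have hval : ∀ x : ℂ, ‖x‖ < 1 → U (discCoh k x) p = (((1 - ‖w‖ ^ 2) ^ k : ℝ) : ℂ) *
      (1 + conj w * x) ^ (-((2 * k : ℝ) : ℂ)) *
      (((x + w) / (1 + conj w * x)) ^ p / p.factorial * (discW k p : ℂ)) := by
    intro x hx
    rw [hU x hx, lp.coeFn_smul, Pi.smul_apply, discCoh_apply hk (norm_diskMap_lt hw hx),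
      smul_eq_mul, diskMul, diskMap]
  have hfac : ∀ n ∈ Finset.range (p + 1),
      (p.choose n : ℂ) / p.factorial = 1 / (n.factorial * (p - n).factorial) := by
    intro n hn
    have hn : n ≤ p := by simpa [Nat.lt_succ_iff] using hn
    rw [Nat.cast_choose ℂ hn]
    have h1 := Nat.cast_ne_zero (R := ℂ).mpr p.factorial_ne_zero
    field_simp
  constructor
  · refine hasSum_pow_unique one_pos (f := fun x => U (discCoh k x) p)
      (b := fun m => ∑ n ∈ Finset.range (min p m + 1),
        ((discW k p / (n.factorial * (p - n).factorial) * (1 - ‖w‖ ^ 2) ^ (k + n) : ℝ) : ℂ) *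
          w ^ (p - n) *
          ((-(conj w)) ^ (m - n) * ((rise (2 * k + n) (m - n) / (m - n).factorial : ℝ) : ℂ)))
      (fun x hx => hasSum_map_coh (discCoh_apply hk hx) U p) (fun x hx => ?_) m
    have h := hasSum_generating (x := x) (p := p)
      (a := fun n => ((discW k p / (n.factorial * (p - n).factorial) *
        (1 - ‖w‖ ^ 2) ^ (k + n) : ℝ) : ℂ) * w ^ (p - n))
      (b := fun n i => (-(conj w)) ^ i * ((rise (2 * k + n) i / i.factorial : ℝ) : ℂ))
      fun n _ => hasSum_one_add_cpow (2 * k + n) (norm_conj_mul_lt hw hx)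
    convert h using 1
    have hz := one_add_conj_mul_ne_zero hw hx
    have hb : (x + w) / (1 + conj w * x) =
        ((1 - ‖w‖ ^ 2 : ℝ) : ℂ) * x / (1 + conj w * x) + w := by
      rw [norm_sq_one_sub, div_eq_iff hz, add_mul, div_mul_cancel₀ _ hz]; ring
    rw [hval x hx, hb, add_pow, Finset.sum_div, Finset.sum_mul, Finset.mul_sum]
    refine Finset.sum_congr rfl fun n hn => ?_
    rw [cpow_neg_add_nat _ _ hz, mul_div_assoc, hfac n hn, Real.rpow_add hρ, Real.rpow_natCast,
      div_pow, mul_pow]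
    push_cast
    ring
  · refine hasSum_pow_unique one_pos (f := fun x => U (discCoh k x) p)
      (b := fun m => ∑ n ∈ Finset.range (min p m + 1),
        ((discW k p / (n.factorial * (p - n).factorial) * (1 - ‖w‖ ^ 2) ^ k : ℝ) : ℂ) *
          w ^ (p - n) *
          ((-(conj w)) ^ (m - n) * ((rise (2 * k + p) (m - n) / (m - n).factorial : ℝ) : ℂ)))
      (fun x hx => hasSum_map_coh (discCoh_apply hk hx) U p) (fun x hx => ?_) m
    have h := hasSum_generating (x := x) (p := p)
      (a := fun n => ((discW k p / (n.factorial * (p - n).factorial) *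
        (1 - ‖w‖ ^ 2) ^ k : ℝ) : ℂ) * w ^ (p - n))
      (b := fun n i => (-(conj w)) ^ i * ((rise (2 * k + p) i / i.factorial : ℝ) : ℂ))
      fun n _ => hasSum_one_add_cpow (2 * k + p) (norm_conj_mul_lt hw hx)
    convert h using 1
    have hz := one_add_conj_mul_ne_zero hw hx
    rw [hval x hx, div_pow, add_pow, ← Finset.sum_mul, cpow_neg_add_nat _ _ hz]
    have hs : ∑ n ∈ Finset.range (p + 1), ((discW k p / (n.factorial * (p - n).factorial) *
        (1 - ‖w‖ ^ 2) ^ k : ℝ) : ℂ) * w ^ (p - n) * x ^ n =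
        (discW k p : ℂ) * (((1 - ‖w‖ ^ 2) ^ k : ℝ) : ℂ) *
          ((∑ n ∈ Finset.range (p + 1), x ^ n * w ^ (p - n) * (p.choose n : ℂ)) / p.factorial) := by
      rw [Finset.sum_div, Finset.mul_sum]
      refine Finset.sum_congr rfl fun n hn => ?_
      rw [mul_div_assoc, hfac n hn]
      push_cast
      ring
    rw [hs]
    ring

/-- The first expansion is, term by term, the turning-level sum of the three exponentials. This
identifies the isometry defined on coherent states with the squeeze operator. -/
lemma disc_apply_phi_eq {k : ℝ} (hk : 0 < k) {w : ℂ} (hw : ‖w‖ < 1) {U : Ell2 →L[ℂ] Ell2}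
    (hU : ∀ x, ‖x‖ < 1 → U (discCoh k x) = diskMul k w x • discCoh k (diskMap w x)) (p m : ℕ) :
    U (φ m) p = squeezeCoef (discW k) k w p m := by
  have h := (disc_apply_phi hk hw hU p m).1
  have hm : ((discW k m / m.factorial : ℝ) : ℂ) ≠ 0 :=
    Complex.ofReal_ne_zero.mpr (div_ne_zero (discW_pos hk m).ne' (by positivity))
  refine mul_left_cancel₀ hm ?_
  rw [h, squeezeCoef, Finset.mul_sum]
  refine Finset.sum_congr rfl fun n hn => ?_
  have hn : n ≤ m := by simp at hn; omega
  -- The squared weight contains `(2k)ₘ = (2k)ₙ (2k + n)ₘ₋ₙ`, which absorbs the rising factorial of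
  -- the binomial series.
  have e1 : discW k m * discW k m = m.factorial * rise (2 * k) n * rise (2 * k + n) (m - n) := by
    rw [← sq, discW_sq hk, mul_assoc, ← rise_add, Nat.add_sub_cancel' hn]
  have e2 : discW k p / (n.factorial * (p - n).factorial) * (1 - ‖w‖ ^ 2) ^ (k + n) *
      (rise (2 * k + n) (m - n) / (m - n).factorial) = discW k m / m.factorial *
      (discW k p * discW k m / discW k n ^ 2 * (1 - ‖w‖ ^ 2) ^ (k + n)) *
      (1 / (p - n).factorial) * (1 / (m - n).factorial) := by
    have e3 : discW k m / m.factorial *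
      (discW k p * discW k m / discW k n ^ 2 * (1 - ‖w‖ ^ 2) ^ (k + n)) =
      (discW k m * discW k m) / m.factorial * discW k p / discW k n ^ 2 *
        (1 - ‖w‖ ^ 2) ^ (k + n) := by ring
    have := rise_pos (by positivity : 0 < 2 * k) n
    rw [e3, e1, discW_sq hk]
    generalize rise (2 * k) n = R at *
    field_simp
  have e2' := congrArg (Complex.ofReal) e2
  simp only [Complex.ofReal_mul _ (rise _ _ / _), Complex.ofReal_mul _ (1 / _)] at e2'
  simp only [Complex.ofReal_mul (_ / _) (_ * _)] at e2'
  rw [Complex.ofReal_div 1, Complex.ofReal_div 1] at e2'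
  simp only [Complex.ofReal_one, Complex.ofReal_natCast] at e2'
  linear_combination (w ^ (p - n) * (-(conj w)) ^ (m - n)) * e2'

/-! ### The squeeze operator of the discrete series -/

lemma core_squeezeMaps {Kp K0 Km : Module.End ℂ Core} {w : ℂ} {U : Ell2 →L[ℂ] Ell2}
    (h : ∀ m, SqueezeMaps emb Kp K0 Km w (δ m) (U (φ m))) (u : Core) :
    SqueezeMaps emb Kp K0 Km w u (U (emb u)) := by
  refine core_induction (P := fun u => SqueezeMaps emb Kp K0 Km w u (U (emb u))) u ?_ ?_ ?_ ?_
  · rw [map_zero, map_zero]; exact .zero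
  · intro u v hu hv; rw [map_add, map_add]; exact hu.add hv
  · intro c u hu; rw [map_smul, map_smul]; exact hu.smul c
  · intro m; rw [emb_delta]; exact h m

lemma existsUnique_squeeze {Kp K0 Km : Module.End ℂ Core} {w : ℂ} {U : Ell2 →L[ℂ] Ell2}
    (h : ∀ m, SqueezeMaps emb Kp K0 Km w (δ m) (U (φ m))) :
    ∃! V, IsSqueeze emb Kp K0 Km w V := by
  have hU := IsSqueeze.of_squeezeMaps (core_squeezeMaps h)
  refine ⟨U, hU, fun V hV => clm_ext_phi fun n => ?_⟩
  rw [← emb_delta]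
  exact hV.unique emb_injective hU _

lemma exists_disc_squeeze {k : ℝ} (hk : 0 < k) {w : ℂ} (hw : ‖w‖ < 1) :
    ∃ U : Ell2 →L[ℂ] Ell2,
      (∀ m, SqueezeMaps emb (discKp k) (discK0 k) (discKm k) w (δ m) (U (φ m))) ∧
      (∀ x, ‖x‖ < 1 → U (discCoh k x) = diskMul k w x • discCoh k (diskMap w x)) := by
  obtain ⟨U, hU⟩ := exists_disk_operator hk hw
  refine ⟨U, fun m => ?_, hU⟩
  obtain ⟨y, hy, hy'⟩ := exists_squeezeMaps_shift (fun n => (discW_pos hk n).ne')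
    (discKp_delta hk) (discKm_delta_succ hk) (discKm_delta_zero k) (discK0_delta k) hw
    (summable_discW hk hw) m
  convert hy using 1
  exact ell2_ext fun p => by rw [hy', disc_apply_phi_eq hk hw hU]

lemma existsUnique_discS {k : ℝ} (hk : 0 < k) {w : ℂ} (hw : ‖w‖ < 1) :
    ∃! U, IsSqueeze emb (discKp k) (discK0 k) (discKm k) w U := by
  obtain ⟨U, h1, -⟩ := exists_disc_squeeze hk hw
  exact existsUnique_squeeze h1

lemma discS_spec {k : ℝ} (hk : 0 < k) {w : ℂ} (hw : ‖w‖ < 1) :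
    (∀ m, SqueezeMaps emb (discKp k) (discK0 k) (discKm k) w (δ m) (discS k w (φ m))) ∧
      (∀ x, ‖x‖ < 1 →
        discS k w (discCoh k x) = diskMul k w x • discCoh k (diskMap w x)) := by
  obtain ⟨U, h1, h2⟩ := exists_disc_squeeze hk hw
  have : discS k w = U :=
    theOp_eq (existsUnique_discS hk hw) (IsSqueeze.of_squeezeMaps (core_squeezeMaps h1))
  rw [this]
  exact ⟨h1, h2⟩

lemma discS_discCoh {k : ℝ} (hk : 0 < k) {w x : ℂ} (hw : ‖w‖ < 1) (hx : ‖x‖ < 1) :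
    discS k w (discCoh k x) = diskMul k w x • discCoh k (diskMap w x) := (discS_spec hk hw).2 x hx

lemma elemS_eq_apply (k : ℝ) (w : ℂ) (p m : ℕ) : elemS k w p m = discS k w (φ m) p :=
  inner_phi_left _ _

lemma elemS_eq_squeezeCoef {k : ℝ} (hk : 0 < k) {w : ℂ} (hw : ‖w‖ < 1) (p m : ℕ) :
    elemS k w p m = squeezeCoef (discW k) k w p m := by
  rw [elemS_eq_apply, disc_apply_phi_eq hk hw (discS_spec hk hw).2]

lemma elemS_symm {k : ℝ} (hk : 0 < k) {w : ℂ} (hw : ‖w‖ < 1) (p m : ℕ) :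
    elemS k w p m = elemS k (-(conj w)) m p := by
  rw [elemS_eq_squeezeCoef hk hw, elemS_eq_squeezeCoef hk (by rwa [norm_neg, RCLike.norm_conj]),
    squeezeCoef_symm]

/-! ### Hypergeometric form of the matrix elements -/

lemma rise_reverse (a : ℝ) (i : ℕ) : rise (1 - a - i) i = (-1) ^ i * rise a i := by
  induction i generalizing a with
  | zero => simp
  | succ i ih =>
    have h1 := ih (a + 1)
    have h2 := rise_add a 1 i
    have h3 : rise a 1 = a := by rw [show 1 = 0 + 1 from rfl, rise_succ]; simp
    rw [add_comm 1 i, h3, Nat.cast_one] at h2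
    rw [rise_succ, h2, show 1 - a - ((i + 1 : ℕ) : ℝ) = 1 - (a + 1) - i by push_cast; ring, h1,
      pow_succ]
    ring

lemma factorial_mul_rise (n i : ℕ) : (n.factorial : ℝ) * rise (n + 1) i = (n + i).factorial := by
  induction i with
  | zero => simp
  | succ i ih =>
    rw [rise_succ, ← mul_assoc, ih, ← add_assoc, Nat.factorial_succ]
    push_cast; ring

lemma hypergeometric_neg_nat (m : ℕ) (b c t : ℝ) :
    ordinaryHypergeometric (-(m : ℝ)) b c t = ∑ i ∈ Finset.range (m + 1),
      (i.factorial : ℝ)⁻¹ * rise (-(m : ℝ)) i * rise b i * (rise c i)⁻¹ * t ^ i := by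
  rw [ordinaryHypergeometric_eq_tsum]
  refine tsum_eq_sum fun i hi => ?_
  have : (ascPochhammer ℝ i).eval (-(m : ℝ)) = 0 :=
    (ascPochhammer_eval_eq_zero_iff i _).mpr ⟨m, by simpa using hi, by simp⟩
  rw [this]; simp

/-- With `m = n + i` and `p = m + d`, the factors `(-m)ᵢ / (i! (d + 1)ᵢ)` of a hypergeometric term
are a signed quotient of factorials. -/
lemma hypergeometric_term_eq (d n i : ℕ) :
    (i.factorial : ℝ)⁻¹ * rise (-((n + i : ℕ) : ℝ)) i * (rise (((n + i + d : ℕ) : ℝ) -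
      (n + i : ℕ) + 1) i)⁻¹ = (-1) ^ i * ((n + i).factorial * d.factorial /
        (i.factorial * n.factorial * (d + i).factorial)) := by
  have h1 := rise_reverse (n + 1) i
  rw [show (1 - (n + 1 : ℝ) - i) = -((n + i : ℕ) : ℝ) by push_cast; ring] at h1
  have h2 := factorial_mul_rise n i
  have h3 := factorial_mul_rise d i
  rw [show (((n + i + d : ℕ) : ℝ) - (n + i : ℕ) + 1) = (d : ℝ) + 1 by push_cast; ring, h1,
    ← h2, ← h3]
  have := (rise_pos (a := (d : ℝ) + 1) (by positivity) i).ne'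
  field_simp

lemma sqrt_gamma_ratio {k : ℝ} (hk : 0 < k) (p m : ℕ) :
    √((p.factorial : ℝ) * Real.Gamma (2 * k + p) /
      ((m.factorial : ℝ) * Real.Gamma (2 * k + m))) = discW k p / discW k m := by
  have h2k : 0 < 2 * k := by positivity
  have hG := Real.Gamma_pos_of_pos h2k
  rw [Gamma_add_nat h2k, Gamma_add_nat h2k, discW, discW, ← Real.sqrt_div (discW_arg_pos hk p).le]
  congr 1
  have := rise_pos h2k m
  have := rise_pos h2k p
  generalize rise (2 * k) m = R at *
  generalize rise (2 * k) p = R' at *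
  field_simp

lemma pow_add_mul_neg_conj_pow (w : ℂ) (d i : ℕ) :
    w ^ (d + i) * (-(conj w)) ^ i = w ^ d * (((-1) ^ i * (‖w‖ ^ 2) ^ i : ℝ) : ℂ) := by
  rw [pow_add, mul_assoc, ← mul_pow, mul_neg, Complex.mul_conj', ← mul_pow]
  push_cast
  ring_nf

lemma elemS_hypergeometric {k : ℝ} (hk : 0 < k) {w : ℂ} (hw : ‖w‖ < 1) {p m : ℕ} (hmp : m ≤ p) :
    elemS k w p m =
        ((√((p.factorial : ℝ) * Real.Gamma (2 * k + p) /
          ((m.factorial : ℝ) * Real.Gamma (2 * k + m))) : ℝ) : ℂ) *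
          (w ^ (p - m) / ((p - m).factorial : ℂ)) *
          (((1 - ‖w‖ ^ 2) ^ (k + m) *
            ordinaryHypergeometric (-(m : ℝ)) (1 - 2 * k - m) ((p : ℝ) - m + 1)
              (-‖w‖ ^ 2 / (1 - ‖w‖ ^ 2)) : ℝ) : ℂ) ∧
      elemS k w p m =
        ((√((p.factorial : ℝ) * Real.Gamma (2 * k + p) /
          ((m.factorial : ℝ) * Real.Gamma (2 * k + m))) : ℝ) : ℂ) *
          (w ^ (p - m) / ((p - m).factorial : ℂ)) *
          (((1 - ‖w‖ ^ 2) ^ k *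
            ordinaryHypergeometric (-(m : ℝ)) (2 * k + p) ((p : ℝ) - m + 1)
              (‖w‖ ^ 2) : ℝ) : ℂ) := by
  obtain ⟨d, rfl⟩ := Nat.exists_eq_add_of_le hmp
  have hρ := one_sub_norm_sq_pos hw
  have h2k : 0 < 2 * k := by positivity
  obtain ⟨h1, h2⟩ := disc_apply_phi hk hw (discS_spec hk hw).2 (m + d) m
  rw [← elemS_eq_apply] at h1 h2
  -- The hypergeometric index is `i = m - n`, the number of lowering steps, so the sums are
  -- reversed.
  rw [min_eq_right hmp, ← Finset.sum_range_reflect] at h1 h2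
  have hm : ((discW k m / m.factorial : ℝ) : ℂ) ≠ 0 :=
    Complex.ofReal_ne_zero.mpr (div_ne_zero (discW_pos hk m).ne' (by positivity))
  have hm' := (discW_pos hk m).ne'
  rw [sqrt_gamma_ratio hk, hypergeometric_neg_nat, hypergeometric_neg_nat, Nat.add_sub_cancel_left]
  constructor <;> refine mul_left_cancel₀ hm ?_
  · rw [h1, Finset.mul_sum, Complex.ofReal_sum, Finset.mul_sum, Finset.mul_sum]
    refine Finset.sum_congr rfl fun i hi => ?_
    obtain ⟨n, rfl⟩ := Nat.exists_eq_add_of_le' (show i ≤ m by simpa [Nat.lt_succ_iff] using hi)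
    rw [show n + i + 1 - 1 - i = n by omega, show n + i + d - n = d + i by omega,
      Nat.add_sub_cancel_left]
    have e1 := pow_add_mul_neg_conj_pow w d i
    have e2 := hypergeometric_term_eq d n i
    -- Turns `(1 - 2k - m)ᵢ` with `m = n + i` into `(-1)^i (2k + n)ᵢ`.
    have e3 := rise_reverse (2 * k + n) i
    rw [show 1 - (2 * k + n) - i = 1 - 2 * k - ((n + i : ℕ) : ℝ) by push_cast; ring] at e3
    have e4 : discW k (n + i + d) / (n.factorial * (d + i).factorial) *
        (1 - ‖w‖ ^ 2) ^ (k + n) * ((-1) ^ i * (‖w‖ ^ 2) ^ i) *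
        (rise (2 * k + n) i / i.factorial) =
        discW k (n + i) / (n + i).factorial * (discW k (n + i + d) / discW k (n + i)) *
        (1 / d.factorial) * ((1 - ‖w‖ ^ 2) ^ (k + (n + i : ℕ)) *
          ((i.factorial : ℝ)⁻¹ * rise (-((n + i : ℕ) : ℝ)) i *
            rise (1 - 2 * k - (n + i : ℕ)) i *
            (rise (((n + i + d : ℕ) : ℝ) - (n + i : ℕ) + 1) i)⁻¹ *
            (-‖w‖ ^ 2 / (1 - ‖w‖ ^ 2)) ^ i)) := by
      rw [mul_right_comm _ (rise (1 - 2 * k - _) _), e2, e3, Nat.cast_add, ← add_assoc,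
        Real.rpow_add hρ (k + n), Real.rpow_natCast, div_pow, neg_pow]
      have h3 : ((-1 : ℝ) ^ i) * (-1) ^ i = 1 := by rw [← mul_pow]; norm_num
      have h4 : (1 - ‖w‖ ^ 2) ^ i ≠ 0 := by positivity
      generalize (1 - ‖w‖ ^ 2) ^ i = Y at *
      generalize (1 - ‖w‖ ^ 2) ^ (k + n) = Z
      generalize rise (2 * k + n) i = R
      field_simp
      linear_combination -(discW k (n + i + d) * Z * ‖w‖ ^ (i * 2) * R) * h3
    have e4' := congrArg Complex.ofReal e4
    push_cast at e4' e1 ⊢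
    linear_combination (w ^ d) * e4' + (discW k (n + i + d) / (n.factorial * (d + i).factorial) *
        ((1 - ‖w‖ ^ 2) ^ (k + n) : ℝ) * (rise (2 * k + n) i / i.factorial) : ℂ) * e1
  · rw [h2, Finset.mul_sum, Complex.ofReal_sum, Finset.mul_sum, Finset.mul_sum]
    refine Finset.sum_congr rfl fun i hi => ?_
    obtain ⟨n, rfl⟩ := Nat.exists_eq_add_of_le' (show i ≤ m by simpa [Nat.lt_succ_iff] using hi)
    rw [show n + i + 1 - 1 - i = n by omega, show n + i + d - n = d + i by omega,
      Nat.add_sub_cancel_left]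
    have e1 := pow_add_mul_neg_conj_pow w d i
    have e2 := hypergeometric_term_eq d n i
    have e4 : discW k (n + i + d) / (n.factorial * (d + i).factorial) *
        (1 - ‖w‖ ^ 2) ^ k * ((-1) ^ i * (‖w‖ ^ 2) ^ i) *
        (rise (2 * k + (n + i + d : ℕ)) i / i.factorial) =
        discW k (n + i) / (n + i).factorial * (discW k (n + i + d) / discW k (n + i)) *
        (1 / d.factorial) * ((1 - ‖w‖ ^ 2) ^ k *
          ((i.factorial : ℝ)⁻¹ * rise (-((n + i : ℕ) : ℝ)) i *
            rise (2 * k + (n + i + d : ℕ)) i *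
            (rise (((n + i + d : ℕ) : ℝ) - (n + i : ℕ) + 1) i)⁻¹ *
            (‖w‖ ^ 2) ^ i)) := by
      rw [mul_right_comm _ (rise (2 * k + _) _), e2]
      generalize (1 - ‖w‖ ^ 2) ^ k = Z
      generalize rise (2 * k + _) i = R
      field_simp
    have e4' := congrArg Complex.ofReal e4
    push_cast at e4' e1 ⊢
    linear_combination (w ^ d) * e4' + (discW k (n + i + d) / (n.factorial * (d + i).factorial) *
        ((1 - ‖w‖ ^ 2) ^ k : ℝ) * (rise (2 * k + (n + i + d)) i / i.factorial) : ℂ) * e1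

/-! ### The Bargmann transform -/

/-- The Bargmann transform of a vector of Fock space, evaluated at `x`. -/
def barg (x : ℂ) : Ell2 →L[ℂ] ℂ := innerSL ℂ (fockCoh (conj x))

lemma barg_fockCoh (x z : ℂ) : barg x (fockCoh z) = Complex.exp (x * z) := by
  rw [barg, innerSL_apply_apply, inner_fockCoh, Complex.conj_conj]

lemma barg_phi (x : ℂ) (n : ℕ) : barg x (φ n) = x ^ n / n.factorial * (fockW n : ℂ) := by
  rw [barg, innerSL_apply_apply, ← inner_conj_symm, inner_phi_left, fockCoh_apply]
  simp

lemma ext_barg {u v : Ell2} (h : ∀ x, barg x u = barg x v) : u = v := by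
  have h1 : innerSL ℂ u = innerSL ℂ v := clm_ext_fockCoh fun z => by
    have h2 := h (conj z)
    rw [barg, Complex.conj_conj, innerSL_apply_apply, innerSL_apply_apply] at h2
    rw [innerSL_apply_apply, innerSL_apply_apply, ← inner_conj_symm, h2, inner_conj_symm]
  exact ext_inner_right ℂ fun w => by simpa using DFunLike.congr_fun h1 w

lemma fockW_succ_div (n : ℕ) :
    ((fockW (n + 1) / fockW n : ℝ) : ℂ) * (fockW n : ℂ) = (fockW (n + 1) : ℂ) := by
  rw [← Complex.ofReal_mul, div_mul_cancel₀ _ (fockW_pos n).ne']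

lemma fockW_sq' (n : ℕ) : (fockW n : ℂ) * (fockW n : ℂ) = n.factorial := by
  rw [← Complex.ofReal_mul, ← sq, fockW_sq, Complex.ofReal_natCast]

/-- In the Bargmann picture `a†` is multiplication by the variable. -/
lemma barg_cre (x : ℂ) (u : Core) : barg x (emb (cre u)) = x * barg x (emb u) := by
  refine core_induction (P := fun u => barg x (emb (cre u)) = x * barg x (emb u)) u ?_ ?_ ?_ ?_
  · simp
  · intro u v hu hv; simp only [map_add, hu, hv, mul_add]
  · intro c u hu; simp only [map_smul, hu, smul_eq_mul]; ring
  · intro n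
    rw [cre_delta, map_smul, map_smul, emb_delta, emb_delta, barg_phi, barg_phi, smul_eq_mul,
      Nat.factorial_succ]
    have h1 := fockW_succ_div n
    have h3 : ((fockW (n + 1) / fockW n : ℝ) : ℂ) * ((fockW (n + 1) / fockW n : ℝ) : ℂ) =
        n + 1 := by
      rw [← Complex.ofReal_mul, fockW_succ, mul_div_cancel_right₀ _ (fockW_pos n).ne',
        Real.mul_self_sqrt (by positivity)]
      simp
    have h4 : (n.factorial : ℂ) ≠ 0 := Nat.cast_ne_zero.mpr n.factorial_ne_zero
    have h5 : (n : ℂ) + 1 ≠ 0 := Nat.cast_add_one_ne_zero n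
    rw [← h1]
    generalize ((fockW (n + 1) / fockW n : ℝ) : ℂ) = a at *
    push_cast
    calc _ = a * a * (x ^ (n + 1) / ((n + 1) * n.factorial) * (fockW n : ℂ)) := by ring
      _ = _ := by rw [h3, pow_succ]; field_simp

/-- In the Bargmann picture `a` is differentiation. -/
lemma hasDerivAt_barg (u : Core) (x : ℂ) :
    HasDerivAt (fun y => barg y (emb u)) (barg x (emb (ann u))) x := by
  refine core_induction
    (P := fun u => HasDerivAt (fun y => barg y (emb u)) (barg x (emb (ann u))) x) u ?_ ?_ ?_ ?_
  · simpa using hasDerivAt_const x (0 : ℂ)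
  · intro u v hu hv; simp only [map_add]; exact hu.fun_add hv
  · intro c u hu; simp only [map_smul, smul_eq_mul]; exact hu.const_mul c
  · intro n
    simp only [emb_delta, barg_phi]
    cases n with
    | zero => simpa [ann_delta_zero] using hasDerivAt_const x (1 : ℂ)
    | succ n =>
      rw [ann_delta_succ, map_smul, map_smul, emb_delta, barg_phi, smul_eq_mul]
      have h := ((hasDerivAt_pow (n + 1) x).div_const ((n + 1).factorial : ℂ)).mul_const
        (fockW (n + 1) : ℂ)
      refine h.congr_deriv ?_
      rw [← fockW_succ_div n, Nat.factorial_succ]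
      have h5 : (n : ℂ) + 1 ≠ 0 := Nat.cast_add_one_ne_zero n
      push_cast
      field_simp

/-! ### The displacement operator -/

/-- The generator `α a† - ᾱ a` of displacements. -/
def dispGen (α : ℂ) : Module.End ℂ Core := α • cre + (-(conj α)) • ann

/-- The generator is a sum of a raising and a lowering part, and lowering never gives a larger
vector than raising would; each part is bounded by half of the right-hand side, whence `(2‖α‖)^n`.
-/
lemma norm_dispGen_pow (α : ℂ) (n m : ℕ) :
    ‖emb ((dispGen α ^ n) (δ m))‖ ≤ (2 * ‖α‖) ^ n * (fockW (m + n) / fockW m) := by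
  induction n generalizing m with
  | zero => simp [div_self (fockW_pos m).ne']
  | succ n ih =>
    have hα := norm_nonneg α
    have h1 : ‖emb ((dispGen α ^ n) (α • cre (δ m)))‖ ≤
        ‖α‖ * (2 * ‖α‖) ^ n * (fockW (m + (n + 1)) / fockW m) := by
      rw [cre_delta, smul_smul, map_smul, map_smul, norm_smul, norm_mul, Complex.norm_real,
        Real.norm_of_nonneg (div_pos (fockW_pos _) (fockW_pos _)).le]
      calc _ ≤ ‖α‖ * (fockW (m + 1) / fockW m) *
            ((2 * ‖α‖) ^ n * (fockW (m + 1 + n) / fockW (m + 1))) :=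
            mul_le_mul_of_nonneg_left (ih (m + 1))
              (mul_nonneg hα (div_pos (fockW_pos _) (fockW_pos _)).le)
        _ = _ := by
          rw [show m + 1 + n = m + (n + 1) by ring]
          have := (fockW_pos (m + 1)).ne'
          field_simp
    have h2 : ‖emb ((dispGen α ^ n) ((-(conj α)) • ann (δ m)))‖ ≤
        ‖α‖ * (2 * ‖α‖) ^ n * (fockW (m + (n + 1)) / fockW m) := by
      cases m with
      | zero =>
        rw [ann_delta_zero, smul_zero, map_zero, map_zero, norm_zero]
        have := fockW_pos (0 + (n + 1))
        have := fockW_pos 0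
        positivity
      | succ m =>
        rw [ann_delta_succ, smul_smul, map_smul, map_smul, norm_smul, norm_mul, Complex.norm_real,
          norm_neg, RCLike.norm_conj, Real.norm_of_nonneg (div_pos (fockW_pos _) (fockW_pos _)).le]
        -- After cancellation this is `m + 1 ≤ √((m + n + 2)(m + n + 1))`.
        have h3 : fockW (m + 1) / fockW m * (fockW (m + n) / fockW m) ≤
            fockW (m + 1 + (n + 1)) / fockW (m + 1) := by
          have p0 := fockW_pos m
          have p1 := fockW_pos (m + 1)
          have p2 := fockW_pos (m + n)
          have e1 : fockW (m + 1) ^ 2 = (m + 1) * fockW m ^ 2 := by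
            rw [fockW_sq, fockW_sq, Nat.factorial_succ]; push_cast; ring
          rw [show m + 1 + (n + 1) = (m + n + 1) + 1 by ring, fockW_succ (m + n + 1),
            fockW_succ (m + n), div_mul_div_comm,
            div_le_div_iff₀ (by positivity) p1]
          have e2 : (m : ℝ) + 1 ≤ √((m + n + 1 : ℕ) + 1 : ℝ) * √((m + n : ℕ) + 1 : ℝ) := by
            rw [← Real.sqrt_mul (by positivity)]
            refine Real.le_sqrt_of_sq_le ?_
            push_cast
            have : (0 : ℝ) ≤ m := Nat.cast_nonneg m
            have : (0 : ℝ) ≤ n := Nat.cast_nonneg n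
            nlinarith
          calc fockW (m + 1) * fockW (m + n) * fockW (m + 1)
              = fockW (m + 1) ^ 2 * fockW (m + n) := by ring
            _ = (m + 1) * (fockW m ^ 2 * fockW (m + n)) := by rw [e1]; ring
            _ ≤ √((m + n + 1 : ℕ) + 1 : ℝ) * √((m + n : ℕ) + 1 : ℝ) *
                (fockW m ^ 2 * fockW (m + n)) := by gcongr
            _ = _ := by ring
        calc _ ≤ ‖α‖ * (fockW (m + 1) / fockW m) *
              ((2 * ‖α‖) ^ n * (fockW (m + n) / fockW m)) :=
              mul_le_mul_of_nonneg_left (ih m)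
                (mul_nonneg hα (div_pos (fockW_pos _) (fockW_pos _)).le)
          _ = ‖α‖ * (2 * ‖α‖) ^ n *
              (fockW (m + 1) / fockW m * (fockW (m + n) / fockW m)) := by ring
          _ ≤ _ := by gcongr
    rw [pow_succ, Module.End.mul_apply]
    have h3 : dispGen α (δ m) = α • cre (δ m) + (-(conj α)) • ann (δ m) := rfl
    rw [h3, map_add, map_add]
    refine (norm_add_le _ _).trans ((add_le_add h1 h2).trans (le_of_eq ?_))
    ring

lemma absExp_dispGen (α : ℂ) (u : Core) : AbsExp emb (dispGen α) u := by
  refine core_induction u .zero (fun _ _ h h' => h.add h') (fun c _ h => h.smul c) fun m => ?_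
  refine Summable.of_nonneg_of_le (fun _ => norm_nonneg _) (fun n => ?_)
    ((summable_fockW (2 * α) m).mul_right (fockW m)⁻¹)
  rw [norm_smul, norm_inv, Complex.norm_natCast, abs_of_pos (fockW_pos _)]
  have h := norm_dispGen_pow α n m
  have h2 : ‖(2 : ℂ) * α‖ = 2 * ‖α‖ := by rw [norm_mul]; simp
  rw [h2]
  calc _ ≤ (n.factorial : ℝ)⁻¹ * ((2 * ‖α‖) ^ n * (fockW (m + n) / fockW m)) := by gcongr
    _ = _ := by ring

/-- The transform of `exp(tG)u`, with `G` the generator, is guessed to be `Φ u t`. This satisfies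
`d/dt Φ u = Φ (G u)` and is entire in `t`, so its Taylor series at `0`, evaluated at `t = 1`, is the
transformed exponential series. -/
lemma barg_expVec_dispGen (α x : ℂ) (u : Core) :
    barg x (expVec emb (dispGen α) u) =
      Complex.exp (α * x - α * conj α / 2) * barg (x - conj α) (emb u) := by
  let Φ : Core → ℂ → ℂ := fun u t =>
    Complex.exp (α * x * t - α * conj α / 2 * t ^ 2) * barg (x - conj α * t) (emb u)
  have hΦ : ∀ u t, HasDerivAt (Φ u) (Φ (dispGen α u) t) t := by
    intro u t
    have h1 : HasDerivAt (fun t => α * x * t - α * conj α / 2 * t ^ 2)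
        (α * x - α * conj α * t) t := by
      refine (((hasDerivAt_id' t).const_mul (α * x)).fun_sub
        ((hasDerivAt_pow 2 t).const_mul (α * conj α / 2))).congr_deriv ?_
      push_cast
      ring
    have h2 : HasDerivAt (fun t => x - conj α * t) (-(conj α)) t := by
      simpa using ((hasDerivAt_id' t).const_mul (conj α)).const_sub x
    have h3 := h1.cexp.mul ((hasDerivAt_barg u (x - conj α * t)).comp t h2)
    refine h3.congr_deriv ?_
    have h4 : dispGen α u = α • cre u + (-(conj α)) • ann u := rfl
    simp only [Φ, h4, map_add, map_smul, barg_cre, smul_eq_mul, Function.comp]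
    ring
  have hit : ∀ n u, iteratedDeriv n (Φ u) = Φ ((dispGen α ^ n) u) := by
    intro n
    induction n with
    | zero => intro u; simp
    | succ n ih =>
      intro u
      rw [iteratedDeriv_succ', show deriv (Φ u) = Φ (dispGen α u) from
        funext fun t => (hΦ u t).deriv, ih, pow_succ, Module.End.mul_apply]
  have hd : Differentiable ℂ (Φ u) := fun t => (hΦ u t).differentiableAt
  have h1 := Complex.hasSum_taylorSeries_of_entire hd 0 1
  have h2 := (absExp_dispGen α u).hasSum.mapL (barg x)
  have h3 : Complex.exp (α * x - α * conj α / 2) * barg (x - conj α) (emb u) = Φ u 1 := by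
    simp [Φ]
  rw [h3]
  refine h2.unique (h1.congr_fun fun n => ?_)
  rw [hit, map_smul]
  simp [Φ]

/-- The prefactor is what keeps the kernel `exp(x̄y)` invariant under the translation of both
arguments by `α`. -/
lemma exists_fockD (α : ℂ) : ∃ U : Ell2 →L[ℂ] Ell2,
    ∀ z, U (fockCoh z) = Complex.exp (-(α * conj α / 2) - conj α * z) • fockCoh (z + α) := by
  refine exists_clm_of_gram fockCoh _ dense_span_fockCoh fun x y => ?_
  rw [inner_smul_left, inner_smul_right, inner_fockCoh, inner_fockCoh, ← Complex.exp_conj,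
    ← Complex.exp_add, ← Complex.exp_add]
  congr 1
  simp only [map_sub, map_neg, map_div₀, map_mul, Complex.conj_conj, map_ofNat, map_add]
  ring

lemma barg_comp_disp {α : ℂ} {U : Ell2 →L[ℂ] Ell2} (hU : ∀ z, U (fockCoh z) =
      Complex.exp (-(α * conj α / 2) - conj α * z) • fockCoh (z + α)) (x : ℂ) (v : Ell2) :
    barg x (U v) = Complex.exp (α * x - α * conj α / 2) * barg (x - conj α) v := by
  have h : (barg x).comp U = Complex.exp (α * x - α * conj α / 2) • barg (x - conj α) :=
    clm_ext_fockCoh fun z => by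
      rw [ContinuousLinearMap.comp_apply, hU, map_smul, smul_apply, barg_fockCoh, barg_fockCoh,
        smul_eq_mul, smul_eq_mul, ← Complex.exp_add, ← Complex.exp_add]
      congr 1
      ring
  simpa using DFunLike.congr_fun h v

lemma fockD_unique (α : ℂ) : ∃! U, IsDisplacement emb cre ann α U := by
  obtain ⟨U, hU⟩ := exists_fockD α
  have h : IsDisplacement emb cre ann α U := fun u => by
    have h1 : U (emb u) = expVec emb (dispGen α) u :=
      ext_barg fun x => by rw [barg_comp_disp hU, barg_expVec_dispGen]
    rw [h1]
    exact (absExp_dispGen α u).expMaps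
  refine ⟨U, h, fun V hV => clm_ext_phi fun n => ?_⟩
  rw [← emb_delta]
  exact hV.unique emb_injective h _

lemma expVec_dispGen (α : ℂ) (u : Core) : expVec emb (dispGen α) u = fockD α (emb u) := by
  have h : IsDisplacement emb cre ann α (fockD α) :=
    Classical.epsilon_spec (fockD_unique α).exists
  exact (absExp_dispGen α u).expMaps.unique emb_injective (h u)

lemma fockD_fockCoh (α z : ℂ) : fockD α (fockCoh z) =
    Complex.exp (-(α * conj α / 2) - conj α * z) • fockCoh (z + α) := by
  obtain ⟨U, hU⟩ := exists_fockD α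
  have : fockD α = U := clm_ext_phi fun n => by
    rw [← emb_delta, ← expVec_dispGen]
    exact ext_barg fun x => by rw [barg_comp_disp hU, barg_expVec_dispGen]
  rw [this, hU]

lemma barg_fockD (α x : ℂ) (v : Ell2) : barg x (fockD α v) =
    Complex.exp (α * x - α * conj α / 2) * barg (x - conj α) v :=
  barg_comp_disp (fockD_fockCoh α) x v

/-! ### Matrix elements of the displacement operator -/

lemma elemD_eq_apply (α : ℂ) (p m : ℕ) : elemD α p m = fockD α (φ m) p := inner_phi_left _ _

/-- Coefficients of `x^m` in the `p`-th coordinate of `D(α) e_x`, which is `exp(-ᾱx) (x + α)^p` up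
to constants. -/
lemma elemD_eq_sum (α : ℂ) (p m : ℕ) : elemD α p m =
    ∑ n ∈ Finset.range (min p m + 1),
      Complex.exp (-(α * conj α / 2)) * ((fockW p * fockW m / n.factorial : ℝ) : ℂ) *
        (α ^ (p - n) / (p - n).factorial) * ((-conj α) ^ (m - n) / (m - n).factorial) := by
  have h1 : ((fockW m / m.factorial : ℝ) : ℂ) * fockD α (φ m) p =
      ∑ n ∈ Finset.range (min p m + 1),
        (Complex.exp (-(α * conj α / 2)) * (fockW p : ℂ) / p.factorial *
          ((p.choose n : ℂ) * α ^ (p - n))) * ((-conj α) ^ (m - n) / (m - n).factorial) := by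
    refine hasSum_pow_unique one_pos (f := fun x => fockD α (fockCoh x) p)
      (b := fun m => ∑ n ∈ Finset.range (min p m + 1),
        (Complex.exp (-(α * conj α / 2)) * (fockW p : ℂ) / p.factorial *
          ((p.choose n : ℂ) * α ^ (p - n))) * ((-conj α) ^ (m - n) / (m - n).factorial))
      (fun x hx => hasSum_map_coh (fockCoh_apply x) (fockD α) p) (fun x hx => ?_) m
    have h := hasSum_generating (x := x) (p := p)
      (a := fun n => Complex.exp (-(α * conj α / 2)) * (fockW p : ℂ) / p.factorial *
          ((p.choose n : ℂ) * α ^ (p - n)))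
      (b := fun n i => (-conj α) ^ i / i.factorial)
      (B := fun _ => Complex.exp (-(conj α * x))) fun n _ => by
        have := NormedSpace.expSeries_div_hasSum_exp (-(conj α * x))
        rw [← Complex.exp_eq_exp_ℂ] at this
        refine this.congr_fun fun i => ?_
        rw [← neg_mul, mul_pow]
        ring
    convert h using 1
    simp only [fockD_fockCoh, lp.coeFn_smul, Pi.smul_apply, smul_eq_mul, fockCoh_apply]
    rw [add_pow, sub_eq_add_neg, Complex.exp_add, Finset.sum_div, Finset.sum_mul, Finset.mul_sum]
    refine Finset.sum_congr rfl fun n _ => ?_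
    ring
  have hm : ((fockW m / m.factorial : ℝ) : ℂ) ≠ 0 :=
    Complex.ofReal_ne_zero.mpr (div_ne_zero (fockW_pos m).ne' (by positivity))
  refine mul_left_cancel₀ hm ?_
  rw [elemD_eq_apply, h1, Finset.mul_sum]
  refine Finset.sum_congr rfl fun n hn => ?_
  have hn : n ≤ p := by simp at hn; omega
  rw [Nat.cast_choose ℂ hn]
  have e1 := fockW_sq' m
  have e2 := Nat.cast_ne_zero (R := ℂ).mpr p.factorial_ne_zero
  have e3 := Nat.cast_ne_zero (R := ℂ).mpr m.factorial_ne_zero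
  push_cast
  rw [← e1]
  have e4 : (fockW m : ℂ) ≠ 0 := Complex.ofReal_ne_zero.mpr (fockW_pos m).ne'
  field_simp

lemma elemD_symm (α : ℂ) (p m : ℕ) : elemD α p m = elemD (-(conj α)) m p := by
  rw [elemD_eq_sum, elemD_eq_sum, min_comm p m]
  refine Finset.sum_congr rfl fun n _ => ?_
  simp only [map_neg, Complex.conj_conj, neg_neg]
  rw [mul_comm (fockW p), neg_mul_neg, mul_comm (conj α)]
  ring

lemma elemD_laguerre (α : ℂ) {p m : ℕ} (hmp : m ≤ p) :
    elemD α p m = ((√((m.factorial : ℝ) / (p.factorial : ℝ)) : ℝ) : ℂ) * α ^ (p - m) *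
      ((laguerre m (p - m) (‖α‖ ^ 2) * Real.exp (-‖α‖ ^ 2 / 2) : ℝ) : ℂ) := by
  obtain ⟨d, rfl⟩ := Nat.exists_eq_add_of_le hmp
  have hexp : Complex.exp (-(α * conj α / 2)) = ((Real.exp (-‖α‖ ^ 2 / 2) : ℝ) : ℂ) := by
    rw [Complex.mul_conj', Complex.ofReal_exp]
    push_cast
    ring_nf
  rw [elemD_eq_sum, min_eq_right hmp, ← Finset.sum_range_reflect, Nat.add_sub_cancel_left, laguerre,
    Finset.sum_mul, Complex.ofReal_sum, Finset.mul_sum, hexp]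
  refine Finset.sum_congr rfl fun i hi => ?_
  obtain ⟨n, rfl⟩ := Nat.exists_eq_add_of_le' (show i ≤ m by simpa [Nat.lt_succ_iff] using hi)
  rw [show n + i + 1 - 1 - i = n by omega, show n + i + d - n = d + i by omega,
    Nat.add_sub_cancel_left, show n + i - i = n by omega, Real.sqrt_div (by positivity),
    Nat.cast_choose ℝ (show n ≤ n + i + d by omega), show n + i + d - n = d + i by omega]
  have e1 := pow_add_mul_neg_conj_pow α d i
  change _ = ((fockW (n + i) / fockW (n + i + d) : ℝ) : ℂ) * α ^ d * _
  rw [← fockW_sq (n + i + d)]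
  have e2 := (fockW_pos (n + i + d)).ne'
  have e4 : fockW (n + i + d) * fockW (n + i) / n.factorial *
      (1 / (d + i).factorial) * (1 / i.factorial) * ((-1) ^ i * (‖α‖ ^ 2) ^ i) =
      fockW (n + i) / fockW (n + i + d) * ((-1) ^ i *
        (fockW (n + i + d) ^ 2 / (n.factorial * (d + i).factorial)) * (‖α‖ ^ 2) ^ i /
        i.factorial) := by
    field_simp
  have e4' := congrArg Complex.ofReal e4
  push_cast at e4' e1 ⊢
  linear_combination (α ^ d * Complex.exp (-‖α‖ ^ 2 / 2)) * e4' + (Complex.exp (-‖α‖ ^ 2 / 2) *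
    (fockW (n + i + d) * fockW (n + i) / n.factorial * (1 / (d + i).factorial) *
      (1 / i.factorial))) * e1

/-! ### Displacements of the total space -/

lemma absExp_zero_op (v : Core) : AbsExp emb 0 v ∧ expVec emb 0 v = emb v := by
  have h : ∀ n : ℕ, n ≠ 0 → (n.factorial : ℂ)⁻¹ • emb (((0 : Module.End ℂ Core) ^ n) v) = 0 := by
    intro n hn
    rw [zero_pow hn]; simp
  constructor
  · exact summable_of_ne_finset_zero (s := {0}) fun n hn => by
      rw [h n (by simpa using hn), norm_zero]
  · rw [expVec, tsum_eq_single 0 h]; simp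

/-- The zero operator is put on the second factor so that the factorization `expVec_tens` applies.
-/
lemma totalDisp_eq (α : ℂ) : α • totalCre + (-(conj α)) • totalAnn =
    TensorProduct.map (dispGen α) 1 + TensorProduct.map 1 0 := by
  rw [TensorProduct.map_zero_right, add_zero, dispGen, TensorProduct.map_add_left,
    TensorProduct.map_smul_left, TensorProduct.map_smul_left]
  rfl

lemma isDisplacement_total (α : ℂ) :
    IsDisplacement totalEmb totalCre totalAnn α (tensOp (fockD α) (.id ℂ Ell2)) := by
  intro u
  rw [totalDisp_eq]
  have h : AbsExp totalEmb (TensorProduct.map (dispGen α) 1 + TensorProduct.map 1 0) u ∧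
      expVec totalEmb (TensorProduct.map (dispGen α) 1 + TensorProduct.map 1 0) u =
        tensOp (fockD α) (.id ℂ Ell2) (totalEmb u) := by
    induction u using TensorProduct.induction_on with
    | zero => exact ⟨.zero, by rw [expVec_zero, map_zero, map_zero]⟩
    | add x y hx hy =>
      exact ⟨hx.1.add hy.1, by rw [expVec_add hx.1 hy.1, hx.2, hy.2, map_add, map_add]⟩
    | tmul x y =>
      have h0 := absExp_zero_op y
      refine ⟨(absExp_dispGen α x).tens h0.1, ?_⟩
      rw [expVec_tens (absExp_dispGen α x) h0.1, h0.2, expVec_dispGen, totalEmb_tmul, tensOp_tens]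
      rfl
  rw [← h.2]
  exact h.1.expMaps

lemma totalD_unique (α : ℂ) : ∃! U, IsDisplacement totalEmb totalCre totalAnn α U := by
  refine ⟨_, isDisplacement_total α, fun V hV => clm_ext_tens fun n m => ?_⟩
  rw [← emb_delta, ← emb_delta, ← totalEmb_tmul]
  exact hV.unique totalEmb_injective (isDisplacement_total α) _

lemma totalD_eq (α : ℂ) : totalD α = tensOp (fockD α) (.id ℂ Ell2) :=
  theOp_eq (totalD_unique α) (isDisplacement_total α)

/-! ### Even and odd parts of Fock space -/

lemma exists_clm_of_phi {f : ℕ → Ell2}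
    (h : ∀ i j, inner ℂ (f i) (f j) = if i = j then (1 : ℂ) else 0) :
    ∃ U : Ell2 →L[ℂ] Ell2, ∀ n, U (φ n) = f n :=
  exists_clm_of_gram φ f dense_span_phi fun i j => by rw [h, inner_phi_phi]

lemma exists_parityL (ε : ℕ) : ∃ U : Ell2 →L[ℂ] Ell2, ∀ s, U (φ s) = φ (2 * s + ε) :=
  exists_clm_of_phi fun i j => by
    rw [inner_phi_phi]
    congr 1
    exact propext (by omega)

/-- The isometry `φ s ↦ φ (2 s + ε)`. -/
def parityL (ε : ℕ) : Ell2 →L[ℂ] Ell2 := (exists_parityL ε).choose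

lemma parityL_phi (ε s : ℕ) : parityL ε (φ s) = φ (2 * s + ε) := (exists_parityL ε).choose_spec s

/-- The map `δ s ↦ δ (2 s + ε)` of the cores. -/
def parityCore (ε : ℕ) : Core →ₗ[ℂ] Core :=
  Finsupp.linearCombination ℂ fun s => δ (2 * s + ε)

lemma parityCore_delta (ε s : ℕ) : parityCore ε (δ s) = δ (2 * s + ε) := by
  rw [parityCore, δ, Finsupp.linearCombination_single, one_smul]

lemma core_hom_ext {E : Type*} [AddCommMonoid E] [Module ℂ E] {f g : Core →ₗ[ℂ] E}
    (h : ∀ n, f (δ n) = g (δ n)) : f = g :=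
  Finsupp.lhom_ext' fun n => LinearMap.ext_ring (h n)

lemma parityL_emb (ε : ℕ) (u : Core) : parityL ε (emb u) = emb (parityCore ε u) := by
  have : (parityL ε).toLinearMap ∘ₗ emb = emb ∘ₗ parityCore ε := core_hom_ext fun n => by
    simp [parityL_phi, parityCore_delta]
  exact DFunLike.congr_fun this u

lemma cre_delta_sqrt (n : ℕ) : cre (δ n) = ((√((n : ℝ) + 1) : ℝ) : ℂ) • δ (n + 1) := by
  simp [cre, δ]

lemma ann_delta_sqrt (n : ℕ) : ann (δ (n + 1)) = ((√((n : ℝ) + 1) : ℝ) : ℂ) • δ n := by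
  simp [ann, δ]

lemma oscKp_delta (n : ℕ) : oscKp (δ n) =
    ((1 / 2 * √((n + 1 : ℝ) * (n + 2)) : ℝ) : ℂ) • δ (n + 2) := by
  rw [oscKp, LinearMap.smul_apply, pow_two, Module.End.mul_apply, cre_delta_sqrt, map_smul,
    cre_delta_sqrt, smul_smul, smul_smul, Real.sqrt_mul (by positivity)]
  congr 1
  push_cast
  rw [add_assoc, one_add_one_eq_two]
  ring

lemma oscKm_delta (n : ℕ) : oscKm (δ (n + 2)) =
    ((1 / 2 * √((n + 1 : ℝ) * (n + 2)) : ℝ) : ℂ) • δ n := by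
  rw [oscKm, LinearMap.smul_apply, pow_two, Module.End.mul_apply, ann_delta_sqrt, map_smul,
    ann_delta_sqrt, smul_smul, smul_smul, Real.sqrt_mul (by positivity)]
  congr 1
  push_cast
  rw [add_assoc, one_add_one_eq_two]
  ring

lemma oscKm_delta_of_lt {n : ℕ} (hn : n < 2) : oscKm (δ n) = 0 := by
  rw [oscKm, LinearMap.smul_apply, pow_two, Module.End.mul_apply]
  interval_cases n
  · rw [ann_delta_zero, map_zero, smul_zero]
  · rw [ann_delta_sqrt, map_smul, ann_delta_zero, smul_zero, smul_zero]

lemma oscK0_delta (n : ℕ) : oscK0 (δ n) = ((1 / 4 + n / 2 : ℝ) : ℂ) • δ n := by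
  have h : cre (ann (δ n)) = (n : ℂ) • δ n := by
    cases n with
    | zero => simp [ann_delta_zero]
    | succ n =>
      rw [ann_delta_sqrt, map_smul, cre_delta_sqrt, smul_smul, ← Complex.ofReal_mul,
        Real.mul_self_sqrt (by positivity)]
      push_cast; rfl
  rw [oscK0, LinearMap.smul_apply, LinearMap.add_apply, Module.End.mul_apply, h,
    LinearMap.smul_apply, Module.End.one_apply, ← add_smul, smul_smul]
  congr 1
  push_cast
  ring

/-- Matches the two-step weights of `½(a†)²` with the one-step weights of Bargmann index `1/4 +
ε/2`. It depends on `ε ∈ {0, 1}`: one of the factors `2s + ε + 1`, `2s + ε + 2` is then `2(s + 1)`.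
-/
lemma half_sqrt_eq {ε : ℕ} (hε : ε < 2) (s : ℕ) :
    1 / 2 * √(((2 * s + ε : ℕ) + 1 : ℝ) * ((2 * s + ε : ℕ) + 2)) =
      √(((s : ℝ) + 1) * (s + 2 * (1 / 4 + ε / 2))) := by
  rw [show (1 / 2 : ℝ) = √(1 / 4) by
    rw [show (1 / 4 : ℝ) = (1 / 2) ^ 2 by norm_num, Real.sqrt_sq (by norm_num)],
    ← Real.sqrt_mul (by norm_num)]
  congr 1
  interval_cases ε <;> push_cast <;> ring

lemma parity_Kp {ε : ℕ} (hε : ε < 2) (u : Core) :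
    parityCore ε (discKp (1 / 4 + ε / 2) u) = oscKp (parityCore ε u) := by
  have : parityCore ε ∘ₗ discKp (1 / 4 + ε / 2) = oscKp ∘ₗ parityCore ε := core_hom_ext fun s => by
    rw [LinearMap.comp_apply, LinearMap.comp_apply, parityCore_delta, oscKp_delta, half_sqrt_eq hε]
    rw [discKp, δ, Finsupp.linearCombination_single, one_smul, map_smul, parityCore_delta,
      show 2 * (s + 1) + ε = 2 * s + ε + 2 by ring]
  exact DFunLike.congr_fun this u

lemma parity_Km {ε : ℕ} (hε : ε < 2) (u : Core) :
    parityCore ε (discKm (1 / 4 + ε / 2) u) = oscKm (parityCore ε u) := by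
  have : parityCore ε ∘ₗ discKm (1 / 4 + ε / 2) = oscKm ∘ₗ parityCore ε := core_hom_ext fun s => by
    rw [LinearMap.comp_apply, LinearMap.comp_apply, parityCore_delta]
    cases s with
    | zero => rw [discKm_delta_zero, map_zero, oscKm_delta_of_lt (by omega)]
    | succ s =>
      rw [show 2 * (s + 1) + ε = 2 * s + ε + 2 by ring, oscKm_delta, half_sqrt_eq hε]
      rw [discKm, δ, Finsupp.linearCombination_single, one_smul, map_smul, Nat.add_sub_cancel,
        parityCore_delta]
      congr 3
      push_cast
      ring_nf
  exact DFunLike.congr_fun this u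

lemma parity_K0 (ε : ℕ) (u : Core) :
    parityCore ε (discK0 (1 / 4 + ε / 2) u) = oscK0 (parityCore ε u) := by
  have : parityCore ε ∘ₗ discK0 (1 / 4 + ε / 2) = oscK0 ∘ₗ parityCore ε := core_hom_ext fun s => by
    rw [LinearMap.comp_apply, LinearMap.comp_apply, parityCore_delta, oscK0_delta, discK0_delta,
      map_smul, parityCore_delta]
    congr 2
    push_cast
    ring
  exact DFunLike.congr_fun this u

lemma quarter_pos (ε : ℕ) : (0 : ℝ) < 1 / 4 + ε / 2 := by positivity

lemma parityL_adjoint (ε ε' s : ℕ) (hε : ε < 2) (hε' : ε' < 2) :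
    ContinuousLinearMap.adjoint (parityL ε) (φ (2 * s + ε')) = if ε = ε' then φ s else 0 := by
  refine ell2_ext fun n => ?_
  rw [← inner_phi_left, ContinuousLinearMap.adjoint_inner_right, parityL_phi, inner_phi_phi]
  split_ifs with h1 h2 h2
  · rw [phi_apply, if_pos (by omega)]
  · omega
  · rw [phi_apply, if_neg (by omega)]
  · rfl

lemma phi_parity_induction {P : ℕ → Prop} (h : ∀ s ε, ε < 2 → P (2 * s + ε)) (n : ℕ) : P n := by
  rw [← Nat.div_add_mod n 2]
  exact h _ _ (Nat.mod_lt _ two_pos)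

/-- The operator is `∑ P_ε S_{1/4 + ε/2}(w) P_ε*`, where `P_ε` embeds `D⁺_{1/4 + ε/2}` as the levels
of parity `ε`. -/
lemma exists_osc_squeeze {w : ℂ} (hw : ‖w‖ < 1) : ∃ U : Ell2 →L[ℂ] Ell2,
    (∀ m, SqueezeMaps emb oscKp oscK0 oscKm w (δ m) (U (φ m))) ∧
    (∀ s ε : ℕ, ε < 2 → U (φ (2 * s + ε)) = parityL ε (discS (1 / 4 + ε / 2) w (φ s))) := by
  let U : Ell2 →L[ℂ] Ell2 := ∑ ε ∈ Finset.range 2,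
    ((parityL ε).comp (discS (1 / 4 + ε / 2) w)).comp (ContinuousLinearMap.adjoint (parityL ε))
  have hU : ∀ s ε : ℕ, ε < 2 →
      U (φ (2 * s + ε)) = parityL ε (discS (1 / 4 + ε / 2) w (φ s)) := by
    intro s ε hε
    have h1 : ∀ ε' ∈ Finset.range 2, ((parityL ε').comp (discS (1 / 4 + ε' / 2) w)).comp
        (ContinuousLinearMap.adjoint (parityL ε')) (φ (2 * s + ε)) =
        if ε' = ε then parityL ε (discS (1 / 4 + ε / 2) w (φ s)) else 0 := by
      intro ε' hε'
      rw [ContinuousLinearMap.comp_apply, parityL_adjoint _ _ _ (by simpa using hε') hε]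
      split_ifs with h
      · subst h; rfl
      · rw [map_zero]
    simp only [U, sum_apply]
    rw [Finset.sum_congr rfl h1, Finset.sum_ite_eq' , if_pos (by simpa using hε)]
  refine ⟨U, phi_parity_induction fun s ε hε => ?_, hU⟩
  rw [hU s ε hε, ← parityCore_delta]
  exact ((discS_spec (quarter_pos ε) hw).1 s).intertwine (parityL_emb ε) (parity_Kp hε)
    (parity_K0 ε) (parity_Km hε)

lemma existsUnique_oscS {w : ℂ} (hw : ‖w‖ < 1) : ∃! U, IsSqueeze emb oscKp oscK0 oscKm w U := by
  obtain ⟨U, h, -⟩ := exists_osc_squeeze hw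
  exact existsUnique_squeeze h

lemma oscS_spec {w : ℂ} (hw : ‖w‖ < 1) :
    (∀ m, SqueezeMaps emb oscKp oscK0 oscKm w (δ m) (oscS w (φ m))) ∧
    (∀ s ε : ℕ, ε < 2 → oscS w (φ (2 * s + ε)) = parityL ε (discS (1 / 4 + ε / 2) w (φ s))) := by
  obtain ⟨U, h1, h2⟩ := exists_osc_squeeze hw
  have : oscS w = U :=
    theOp_eq (existsUnique_oscS hw) (IsSqueeze.of_squeezeMaps (core_squeezeMaps h1))
  rw [this]
  exact ⟨h1, h2⟩

lemma oscS_comp_parityL {w : ℂ} (hw : ‖w‖ < 1) {ε : ℕ} (hε : ε < 2) (v : Ell2) :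
    oscS w (parityL ε v) = parityL ε (discS (1 / 4 + ε / 2) w v) := by
  have : (oscS w).comp (parityL ε) = (parityL ε).comp (discS (1 / 4 + ε / 2) w) :=
    clm_ext_phi fun s => by
      rw [ContinuousLinearMap.comp_apply, parityL_phi, (oscS_spec hw).2 s ε hε]; rfl
  exact DFunLike.congr_fun this v

/-! ### The squeeze operator of the total space -/

lemma totalKp_eq (κ : ℝ) :
    totalKp κ = TensorProduct.map oscKp 1 + TensorProduct.map 1 (discKp κ) := by
  rw [totalKp, totalCre, map_one_pow, oscKp, TensorProduct.map_smul_left]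

lemma totalKm_eq (κ : ℝ) :
    totalKm κ = TensorProduct.map oscKm 1 + TensorProduct.map 1 (discKm κ) := by
  rw [totalKm, totalAnn, map_one_pow, oscKm, TensorProduct.map_smul_left]

lemma totalK0_eq (κ : ℝ) :
    totalK0 κ = TensorProduct.map oscK0 1 + TensorProduct.map 1 (discK0 κ) := by
  rw [totalK0, totalCre, totalAnn, oscK0, TensorProduct.map_smul_left, TensorProduct.map_add_left,
    TensorProduct.map_smul_left, ← TensorProduct.map_mul, one_mul, TensorProduct.map_one]

lemma isSqueeze_total {κ : ℝ} (hκ : 0 < κ) {w : ℂ} (hw : ‖w‖ < 1) :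
    IsSqueeze totalEmb (totalKp κ) (totalK0 κ) (totalKm κ) w (auxS κ w w) := by
  refine IsSqueeze.of_squeezeMaps fun u => ?_
  rw [totalKp_eq, totalK0_eq, totalKm_eq]
  induction u using TensorProduct.induction_on with
  | zero => rw [map_zero, map_zero]; exact .zero
  | add x y hx hy => rw [map_add, map_add]; exact hx.add hy
  | tmul x y =>
    rw [totalEmb_tmul, auxS, tensOp_tens]
    exact (core_squeezeMaps (oscS_spec hw).1 x).tens (core_squeezeMaps (discS_spec hκ hw).1 y)

lemma existsUnique_totalS {κ : ℝ} (hκ : 0 < κ) {w : ℂ} (hw : ‖w‖ < 1) :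
    ∃! U, IsSqueeze totalEmb (totalKp κ) (totalK0 κ) (totalKm κ) w U := by
  refine ⟨_, isSqueeze_total hκ hw, fun V hV => clm_ext_tens fun n m => ?_⟩
  rw [← emb_delta, ← emb_delta, ← totalEmb_tmul]
  exact hV.unique totalEmb_injective (isSqueeze_total hκ hw) _

lemma totalS_eq {κ : ℝ} (hκ : 0 < κ) {w : ℂ} (hw : ‖w‖ < 1) : totalS κ w = auxS κ w w :=
  theOp_eq (existsUnique_totalS hκ hw) (isSqueeze_total hκ hw)

/-- `S(w)` preserves parity, so its image of `φ (2s + ε)` expands in the vectors `φ (2s' + ε)`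
alone; continuity of `D(α)` lets the expansion be summed termwise. -/
lemma hasSum_fockD_oscS (α : ℂ) {w : ℂ} (hw : ‖w‖ < 1) (n' s : ℕ) {ε : ℕ} (hε : ε < 2) :
    HasSum (fun s' : ℕ => elemD α n' (2 * s' + ε) * elemS (1 / 4 + ε / 2) w s' s)
      (inner ℂ (φ n') (fockD α (oscS w (φ (2 * s + ε))))) := by
  rw [(oscS_spec hw).2 s ε hε]
  have h := (hasSum_phi (discS (1 / 4 + ε / 2) w (φ s))).mapL
    ((innerSL ℂ (φ n')).comp ((fockD α).comp (parityL ε)))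
  refine h.congr_fun fun s' => ?_
  rw [elemS_eq_apply, map_smul, ContinuousLinearMap.comp_apply, ContinuousLinearMap.comp_apply,
    parityL_phi, innerSL_apply_apply, smul_eq_mul, mul_comm]
  rfl

lemma inner_totalD_auxS {κ : ℝ} (α : ℂ) {w : ℂ} (w' : ℂ) (hw : ‖w‖ < 1) (n' m' s m : ℕ) {ε : ℕ}
    (hε : ε < 2) :
    inner ℂ (tens (φ n') (φ m')) (totalD α (auxS κ w w' (tens (φ (2 * s + ε)) (φ m)))) =
      elemS κ w' m' m *
        ∑' s' : ℕ, elemD α n' (2 * s' + ε) * elemS (1 / 4 + ε / 2) w s' s := by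
  rw [(hasSum_fockD_oscS α hw n' s hε).tsum_eq, totalD_eq, auxS, tensOp_tens, tensOp_tens,
    inner_tens, mul_comm]
  rfl

/-! ### Phase rotations and the composition law of squeeze operators -/

lemma exists_rotation (c : ℕ → ℝ) (t : ℝ) : ∃ U : Ell2 →L[ℂ] Ell2,
    ∀ n, U (φ n) = Complex.exp (2 * c n * t * Complex.I) • φ n := by
  refine exists_clm_of_phi fun i j => ?_
  rw [inner_smul_left, inner_smul_right, inner_phi_phi]
  split_ifs with h
  · subst h
    have h0 : conj (2 * c i * t * Complex.I) + 2 * c i * t * Complex.I = 0 := by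
      simp only [map_mul, map_ofNat, Complex.conj_ofReal, Complex.conj_I]
      ring
    rw [← mul_assoc, mul_one, ← Complex.exp_conj, ← Complex.exp_add, h0, Complex.exp_zero]
  · simp

/-- The unitary operator `φ n ↦ e^{2 i c(n) t} φ n`. -/
def rotation (c : ℕ → ℝ) (t : ℝ) : Ell2 →L[ℂ] Ell2 := (exists_rotation c t).choose

lemma rotation_phi (c : ℕ → ℝ) (t : ℝ) (n : ℕ) :
    rotation c t (φ n) = Complex.exp (2 * c n * t * Complex.I) • φ n :=
  (exists_rotation c t).choose_spec n

/-- The rotation `exp(2 i t K₀)` of the discrete series. -/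
def discR (k t : ℝ) : Ell2 →L[ℂ] Ell2 := rotation (fun m => k + m) t

/-- The rotation `exp(2 i t K₀)` of Fock space. -/
def oscR (t : ℝ) : Ell2 →L[ℂ] Ell2 := rotation (fun n => 1 / 4 + n / 2) t

lemma oscR_comp_parityL (ε : ℕ) (t : ℝ) (s : ℕ) :
    oscR t (φ (2 * s + ε)) = parityL ε (discR (1 / 4 + ε / 2) t (φ s)) := by
  rw [oscR, discR, rotation_phi, rotation_phi, map_smul, parityL_phi]
  congr 2
  push_cast
  ring

lemma rotation_apply (c : ℕ → ℝ) (t : ℝ) (v : Ell2) (n : ℕ) :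
    rotation c t v n = Complex.exp (2 * c n * t * Complex.I) * v n := by
  have h := hasSum_coord ((hasSum_phi v).mapL (rotation c t)) n
  refine h.unique ?_
  convert hasSum_single n ?_ using 1
  · rw [map_smul, rotation_phi, lp.coeFn_smul, Pi.smul_apply, lp.coeFn_smul, Pi.smul_apply,
      phi_apply, if_pos rfl, smul_eq_mul, smul_eq_mul]
    ring
  · intro m hm
    rw [map_smul, rotation_phi, lp.coeFn_smul, Pi.smul_apply, lp.coeFn_smul, Pi.smul_apply,
      phi_apply, if_neg hm.symm, smul_zero, smul_zero]

lemma norm_exp_mul_I_mul (t : ℝ) (x : ℂ) : ‖Complex.exp (2 * t * Complex.I) * x‖ = ‖x‖ := by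
  rw [norm_mul, show (2 * t * Complex.I : ℂ) = ((2 * t : ℝ) : ℂ) * Complex.I by push_cast; rfl,
    Complex.norm_exp_ofReal_mul_I, one_mul]

lemma discR_discCoh {k : ℝ} (hk : 0 < k) (t : ℝ) {x : ℂ} (hx : ‖x‖ < 1) :
    discR k t (discCoh k x) = Complex.exp (2 * k * t * Complex.I) •
      discCoh k (Complex.exp (2 * t * Complex.I) * x) := by
  refine ell2_ext fun n => ?_
  rw [discR, rotation_apply, lp.coeFn_smul, Pi.smul_apply, discCoh_apply hk hx,
    discCoh_apply hk (by rwa [norm_exp_mul_I_mul]), mul_pow, ← Complex.exp_nat_mul, smul_eq_mul]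
  have : Complex.exp (2 * ((k + n : ℝ) : ℂ) * t * Complex.I) =
      Complex.exp (2 * k * t * Complex.I) * Complex.exp (n * (2 * t * Complex.I)) := by
    rw [← Complex.exp_add]
    congr 1
    push_cast
    ring
  rw [this]
  ring

lemma exp_neg_two_arg {q : ℂ} (hq : q ≠ 0) :
    Complex.exp (2 * ((-q.arg : ℝ) : ℂ) * Complex.I) = conj q / q := by
  have h := Complex.norm_mul_exp_arg_mul_I q
  have hc : conj q = ‖q‖ * Complex.exp (-(q.arg * Complex.I)) := by
    conv_lhs => rw [← h]
    rw [map_mul, Complex.conj_ofReal, ← Complex.exp_conj]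
    simp
  rw [eq_div_iff hq, hc]
  calc _ = Complex.exp (2 * ((-q.arg : ℝ) : ℂ) * Complex.I) *
        (‖q‖ * Complex.exp (q.arg * Complex.I)) := by rw [h]
    _ = _ := by
      rw [mul_left_comm, ← Complex.exp_add]
      congr 2
      push_cast
      ring

lemma cpow_neg_two_mul (k : ℝ) {q : ℂ} (hq : q ≠ 0) :
    q ^ (-((2 * k : ℝ) : ℂ)) = (((‖q‖ ^ 2) ^ (-k) : ℝ) : ℂ) *
      Complex.exp (2 * k * ((-q.arg : ℝ) : ℂ) * Complex.I) := by
  have hnq := norm_pos_iff.mpr hq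
  rw [Complex.cpow_def_of_ne_zero hq, Complex.log, add_mul, Complex.exp_add]
  congr 1
  · rw [← Real.rpow_natCast, ← Real.rpow_mul hnq.le, Real.rpow_def_of_pos hnq]
    push_cast
    ring_nf
  · congr 1
    push_cast
    ring

lemma rpow_one_sub_norm_sq_diskMap (k : ℝ) {ζ w : ℂ} (hζ : ‖ζ‖ < 1) (hw : ‖w‖ < 1) :
    (1 - ‖w‖ ^ 2) ^ k * (1 - ‖ζ‖ ^ 2) ^ k * (‖1 + conj ζ * w‖ ^ 2) ^ (-k) =
      (1 - ‖diskMap ζ w‖ ^ 2) ^ k := by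
  have hρζ := one_sub_norm_sq_pos hζ
  have hρw := one_sub_norm_sq_pos hw
  have hρu := one_sub_norm_sq_pos (norm_diskMap_lt hζ hw)
  have hnq := norm_pos_iff.mpr (one_add_conj_mul_ne_zero hζ hw)
  rw [mul_comm ((1 - ‖w‖ ^ 2) ^ k), ← Real.mul_rpow hρζ.le hρw.le, ← one_sub_norm_sq_diskMap hζ hw,
    Real.mul_rpow hρu.le (by positivity), mul_assoc, ← Real.rpow_add (by positivity)]
  simp

/-- Composing two disk automorphisms of this form gives a third one preceded by the rotation `θ =
q̄/q`, with `q = 1 + ζ̄w`. In the multipliers the modulus of `q^(-2k)` supplies the normalization of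
the new squeeze parameter and its phase is that of the rotation. -/
lemma discS_comp {k : ℝ} (hk : 0 < k) {ζ w : ℂ} (hζ : ‖ζ‖ < 1) (hw : ‖w‖ < 1) :
    (discS k ζ).comp (discS k w) =
      (discS k (diskMap ζ w)).comp (discR k (-(1 + conj ζ * w).arg)) := by
  refine clm_ext_discCoh hk fun x hx => ?_
  have hu := norm_diskMap_lt hζ hw
  have hwx := norm_diskMap_lt hw hx
  have hq := one_add_conj_mul_ne_zero hζ hw
  have hq' : 1 + ζ * conj w ≠ 0 := by
    have := (map_ne_zero (starRingEnd ℂ)).mpr hq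
    simpa using this
  have hq'' : 1 + conj w * ζ ≠ 0 := by rwa [mul_comm]
  have h1 := one_add_conj_mul_ne_zero hw hx
  have h2 := one_add_conj_mul_ne_zero hζ hwx
  set q : ℂ := 1 + conj ζ * w with hqdef
  have hcq : conj q = 1 + ζ * conj w := by simp [hqdef]
  have hθ := exp_neg_two_arg hq
  set θ := Complex.exp (2 * ((-q.arg : ℝ) : ℂ) * Complex.I) with hθdef
  have hθx : ‖θ * x‖ < 1 := by rw [hθdef, norm_exp_mul_I_mul]; exact hx
  have h3 := one_add_conj_mul_ne_zero hu hθx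
  rw [ContinuousLinearMap.comp_apply, ContinuousLinearMap.comp_apply, discS_discCoh hk hw hx,
    map_smul, discS_discCoh hk hζ hwx, discR_discCoh hk _ hx, map_smul, ← hθdef,
    discS_discCoh hk hu hθx, smul_smul, smul_smul]
  have hd : 1 + conj (diskMap ζ w) * (θ * x) = (q + x * (conj w + conj ζ)) / q := by
    rw [diskMap, map_div₀, hθ, ← hqdef, hcq, map_add]
    field_simp
  -- The cocycle identity of the denominators; it drives both the equality of the points and that of
  -- the multipliers.
  have hprod : (1 + conj w * x) * (1 + conj ζ * diskMap w x) =
      q * (1 + conj (diskMap ζ w) * (θ * x)) := by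
    rw [hd, mul_div_cancel₀ _ hq, diskMap, mul_add, mul_one, mul_div_assoc', mul_div_cancel₀ _ h1,
      hqdef]
    ring
  have hmap : diskMap ζ (diskMap w x) = diskMap (diskMap ζ w) (θ * x) := by
    have e1 : diskMap w x + ζ = (conj q * x + w + ζ) / (1 + conj w * x) := by
      rw [diskMap, hcq, eq_div_iff h1, add_mul, div_mul_cancel₀ _ h1]; ring
    have e2 : θ * x + diskMap ζ w = (conj q * x + w + ζ) / q := by
      rw [hθ, diskMap, ← hqdef]; field_simp; ring
    change (diskMap w x + ζ) / (1 + conj ζ * diskMap w x) =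
      (θ * x + diskMap ζ w) / (1 + conj (diskMap ζ w) * (θ * x))
    rw [e1, e2, div_div, div_div, hprod]
  have hcp := cpow_mul_cpow_eq (e := 1) (re_one_add_pos (norm_conj_mul_lt hw hx))
    (re_one_add_pos (norm_conj_mul_lt hζ hwx)) (re_one_add_pos (norm_conj_mul_lt hζ hw))
    (re_one_add_pos (norm_conj_mul_lt hu hθx)) one_pos (by
      rw [Complex.ofReal_one, mul_one]; exact hprod) (-((2 * k : ℝ) : ℂ))
  rw [Complex.ofReal_one, Complex.one_cpow, mul_one, ← hqdef] at hcp
  have hqs := cpow_neg_two_mul k hq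
  have hone := rpow_one_sub_norm_sq_diskMap k hζ hw
  rw [← hqdef] at hone
  rw [hmap]
  congr 1
  rw [diskMul, diskMul, diskMul, ← hone]
  push_cast
  push_cast at hcp hqs
  rw [hqs] at hcp
  linear_combination (((1 - ‖w‖ ^ 2) ^ k : ℝ) : ℂ) * (((1 - ‖ζ‖ ^ 2) ^ k : ℝ) : ℂ) * hcp

lemma oscS_comp {ζ w : ℂ} (hζ : ‖ζ‖ < 1) (hw : ‖w‖ < 1) (v : Ell2) :
    oscS ζ (oscS w v) = oscS (diskMap ζ w) (oscR (-(1 + conj ζ * w).arg) v) := by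
  have : (oscS ζ).comp (oscS w) =
      (oscS (diskMap ζ w)).comp (oscR (-(1 + conj ζ * w).arg)) := clm_ext_phi <|
    phi_parity_induction fun s ε hε => by
      rw [ContinuousLinearMap.comp_apply, ContinuousLinearMap.comp_apply, oscR_comp_parityL,
        (oscS_spec hw).2 s ε hε, oscS_comp_parityL hζ hε,
        oscS_comp_parityL (norm_diskMap_lt hζ hw) hε]
      exact congrArg _ (DFunLike.congr_fun (discS_comp (quarter_pos ε) hζ hw) (φ s))
  exact DFunLike.congr_fun this v

/-! ### Gaussian states of Fock space -/

lemma two_mul_factorial_le (j : ℕ) : ((2 * j).factorial : ℝ) ≤ (2 ^ j * j.factorial) ^ 2 := by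
  have h1 := Nat.choose_le_two_pow (2 * j) j
  have h2 := Nat.add_choose_mul_factorial_mul_factorial j j
  rw [← two_mul] at h2
  have h1' : ((2 * j).choose j : ℝ) ≤ 2 ^ (2 * j) := by exact_mod_cast h1
  rw [← h2]
  push_cast
  calc ((2 * j).choose j : ℝ) * j.factorial * j.factorial
      ≤ 2 ^ (2 * j) * j.factorial * j.factorial := by gcongr
    _ = _ := by ring

/-- A single term of the expansion of `(1 + x)^(i + 2j)` bounds the binomial coefficient. The free
parameter `x` shifts almost all of the growth to the index `i`, where convergence is unconditional.
-/
lemma factorial_add_le {x : ℝ} (hx : 0 < x) (i j : ℕ) :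
    ((i + 2 * j).factorial : ℝ) ≤
      ((1 + x) / x) ^ i * ((1 + x) ^ j) ^ 2 * (i.factorial * (2 ^ j * j.factorial) ^ 2) := by
  have h2 := Nat.add_choose_mul_factorial_mul_factorial i (2 * j)
  rw [← Nat.choose_symm_of_eq_add (rfl : i + 2 * j = i + 2 * j)] at h2
  have h1 : ((i + 2 * j).choose i : ℝ) * x ^ i ≤ (1 + x) ^ (i + 2 * j) := by
    rw [add_comm 1 x, add_pow]
    have := Finset.single_le_sum (s := Finset.range (i + 2 * j + 1))
      (f := fun m => x ^ m * 1 ^ (i + 2 * j - m) * ((i + 2 * j).choose m : ℝ))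
      (fun m _ => by positivity) (Finset.mem_range.mpr (show i < i + 2 * j + 1 by omega))
    simpa [mul_comm] using this
  have h3 : ((i + 2 * j).choose i : ℝ) ≤ ((1 + x) / x) ^ i * ((1 + x) ^ j) ^ 2 := by
    rw [div_pow, ← pow_mul, mul_comm j 2, div_mul_eq_mul_div, ← pow_add,
      le_div_iff₀ (by positivity)]
    exact h1
  rw [← h2]
  push_cast
  rw [mul_assoc]
  gcongr
  exact two_mul_factorial_le j

lemma oscKp_pow_delta (w : ℂ) (j : ℕ) : ((w • oscKp) ^ j) (δ 0) =
    ((w / 2) ^ j * (fockW (2 * j) : ℂ)) • δ (2 * j) := by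
  rw [oscKp, smul_smul, smul_pow, LinearMap.smul_apply, ← pow_mul,
    shift_up_pow (fun n => (fockW_pos n).ne') cre_delta, zero_add, fockW_zero, div_one, smul_smul]
  congr 2
  ring

lemma commute_cre_oscKp (z w : ℂ) : Commute (z • cre) (w • oscKp) := by
  refine (Commute.smul_left ?_ z).smul_right w
  exact ((Commute.refl cre).pow_right 2).smul_right _

/-- The generator `z a† + (w / 2) (a†)²`. -/
def gaussGen (z w : ℂ) : Module.End ℂ Core := z • cre + w • oscKp

/-- The double series is dominated by the product of the series for `exp(Cza†)φ₀` and a geometric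
series of ratio `‖w‖(1 + x)`. -/
lemma absExp_gaussGen (z : ℂ) {w : ℂ} (hw : ‖w‖ < 1) : AbsExp emb (gaussGen z w) (δ 0) := by
  refine AbsExp.of_commute (commute_cre_oscKp z w) ?_
  -- With this choice `‖w‖(1 + x) = 1 - (1 - ‖w‖)² < 1`.
  set x : ℝ := 1 - ‖w‖ with hx
  have hx0 : 0 < x := by linarith
  set C : ℝ := √((1 + x) / x) with hC
  have hC0 : 0 ≤ C := Real.sqrt_nonneg _
  have hC2 : C ^ 2 = (1 + x) / x := Real.sq_sqrt (by positivity)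
  have hr : ‖w‖ * (1 + x) < 1 := by rw [hx]; nlinarith
  have s1 := summable_fockW ((C : ℂ) * z) 0
  have s2 := summable_geometric_of_lt_one (by positivity : 0 ≤ ‖w‖ * (1 + x)) hr
  refine Summable.of_nonneg_of_le (fun _ => norm_nonneg _) (fun p => ?_)
    (Summable.mul_of_nonneg s1 s2 (fun _ => by positivity) (fun _ => by positivity))
  obtain ⟨i, j⟩ := p
  simp only
  have e1 : emb (((z • cre) ^ i) (((w • oscKp) ^ j) (δ 0))) =
      (z ^ i * (w / 2) ^ j * (fockW (i + 2 * j) : ℂ)) • φ (i + 2 * j) := by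
    rw [oscKp_pow_delta, smul_pow, map_smul, LinearMap.smul_apply,
      shift_up_pow (fun n => (fockW_pos n).ne') cre_delta, add_comm (2 * j) i, smul_smul,
      smul_smul, map_smul, emb_delta]
    congr 1
    have := Complex.ofReal_ne_zero.mpr (fockW_pos (2 * j)).ne'
    push_cast
    field_simp
  have hb : fockW (i + 2 * j) ≤ C ^ i * (1 + x) ^ j * (fockW i * (2 ^ j * j.factorial)) := by
    refine Real.sqrt_le_iff.mpr ⟨mul_nonneg (by positivity)
      (mul_nonneg (fockW_pos i).le (by positivity)), ?_⟩
    refine (factorial_add_le hx0 i j).trans (le_of_eq ?_)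
    rw [← hC2, mul_pow, mul_pow, mul_pow (fockW i), fockW_sq]
    ring
  rw [e1, norm_smul, norm_smul, norm_phi, mul_one, norm_mul, norm_mul, norm_mul, norm_pow, norm_pow,
    norm_inv, norm_inv, Complex.norm_natCast, Complex.norm_natCast, norm_div, Complex.norm_real,
    Real.norm_of_nonneg (fockW_pos _).le, zero_add, abs_of_pos (fockW_pos i), norm_mul,
    Complex.norm_real, Real.norm_of_nonneg hC0, RCLike.norm_ofNat]
  calc _ ≤ (i.factorial : ℝ)⁻¹ * (j.factorial : ℝ)⁻¹ * (‖z‖ ^ i * (‖w‖ / 2) ^ j *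
        (C ^ i * (1 + x) ^ j * (fockW i * (2 ^ j * j.factorial)))) := by gcongr
    _ = _ := by
      rw [mul_pow, mul_pow, div_pow]
      field_simp

/-- The vector `exp(z a† + (w / 2) (a†)²) φ₀` of Fock space. -/
def fockE (z w : ℂ) : Ell2 := expVec emb (gaussGen z w) (δ 0)

/-- The generator is multiplication by `zx + wx²/2` in the Bargmann picture, so its exponential is
an ordinary exponential factor. -/
lemma barg_expVec_gaussGen {z w : ℂ} {u : Core} (h : AbsExp emb (gaussGen z w) u) (x : ℂ) :
    barg x (expVec emb (gaussGen z w) u) =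
      Complex.exp (z * x + w * x ^ 2 / 2) * barg x (emb u) := by
  have hA : ∀ u, barg x (emb (gaussGen z w u)) =
      (z * x + w * x ^ 2 / 2) * barg x (emb u) := by
    intro u
    have : gaussGen z w u = z • cre u + (w * (1 / 2)) • cre (cre u) := by
      rw [gaussGen, oscKp, smul_smul, pow_two]; rfl
    rw [this]
    simp only [map_add, map_smul, barg_cre, smul_eq_mul]
    ring
  have hn : ∀ n u, barg x (emb ((gaussGen z w ^ n) u)) =
      (z * x + w * x ^ 2 / 2) ^ n * barg x (emb u) := by
    intro n
    induction n with
    | zero => intro u; simp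
    | succ n ih => intro u; rw [pow_succ, Module.End.mul_apply, ih, hA, pow_succ]; ring
  have h1 := h.hasSum.mapL (barg x)
  have h2 := (NormedSpace.expSeries_div_hasSum_exp (z * x + w * x ^ 2 / 2)).mul_right
    (barg x (emb u))
  rw [← Complex.exp_eq_exp_ℂ] at h2
  refine h1.unique (h2.congr_fun fun n => ?_)
  rw [map_smul, hn, smul_eq_mul]
  ring

lemma barg_fockE (x z : ℂ) {w : ℂ} (hw : ‖w‖ < 1) :
    barg x (fockE z w) = Complex.exp (z * x + w * x ^ 2 / 2) := by
  rw [fockE, barg_expVec_gaussGen (absExp_gaussGen z hw), emb_delta, barg_phi]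
  simp

lemma fockE_zero (z : ℂ) : fockE z 0 = fockCoh z := by
  rw [fockE, fockCoh, gaussGen, zero_smul, add_zero]

lemma fockD_fockE (α z : ℂ) {w : ℂ} (hw : ‖w‖ < 1) : fockD α (fockE z w) =
    Complex.exp (-(α * conj α / 2) - z * conj α + w * conj α ^ 2 / 2) •
      fockE (z + α - w * conj α) w := by
  refine ext_barg fun x => ?_
  rw [barg_fockD, map_smul, barg_fockE _ _ hw, barg_fockE _ _ hw, smul_eq_mul, ← Complex.exp_add,
    ← Complex.exp_add]
  congr 1
  ring

/-- The level `n` receives the phase `e^{is/2} (e^{is})^n`, so the Bargmann variable turns by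
`e^{is}`, half the angle by which squeeze parameters turn. -/
lemma barg_oscR (t x : ℂ) (s : ℝ) (hs : t = Complex.exp (s * Complex.I)) (v : Ell2) :
    barg x (oscR s v) = Complex.exp (2 * (1 / 4 : ℝ) * s * Complex.I) * barg (t * x) v := by
  have : (barg x).comp (oscR s) =
      Complex.exp (2 * (1 / 4 : ℝ) * s * Complex.I) • barg (t * x) := clm_ext_phi fun n => by
    rw [ContinuousLinearMap.comp_apply, oscR, rotation_phi, map_smul, smul_apply, barg_phi,
      barg_phi, smul_eq_mul, smul_eq_mul, mul_pow, hs, ← Complex.exp_nat_mul]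
    have : Complex.exp (2 * ((1 / 4 + n / 2 : ℝ) : ℂ) * s * Complex.I) =
        Complex.exp (2 * (1 / 4 : ℝ) * s * Complex.I) * Complex.exp (n * (s * Complex.I)) := by
      rw [← Complex.exp_add]
      congr 1
      push_cast
      ring
    rw [this]
    ring
  exact DFunLike.congr_fun this v

lemma oscR_fockE (s : ℝ) (z : ℂ) {w : ℂ} (hw : ‖w‖ < 1) :
    oscR s (fockE z w) = Complex.exp (2 * (1 / 4 : ℝ) * s * Complex.I) •
      fockE (Complex.exp (s * Complex.I) * z) (Complex.exp (2 * s * Complex.I) * w) := by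
  refine ext_barg fun x => ?_
  rw [barg_oscR _ _ _ rfl, map_smul, barg_fockE _ _ hw,
    barg_fockE _ _ (by rwa [norm_exp_mul_I_mul]), smul_eq_mul]
  have : Complex.exp (2 * s * Complex.I) =
      Complex.exp (s * Complex.I) * Complex.exp (s * Complex.I) := by
    rw [← Complex.exp_add]
    congr 1
    ring
  rw [this]
  congr 2
  ring

/-! ### The squeeze operator on Gaussian states -/

lemma barg_expVec_oscK0 (t y : ℂ) (u : Core) :
    barg y (expVec emb (t • oscK0) u) =
      Complex.exp (t / 4) * barg (Complex.exp (t / 2) * y) (emb u) := by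
  have h := absExp_of_delta (A := t • oscK0)
    (emb ∘ₗ Finsupp.linearCombination ℂ
      fun n : ℕ => Complex.exp (t * ((1 / 4 + n / 2 : ℝ) : ℂ)) • δ n)
    fun n => by
      have := exp_diagonal (c := fun n => ((1 / 4 + n / 2 : ℝ) : ℂ)) oscK0_delta t n
      simpa [δ] using this
  rw [(h u).2]
  have : (barg y).toLinearMap ∘ₗ (emb ∘ₗ Finsupp.linearCombination ℂ
      fun n : ℕ => Complex.exp (t * ((1 / 4 + n / 2 : ℝ) : ℂ)) • δ n) =
      Complex.exp (t / 4) • ((barg (Complex.exp (t / 2) * y)).toLinearMap ∘ₗ emb) :=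
    core_hom_ext fun n => by
      simp only [LinearMap.comp_apply, LinearMap.smul_apply, ContinuousLinearMap.coe_coe]
      rw [δ, Finsupp.linearCombination_single, one_smul, map_smul, map_smul]
      change _ • barg y (emb (δ n)) = _ • barg _ (emb (δ n))
      rw [emb_delta, barg_phi, barg_phi, smul_eq_mul, smul_eq_mul, mul_pow, ← Complex.exp_nat_mul]
      have : Complex.exp (t * ((1 / 4 + n / 2 : ℝ) : ℂ)) =
          Complex.exp (t / 4) * Complex.exp (n * (t / 2)) := by
        rw [← Complex.exp_add]
        congr 1
        push_cast
        ring
      rw [this]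
      ring
  exact DFunLike.congr_fun this u

lemma oscKm_term (c y : ℂ) (m j : ℕ) :
    (fockW m : ℂ) / m.factorial *
        ((j.factorial : ℂ)⁻¹ * barg y (emb (((c • oscKm) ^ j) (δ m)))) =
      if 2 * j ≤ m then (c / 2) ^ j / j.factorial * (y ^ (m - 2 * j) / (m - 2 * j).factorial)
      else 0 := by
  have hγ := fun n => (fockW_pos n).ne'
  have h1 : ((c • oscKm) ^ j) (δ m) = (c / 2) ^ j • (ann ^ (2 * j)) (δ m) := by
    rw [oscKm, smul_smul, smul_pow, LinearMap.smul_apply, ← pow_mul]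
    congr 2
    ring
  rw [h1]
  split_ifs with h
  · have h2 := shift_down_pow hγ ann_delta_succ (2 * j) (m - 2 * j)
    rw [Nat.sub_add_cancel h] at h2
    rw [h2, map_smul, map_smul, map_smul, map_smul, emb_delta, barg_phi, smul_eq_mul, smul_eq_mul]
    have e1 := fockW_sq' m
    have e2 : (fockW (m - 2 * j) : ℂ) ≠ 0 := Complex.ofReal_ne_zero.mpr (hγ _)
    have e3 : (fockW m : ℂ) ≠ 0 := Complex.ofReal_ne_zero.mpr (hγ _)
    rw [← e1]
    push_cast
    field_simp
  · rw [shift_down_pow_eq_zero hγ ann_delta_succ ann_delta_zero (by omega)]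
    simp

lemma hasSum_mul_of_hasSum {f g : ℕ → ℂ} {a b : ℂ} (hf : HasSum f a) (hg : HasSum g b) :
    HasSum (fun p : ℕ × ℕ => f p.1 * g p.2) (a * b) :=
  hf.mul hg (summable_mul_of_summable_norm hf.summable.norm hg.summable.norm)

lemma hasSum_exp (x : ℂ) : HasSum (fun n : ℕ => x ^ n / n.factorial) (Complex.exp x) := by
  rw [Complex.exp_eq_exp_ℂ]
  exact NormedSpace.expSeries_div_hasSum_exp x

/-- Substituting `m = i + 2j` decouples the double sum into a product of two exponential series. -/
lemma hasSum_pairing {a : ℕ → ℕ → ℂ} {S : ℕ → ℂ} (c y z : ℂ)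
    (ha : ∀ m j, a m j = if 2 * j ≤ m then
      (c / 2) ^ j / j.factorial * (y ^ (m - 2 * j) / (m - 2 * j).factorial) else 0)
    (hS : ∀ m, HasSum (a m) (S m)) :
    HasSum (fun m : ℕ => z ^ m * S m) (Complex.exp (c * z ^ 2 / 2 + z * y)) := by
  have h3 : HasSum (fun p : ℕ × ℕ => (z * y) ^ p.1 / p.1.factorial *
      ((c * z ^ 2 / 2) ^ p.2 / p.2.factorial)) (Complex.exp (c * z ^ 2 / 2 + z * y)) := by
    rw [add_comm, Complex.exp_add]
    exact hasSum_mul_of_hasSum (f := fun n : ℕ => (z * y) ^ n / n.factorial)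
      (g := fun n : ℕ => (c * z ^ 2 / 2) ^ n / n.factorial) (hasSum_exp _) (hasSum_exp _)
  let e : ℕ × ℕ → ℕ × ℕ := fun p => (p.1 + 2 * p.2, p.2)
  have he : Function.Injective e := by
    rintro ⟨a, b⟩ ⟨a', b'⟩ hab
    simp only [e, Prod.mk.injEq] at hab ⊢
    omega
  have h5 : HasSum (fun p : ℕ × ℕ => z ^ p.1 * a p.1 p.2)
      (Complex.exp (c * z ^ 2 / 2 + z * y)) := by
    rw [← he.hasSum_iff]
    · refine h3.congr_fun fun p => ?_
      simp only [e, Function.comp]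
      rw [ha, if_pos (by omega), Nat.add_sub_cancel, pow_add, pow_mul, mul_pow z y]
      have : (c * z ^ 2 / 2) ^ p.2 = (z ^ 2) ^ p.2 * (c / 2) ^ p.2 := by
        rw [← mul_pow]; ring
      rw [this]
      ring
    · rintro ⟨m, j⟩ hp
      simp only
      rw [ha, if_neg, mul_zero]
      intro hjm
      exact hp ⟨(m - 2 * j, j), by simp only [e, Nat.sub_add_cancel hjm]⟩
  exact h5.prod_fiberwise fun m => (hS m).mul_left (z ^ m)

/-- Formally `exp(cK₋)` multiplies a coherent state by `exp(cz²/2)`, because `a e_z = z e_z`. The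
state is outside the core, so the exponentials on the basis vectors are summed against its
coordinates instead. -/
lemma hasSum_barg_oscKm (c y z : ℂ) (h : ∀ m, AbsExp emb (c • oscKm) (δ m)) :
    HasSum (fun m : ℕ => z ^ m * ((fockW m : ℂ) / m.factorial *
      barg y (expVec emb (c • oscKm) (δ m)))) (Complex.exp (c * z ^ 2 / 2 + z * y)) := by
  refine hasSum_pairing (a := fun m j => (fockW m : ℂ) / m.factorial *
    ((j.factorial : ℂ)⁻¹ * barg y (emb (((c • oscKm) ^ j) (δ m))))) c y z (oscKm_term c y)
    fun m => ?_
  have h6 := ((h m).hasSum.mapL (barg y)).mul_left ((fockW m : ℂ) / m.factorial)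
  refine h6.congr_fun fun j => ?_
  rw [map_smul, smul_eq_mul]

/-- In the Bargmann picture `exp(ηK₀)` dilates the variable by `e^{η/2} = √(1 - |ζ|²)` and
`exp(ζK₊)` multiplies by `exp(ζx²/2)`; the lowering factor is handled by `hasSum_barg_oscKm`. -/
lemma oscS_fockCoh {ζ : ℂ} (hζ : ‖ζ‖ < 1) (z : ℂ) : oscS ζ (fockCoh z) =
    ((((1 - ‖ζ‖ ^ 2) ^ (1 / 4 : ℝ) : ℝ) : ℂ) * Complex.exp (-(conj ζ) * z ^ 2 / 2)) •
      fockE (z * (√(1 - ‖ζ‖ ^ 2) : ℝ)) ζ := by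
  have hρ := one_sub_norm_sq_pos hζ
  refine ext_barg fun x => ?_
  set η : ℂ := ((Real.log (1 - ‖ζ‖ ^ 2) : ℝ) : ℂ) with hη
  have hη4 : Complex.exp (η / 4) = (((1 - ‖ζ‖ ^ 2) ^ (1 / 4 : ℝ) : ℝ) : ℂ) := by
    rw [Real.rpow_def_of_pos hρ, hη]
    push_cast
    ring_nf
  have hη2 : Complex.exp (η / 2) = ((√(1 - ‖ζ‖ ^ 2) : ℝ) : ℂ) := by
    rw [Real.sqrt_eq_rpow, Real.rpow_def_of_pos hρ, hη]
    push_cast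
    ring_nf
  have hm : ∀ m, AbsExp emb (-(conj ζ) • oscKm) (δ m) ∧ barg x (oscS ζ (φ m)) =
      Complex.exp (ζ * x ^ 2 / 2) * Complex.exp (η / 4) *
        barg (Complex.exp (η / 2) * x) (expVec emb (-(conj ζ) • oscKm) (δ m)) := by
    intro m
    obtain ⟨u₁, u₂, ⟨a1, b1⟩, ⟨a2, b2⟩, a3, b3⟩ := (oscS_spec hζ).1 m
    refine ⟨a1, ?_⟩
    have e1 : gaussGen 0 ζ = ζ • oscKp := by rw [gaussGen, zero_smul, zero_add]
    rw [← e1] at a3 b3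
    rw [← b3, barg_expVec_gaussGen a3, ← b2, barg_expVec_oscK0, b1, zero_mul, zero_add, mul_assoc]
  have h1 := hasSum_barg_oscKm (-(conj ζ)) (Complex.exp (η / 2) * x) z fun m => (hm m).1
  have h2 := ((hasSum_phi (fockCoh z)).mapL (oscS ζ)).mapL (barg x)
  rw [map_smul, barg_fockE _ _ hζ, smul_eq_mul]
  refine h2.unique ?_
  have h3 := h1.mul_left (Complex.exp (ζ * x ^ 2 / 2) * Complex.exp (η / 4))
  have e2 : (((1 - ‖ζ‖ ^ 2) ^ (1 / 4 : ℝ) : ℝ) : ℂ) * Complex.exp (-(conj ζ) * z ^ 2 / 2) *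
      Complex.exp (z * (√(1 - ‖ζ‖ ^ 2) : ℝ) * x + ζ * x ^ 2 / 2) =
      Complex.exp (ζ * x ^ 2 / 2) * Complex.exp (η / 4) *
        Complex.exp (-(conj ζ) * z ^ 2 / 2 + z * (Complex.exp (η / 2) * x)) := by
    rw [hη4, hη2, Complex.exp_add, Complex.exp_add]
    ring_nf
  rw [e2]
  refine h3.congr_fun fun m => ?_
  rw [map_smul, map_smul, (hm m).2, fockCoh_apply, smul_eq_mul]
  ring

/-- A Gaussian vector is, up to a nonzero scalar, a squeezed coherent state `S(w) e_{z'}`. The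
composition law reduces `S(ζ) S(w)` to one squeeze after a rotation, both of which are known on
coherent states. -/
lemma oscS_fockE {ζ w : ℂ} (hζ : ‖ζ‖ < 1) (hw : ‖w‖ < 1) (z : ℂ) : oscS ζ (fockE z w) =
    (diskMul (1 / 4) ζ w * Complex.exp (-(conj ζ * z ^ 2 / (2 * (1 + conj ζ * w))))) •
      fockE (z * (√(1 - ‖ζ‖ ^ 2) : ℝ) / (1 + conj ζ * w)) (diskMap ζ w) := by
  have hρζ := one_sub_norm_sq_pos hζ
  have hρw := one_sub_norm_sq_pos hw
  have hu := norm_diskMap_lt hζ hw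
  have hρu := one_sub_norm_sq_pos hu
  have hq := one_add_conj_mul_ne_zero hζ hw
  set q : ℂ := 1 + conj ζ * w with hqdef
  have hnq := norm_pos_iff.mpr hq
  set r : ℂ := ((√(1 - ‖w‖ ^ 2) : ℝ) : ℂ) with hr
  have hr0 : r ≠ 0 := Complex.ofReal_ne_zero.mpr (Real.sqrt_pos.mpr hρw).ne'
  have hr2 : r ^ 2 = 1 - w * conj w := by
    rw [hr, ← Complex.ofReal_pow, Real.sq_sqrt hρw.le, norm_sq_one_sub]
  have hr2' : 1 - w * conj w ≠ 0 := by rw [← hr2]; exact pow_ne_zero 2 hr0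
  have hr2'' : 1 - conj w * w ≠ 0 := by rwa [mul_comm (conj w)]
  -- Chosen so that the factor `√(1 - |w|²)` in `oscS_fockCoh` restores `z`.
  set z' : ℂ := z / r with hz'
  have hc0 : (((1 - ‖w‖ ^ 2) ^ (1 / 4 : ℝ) : ℝ) : ℂ) ≠ 0 :=
    Complex.ofReal_ne_zero.mpr (Real.rpow_pos_of_pos hρw _).ne'
  have h1 := oscS_fockCoh hw z'
  rw [hz', div_mul_cancel₀ _ hr0, ← hz'] at h1
  have h2 := congrArg (oscS ζ) h1
  rw [map_smul, oscS_comp hζ hw, ← fockE_zero, oscR_fockE _ _ (by simp), map_smul, mul_zero,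
    fockE_zero, oscS_fockCoh hu, ← hqdef] at h2
  have ht := exp_neg_two_arg hq
  set s : ℝ := -q.arg with hs
  have ht2 : Complex.exp (s * Complex.I) * ‖q‖ = ‖q‖ ^ 2 / q := by
    have h3 := Complex.norm_mul_exp_arg_mul_I q
    rw [eq_div_iff hq]
    calc _ = Complex.exp (s * Complex.I) * ‖q‖ * (‖q‖ * Complex.exp (q.arg * Complex.I)) := by
          rw [h3]
      _ = ‖q‖ ^ 2 * Complex.exp (s * Complex.I + q.arg * Complex.I) := by
          rw [Complex.exp_add]; ring
      _ = _ := by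
          rw [hs]; simp
  have hsq : (√(1 - ‖diskMap ζ w‖ ^ 2) : ℝ) * ‖q‖ = √(1 - ‖ζ‖ ^ 2) * √(1 - ‖w‖ ^ 2) := by
    have h4 := one_sub_norm_sq_diskMap hζ hw
    rw [← hqdef] at h4
    rw [← Real.sqrt_mul hρζ.le, ← h4, Real.sqrt_mul hρu.le, Real.sqrt_sq hnq.le]
  have harg : Complex.exp (s * Complex.I) * z' * (√(1 - ‖diskMap ζ w‖ ^ 2) : ℝ) =
      z * (√(1 - ‖ζ‖ ^ 2) : ℝ) / q := by
    have hsq' := congrArg Complex.ofReal hsq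
    push_cast at hsq'
    have hn0 : (‖q‖ : ℂ) ≠ 0 := Complex.ofReal_ne_zero.mpr hnq.ne'
    rw [← hr] at hsq'
    have e1 : (√(1 - ‖diskMap ζ w‖ ^ 2) : ℂ) = √(1 - ‖ζ‖ ^ 2) * r / ‖q‖ := by
      rw [eq_div_iff hn0, hsq']
    have e2 : Complex.exp (s * Complex.I) = ‖q‖ / q := by
      rw [← mul_left_inj' hn0, ht2]; field_simp
    rw [e1, e2, hz']
    field_simp
  rw [harg] at h2
  have hexp : Complex.exp (-(conj w) * z' ^ 2 / 2) *
      Complex.exp (-(conj ζ * z ^ 2 / (2 * q))) =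
      Complex.exp (-(conj (diskMap ζ w)) * (Complex.exp (s * Complex.I) * z') ^ 2 / 2) := by
    rw [← Complex.exp_add]
    congr 1
    have e3 : Complex.exp (s * Complex.I) ^ 2 = conj q / q := by
      rw [← ht, ← Complex.exp_nat_mul]; congr 1; push_cast; ring
    have hcq : conj q ≠ 0 := (map_ne_zero (starRingEnd ℂ)).mpr hq
    rw [mul_pow, e3, hz', div_pow, hr2, diskMap, map_div₀, map_add, ← hqdef]
    have e4 : -(conj w) * (z ^ 2 / (1 - w * conj w)) / 2 + -(conj ζ * z ^ 2 / (2 * q)) =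
        -((conj w * q + conj ζ * (1 - w * conj w)) * z ^ 2) / (2 * q * (1 - w * conj w)) := by
      field_simp
      ring
    rw [e4, hqdef]
    rw [← hqdef]
    -- The cancellation of the `|w|²` terms behind the combination of the two Gaussian exponents.
    have e5 : conj w * q + conj ζ * (1 - w * conj w) = conj w + conj ζ := by
      rw [hqdef]; ring
    rw [e5]
    field_simp
  have hE0 : Complex.exp (-(conj w) * z' ^ 2 / 2) ≠ 0 := Complex.exp_ne_zero _
  have hone := congrArg Complex.ofReal (rpow_one_sub_norm_sq_diskMap (1 / 4) hζ hw)
  have hqs := cpow_neg_two_mul (1 / 4) hq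
  rw [← hqdef] at hone
  rw [← hs] at hqs
  rw [smul_smul, ← hexp, ← hone] at h2
  rw [diskMul, ← hqdef, hqs]
  have hC0 : (((1 - ‖w‖ ^ 2) ^ (1 / 4 : ℝ) : ℝ) : ℂ) * Complex.exp (-(conj w) * z' ^ 2 / 2) ≠ 0 :=
    mul_ne_zero hc0 hE0
  refine smul_right_injective _ hC0 ?_
  simp only
  rw [← map_smul, map_smul, ← h2, smul_smul]
  congr 1
  push_cast
  ring

/-! ### Elements of the covering group and the disk -/

namespace CoverSU11

variable (g : CoverSU11)

lemma norm_a_pos : 0 < ‖g.a‖ := by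
  refine (norm_nonneg _).lt_of_ne' fun h => ?_
  have := g.det_eq
  rw [h] at this
  nlinarith [sq_nonneg ‖g.b‖]

lemma a_ne_zero : g.a ≠ 0 := norm_pos_iff.mp g.norm_a_pos

lemma conj_a_ne_zero : conj g.a ≠ 0 := (map_ne_zero (starRingEnd ℂ)).mpr g.a_ne_zero

lemma det_eq' : g.a * conj g.a - g.b * conj g.b = 1 := by
  rw [Complex.mul_conj, Complex.mul_conj, Complex.normSq_eq_norm_sq, Complex.normSq_eq_norm_sq,
    ← Complex.ofReal_sub, g.det_eq, Complex.ofReal_one]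

lemma a_eq_conj_mul : g.a = conj g.a * Complex.exp (2 * g.ω * Complex.I) := by
  have h : conj g.a = ‖g.a‖ * Complex.exp (-(g.ω * Complex.I)) := by
    conv_lhs => rw [g.arg_eq]
    rw [map_mul, Complex.conj_ofReal, ← Complex.exp_conj, map_mul, Complex.conj_ofReal,
      Complex.conj_I, mul_neg]
  rw [h, mul_assoc, ← Complex.exp_add]
  conv_lhs => rw [g.arg_eq]
  congr 2
  ring

lemma norm_zeta_lt : ‖g.b / conj g.a‖ < 1 := by
  rw [norm_div, RCLike.norm_conj, div_lt_one g.norm_a_pos]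
  nlinarith [g.det_eq, norm_nonneg g.b, g.norm_a_pos]

lemma one_sub_norm_zeta_sq : 1 - ‖g.b / conj g.a‖ ^ 2 = (‖g.a‖ ^ 2)⁻¹ := by
  have h := g.norm_a_pos.ne'
  rw [norm_div, RCLike.norm_conj, div_pow]
  field_simp
  exact g.det_eq

lemma conj_zeta_mul (w : ℂ) :
    conj (g.b / conj g.a) * (Complex.exp (2 * g.ω * Complex.I) * w) =
      conj g.b / conj g.a * w := by
  have h0 := Complex.exp_ne_zero (2 * g.ω * Complex.I)
  have h1 := g.conj_a_ne_zero
  rw [map_div₀, Complex.conj_conj]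
  conv_lhs => rw [g.a_eq_conj_mul]
  field_simp

lemma one_add_conj_zeta_mul (w : ℂ) :
    1 + conj (g.b / conj g.a) * (Complex.exp (2 * g.ω * Complex.I) * w) =
      (conj g.a + conj g.b * w) / conj g.a := by
  have h1 := g.conj_a_ne_zero
  rw [g.conj_zeta_mul]
  field_simp

lemma denom_ne_zero {w : ℂ} (hw : ‖w‖ < 1) : conj g.a + conj g.b * w ≠ 0 := by
  have h := one_add_conj_mul_ne_zero g.norm_zeta_lt
    (show ‖Complex.exp (2 * g.ω * Complex.I) * w‖ < 1 by rwa [norm_exp_mul_I_mul])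
  rw [g.one_add_conj_zeta_mul] at h
  exact (div_ne_zero_iff.mp h).1

/-- The Möbius action of `g` is the rotation by `a/ā = e^{2iω}` followed by the disk map with `ζ =
b/ā`. This is the geometric form of `T(g) = S(ζ) exp(2iωK₀)`. -/
lemma diskMap_zeta {w : ℂ} (hw : ‖w‖ < 1) :
    diskMap (g.b / conj g.a) (Complex.exp (2 * g.ω * Complex.I) * w) = mobius g w := by
  have h1 := g.conj_a_ne_zero
  have h2 := g.denom_ne_zero hw
  rw [diskMap, g.one_add_conj_zeta_mul, mobius, add_comm (conj g.b * w), div_div_eq_mul_div]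
  congr 1
  conv_rhs => rw [g.a_eq_conj_mul]
  field_simp

lemma norm_mobius_lt {w : ℂ} (hw : ‖w‖ < 1) : ‖mobius g w‖ < 1 := by
  rw [← g.diskMap_zeta hw]
  exact norm_diskMap_lt g.norm_zeta_lt (by rwa [norm_exp_mul_I_mul])

lemma phase_mul_diskMul (k : ℝ) (w : ℂ) :
    phase g k * diskMul k (g.b / conj g.a) (Complex.exp (2 * g.ω * Complex.I) * w) =
      multiplier k g w := by
  have h := g.norm_a_pos
  rw [diskMul, multiplier, g.conj_zeta_mul, g.one_sub_norm_zeta_sq, Real.inv_rpow (by positivity),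
    ← Real.rpow_natCast, ← Real.rpow_mul h.le, ← Real.rpow_neg h.le, mul_assoc]
  push_cast
  ring_nf

lemma multiplier_add (k l : ℝ) {w : ℂ} (hw : ‖w‖ < 1) :
    multiplier (k + l) g w = multiplier k g w * multiplier l g w := by
  have h0 : 1 + conj g.b / conj g.a * w ≠ 0 := by
    rw [← g.conj_zeta_mul, g.one_add_conj_zeta_mul]
    exact div_ne_zero (g.denom_ne_zero hw) g.conj_a_ne_zero
  have h1 : phase g (k + l) = phase g k * phase g l := by
    rw [phase, phase, phase, ← Complex.exp_add]
    congr 1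
    push_cast
    ring
  rw [multiplier, multiplier, multiplier, h1, mul_add, Real.rpow_add g.norm_a_pos,
    Complex.ofReal_add, Complex.cpow_add _ _ h0]
  push_cast
  ring

end CoverSU11

/-! ### The operators `T(g)` of the discrete series -/

lemma isDiscT_comp {k : ℝ} (hk : 0 < k) (g : CoverSU11) :
    IsDiscT k g ((discS k (g.b / conj g.a)).comp (discR k g.ω)) := fun w hw => by
  have hw' : ‖Complex.exp (2 * g.ω * Complex.I) * w‖ < 1 := by rwa [norm_exp_mul_I_mul]
  rw [ContinuousLinearMap.comp_apply, discR_discCoh hk _ hw, map_smul,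
    discS_discCoh hk g.norm_zeta_lt hw', smul_smul, g.diskMap_zeta hw, ← g.phase_mul_diskMul, phase]

lemma existsUnique_discT {k : ℝ} (hk : 0 < k) (g : CoverSU11) : ∃! U, IsDiscT k g U :=
  ⟨_, isDiscT_comp hk g, fun V hV => clm_ext_discCoh hk fun z hz => by
    rw [hV z hz, isDiscT_comp hk g z hz]⟩

lemma discT_eq {k : ℝ} (hk : 0 < k) (g : CoverSU11) :
    discT k g = (discS k (g.b / conj g.a)).comp (discR k g.ω) :=
  theOp_eq (existsUnique_discT hk g) (isDiscT_comp hk g)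

lemma discT_phi {k : ℝ} (hk : 0 < k) (g : CoverSU11) (m : ℕ) :
    discT k g (φ m) = phase g (k + m) • discS k (g.b / conj g.a) (φ m) := by
  rw [discT_eq hk, ContinuousLinearMap.comp_apply, discR, rotation_phi, map_smul, phase]

/-! ### The metaplectic operator on Fock space -/

/-- The operator `T(g)` of the oscillator representation on Fock space. -/
def oscT (g : CoverSU11) : Ell2 →L[ℂ] Ell2 := (oscS (g.b / conj g.a)).comp (oscR g.ω)

/-- The index `1/4` is the lowest weight of the oscillator realization, and one multiplier serves
both parities. The modulus `|a|` is eliminated through `|a| = ā e^{iω}`. -/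
lemma oscT_fockE (g : CoverSU11) (z : ℂ) {w : ℂ} (hw : ‖w‖ < 1) : oscT g (fockE z w) =
    (multiplier (1 / 4) g w *
      Complex.exp (-(conj g.b * z ^ 2 / (2 * (conj g.a + conj g.b * w))))) •
      fockE (z / (conj g.a + conj g.b * w)) (mobius g w) := by
  have hw' : ‖Complex.exp (2 * g.ω * Complex.I) * w‖ < 1 := by rwa [norm_exp_mul_I_mul]
  have hn := g.norm_a_pos
  have h1 := g.conj_a_ne_zero
  have h2 := g.denom_ne_zero hw
  have hs : √(1 - ‖g.b / conj g.a‖ ^ 2) = ‖g.a‖⁻¹ := by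
    rw [g.one_sub_norm_zeta_sq, Real.sqrt_inv, Real.sqrt_sq hn.le]
  set e : ℂ := Complex.exp (g.ω * Complex.I) with he
  have he2 : Complex.exp (2 * g.ω * Complex.I) = e ^ 2 := by
    rw [he, ← Complex.exp_nat_mul]
    congr 1
    push_cast
    ring
  have he0 : e ≠ 0 := Complex.exp_ne_zero _
  have hn0 : (‖g.a‖ : ℂ) ≠ 0 := Complex.ofReal_ne_zero.mpr hn.ne'
  have ha := g.a_eq_conj_mul
  rw [he2] at ha
  have ha' : (‖g.a‖ : ℂ) = conj g.a * e := by
    refine mul_right_cancel₀ he0 ?_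
    rw [mul_assoc, ← pow_two, ← ha, he]
    exact g.arg_eq.symm
  have hζ := g.conj_zeta_mul 1
  rw [he2, mul_one, mul_one] at hζ
  rw [oscT, ContinuousLinearMap.comp_apply, oscR_fockE _ _ hw, map_smul,
    oscS_fockE g.norm_zeta_lt hw', smul_smul, g.diskMap_zeta hw, ← g.phase_mul_diskMul,
    g.one_add_conj_zeta_mul, hs, ← mul_assoc, phase]
  congr 1
  · congr 2
    rw [← he, mul_pow, ← mul_assoc, hζ]
    field_simp
  · congr 1
    rw [← he]
    push_cast
    rw [ha']
    field_simp

/-- Covariance of displacements, checked on the total set of coherent states, where both sides are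
Gaussian vectors with explicit parameters; equality of the parameters reduces to `|a|² - |b|² = 1`.
-/
lemma oscT_fockD (g : CoverSU11) (α : ℂ) (v : Ell2) :
    oscT g (fockD α v) = fockD (g.a * α + g.b * conj α) (oscT g v) := by
  have h : (oscT g).comp (fockD α) = (fockD (g.a * α + g.b * conj α)).comp (oscT g) := by
    refine clm_ext_fockCoh fun z => ?_
    have h0 : ‖(0 : ℂ)‖ < 1 := by simp
    have hd := g.det_eq'
    have hA := g.conj_a_ne_zero
    have hu := g.norm_mobius_lt h0
    rw [ContinuousLinearMap.comp_apply, ContinuousLinearMap.comp_apply, fockD_fockCoh, map_smul,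
      ← fockE_zero, ← fockE_zero, oscT_fockE g _ h0, oscT_fockE g _ h0, map_smul,
      fockD_fockE _ _ hu, smul_smul, smul_smul]
    have hm : mobius g 0 = g.b / conj g.a := by simp [mobius]
    rw [hm, mul_zero, add_zero, map_add, map_mul, map_mul, Complex.conj_conj]
    generalize conj g.a = A at *
    generalize conj g.b = B at *
    generalize conj α = β at *
    have hz : z / A + (g.a * α + g.b * β) - g.b / A * (A * β + B * α) = (z + α) / A := by
      field_simp
      linear_combination α * hd
    rw [hz]
    congr 1
    rw [mul_left_comm, mul_assoc, ← Complex.exp_add, ← Complex.exp_add]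
    congr 2
    field_simp
    linear_combination (α * (A * β + B * α)) * hd
  exact DFunLike.congr_fun h v

/-! ### Coherent states of the total space -/

lemma totalGen_eq (κ : ℝ) (z w : ℂ) : z • totalCre + w • totalKp κ =
    TensorProduct.map (gaussGen z w) 1 + TensorProduct.map 1 (w • discKp κ) := by
  rw [totalKp_eq, totalCre, gaussGen, TensorProduct.map_add_left, TensorProduct.map_smul_left,
    TensorProduct.map_smul_left, TensorProduct.map_smul_right, smul_add, add_assoc]

lemma absExp_totalGen {κ : ℝ} (hκ : 0 < κ) (z : ℂ) {w : ℂ} (hw : ‖w‖ < 1) :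
    AbsExp totalEmb (z • totalCre + w • totalKp κ) (δ 0 ⊗ₜ δ 0) := by
  rw [totalGen_eq]
  exact (absExp_gaussGen z hw).tens (absExp_discKp hκ hw 0)

lemma totalCoh_eq {κ : ℝ} (hκ : 0 < κ) (z : ℂ) {w : ℂ} (hw : ‖w‖ < 1) :
    totalCoh κ z w = tens (fockE z w) (discCoh κ w) := by
  rw [totalCoh, totalGen_eq, expVec_tens (absExp_gaussGen z hw) (absExp_discKp hκ hw 0)]
  rfl

lemma exists_expMaps_discKp {k : ℝ} (hk : 0 < k) {w : ℂ} (hw : ‖w‖ < 1) :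
    ∃ y, ExpMaps emb (w • discKp k) (φ 0) y := by
  rw [← emb_delta]
  exact ⟨_, (absExp_discKp hk hw 0).expMaps⟩

lemma exists_expMaps_total {κ : ℝ} (hκ : 0 < κ) (z : ℂ) {w : ℂ} (hw : ‖w‖ < 1) :
    ∃ y, ExpMaps totalEmb (z • totalCre + w • totalKp κ) (tens (φ 0) (φ 0)) y := by
  rw [← emb_delta, ← totalEmb_tmul]
  exact ⟨_, (absExp_totalGen hκ z hw).expMaps⟩

/-! ### Totality of the coherent states `e_{z,w}` -/

section Density

variable {κ : ℝ} {L : TotalSpace →L[ℂ] ℂ}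

/-- Scaling `(z, w)` to `(xz, xw)` makes `L(e_{xz,xw})` a power series in `x`, whose vanishing
isolates each power of the generator. -/
lemma totalGen_pow_eq_zero (hκ : 0 < κ) (hL : ∀ z w, ‖w‖ < 1 → L (totalCoh κ z w) = 0)
    (n : ℕ) (z : ℂ) {w : ℂ} (hw : ‖w‖ < 1) :
    L (totalEmb (((z • totalCre + w • totalKp κ) ^ n) (δ 0 ⊗ₜ δ 0))) = 0 := by
  have h := hasSum_pow_unique (r := 1) one_pos (f := fun _ => 0) (b := fun _ => 0)
    (a := fun n => (n.factorial : ℂ)⁻¹ *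
      L (totalEmb (((z • totalCre + w • totalKp κ) ^ n) (δ 0 ⊗ₜ δ 0)))) ?_ ?_ n
  · have h0 : (n.factorial : ℂ)⁻¹ ≠ 0 := inv_ne_zero (Nat.cast_ne_zero.mpr n.factorial_ne_zero)
    exact (mul_eq_zero.mp h).resolve_left h0
  · intro x hx
    have hxw : ‖x * w‖ < 1 := by
      rw [norm_mul]
      nlinarith [norm_nonneg x, norm_nonneg w]
    have h1 := (absExp_totalGen hκ (x * z) hxw).hasSum.mapL L
    have h2 : L (expVec totalEmb ((x * z) • totalCre + (x * w) • totalKp κ) (δ 0 ⊗ₜ δ 0)) = 0 :=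
      hL _ _ hxw
    rw [h2] at h1
    refine h1.congr_fun fun n => ?_
    rw [mul_smul, mul_smul, ← smul_add, smul_pow, LinearMap.smul_apply, map_smul, map_smul,
      map_smul, smul_eq_mul, smul_eq_mul]
    ring
  · intro x _
    simp

lemma commute_totalCre_totalKp : Commute totalCre (totalKp κ) := by
  rw [totalKp]
  exact (((Commute.refl totalCre).pow_right 2).smul_right _).add_right (commute_map _ _)

/-- For fixed nonzero `w`, here `1/2`, the `(i + j)`-th power of the generator is a polynomial in
`z`; its coefficient at `z^i` is a nonzero multiple of `(a†)^i K₊^j`. -/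
lemma totalCre_totalKp_eq_zero (hκ : 0 < κ) (hL : ∀ z w, ‖w‖ < 1 → L (totalCoh κ z w) = 0)
    (i j : ℕ) : L (totalEmb ((totalCre ^ i * totalKp κ ^ j) (δ 0 ⊗ₜ δ 0))) = 0 := by
  set c : ℕ → ℂ := fun m => L (totalEmb ((totalCre ^ m * totalKp κ ^ (i + j - m)) (δ 0 ⊗ₜ δ 0)))
    with hc
  have h := hasSum_pow_unique (r := 1) one_pos (f := fun _ => 0) (b := fun _ => 0)
    (a := fun m => if m ∈ Finset.range (i + j + 1) then
      (1 / 2 : ℂ) ^ (i + j - m) * ((i + j).choose m : ℂ) * c m else 0) ?_ ?_ i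
  · rw [if_pos (Finset.mem_range.mpr (by omega)), hc] at h
    simp only [Nat.add_sub_cancel_left] at h
    refine (mul_eq_zero.mp h).resolve_left (mul_ne_zero (by simp) ?_)
    exact Nat.cast_ne_zero.mpr (Nat.choose_pos (Nat.le_add_right i j)).ne'
  · intro x _
    have h1 := totalGen_pow_eq_zero hκ hL (i + j) x (w := 1 / 2) (by norm_num)
    have hcomm : Commute (x • totalCre) ((1 / 2 : ℂ) • totalKp κ) :=
      (commute_totalCre_totalKp.smul_left x).smul_right _
    rw [hcomm.add_pow, LinearMap.sum_apply, map_sum, map_sum] at h1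
    have h2 := hasSum_sum_of_ne_finset_zero (s := Finset.range (i + j + 1))
      (f := fun m => x ^ m * (if m ∈ Finset.range (i + j + 1) then
        (1 / 2 : ℂ) ^ (i + j - m) * ((i + j).choose m : ℂ) * c m else 0))
      (L := SummationFilter.unconditional ℕ)
      fun m hm => by rw [if_neg hm, mul_zero]
    rw [Finset.sum_congr rfl (g := fun m => L (totalEmb (((x • totalCre) ^ m *
      ((1 / 2 : ℂ) • totalKp κ) ^ (i + j - m) * ((i + j).choose m : Module.End ℂ TotalCore))
        (δ 0 ⊗ₜ δ 0)))), h1] at h2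
    · exact h2
    · intro m hm
      rw [if_pos hm, smul_pow, smul_pow, smul_mul_smul_comm, Module.End.mul_apply,
        Module.End.natCast_apply, LinearMap.smul_apply, map_nsmul, map_smul, map_nsmul, map_smul,
        map_nsmul, nsmul_eq_mul, smul_eq_mul, hc]
      ring
  · intro x _
    simp

/-- Solving `K₊ = ½(a†)² + K'₊` for `K'₊` trades one factor `K₊` for one `K'₊`, modulo terms already
known to vanish. The quantification over `i` and `j` is what lets the induction raise both
exponents. -/
lemma total_pow_eq_zero (hκ : 0 < κ) (hL : ∀ z w, ‖w‖ < 1 → L (totalCoh κ z w) = 0)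
    (m : ℕ) : ∀ i j, L (totalEmb ((totalCre ^ i * totalKp κ ^ j)
      ((TensorProduct.map 1 (discKp κ) ^ m) (δ 0 ⊗ₜ δ 0)))) = 0 := by
  induction m with
  | zero => exact totalCre_totalKp_eq_zero hκ hL
  | succ m ih =>
    intro i j
    set u : TotalCore := (TensorProduct.map 1 (discKp κ) ^ m) (δ 0 ⊗ₜ δ 0) with hu
    have h1 : totalCre ^ i * totalKp κ ^ (j + 1) = (1 / 2 : ℂ) • (totalCre ^ (i + 2) * totalKp κ ^ j)
        + totalCre ^ i * totalKp κ ^ j * TensorProduct.map 1 (discKp κ) := by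
      have hc := (commute_totalCre_totalKp (κ := κ)).pow_pow 2 j
      rw [pow_succ (totalKp κ) j]
      nth_rewrite 2 [totalKp]
      rw [mul_add, mul_add, mul_smul_comm, mul_smul_comm, ← hc.eq, pow_add, mul_assoc, mul_assoc]
    have h2 := ih i (j + 1)
    rw [h1, LinearMap.add_apply, LinearMap.smul_apply, map_add, map_add, map_smul, map_smul,
      ih (i + 2) j, smul_zero, zero_add] at h2
    rw [pow_succ', Module.End.mul_apply]
    exact h2

/-- The vectors `(a†)^n K'₊^m (φ₀ ⊗ φ₀)` are nonzero multiples of the basis vectors. -/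
lemma eq_zero_of_totalCoh (hκ : 0 < κ) (hL : ∀ z w, ‖w‖ < 1 → L (totalCoh κ z w) = 0) :
    L = 0 := by
  refine clm_ext_tens fun n m => ?_
  have h := total_pow_eq_zero hκ hL m n 0
  have h1 : (discKp κ ^ m) (δ 0) = ((discW κ m / discW κ 0 : ℝ) : ℂ) • δ m := by
    have := shift_up_pow (fun n => (discW_pos hκ n).ne') (discKp_delta hκ) m 0
    rwa [zero_add] at this
  have h2 : (cre ^ n) (δ 0) = ((fockW n / fockW 0 : ℝ) : ℂ) • δ n := by
    have := shift_up_pow (fun n => (fockW_pos n).ne') cre_delta n 0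
    rwa [zero_add] at this
  rw [pow_zero, mul_one, one_map_pow, TensorProduct.map_tmul, totalCre, map_one_pow,
    TensorProduct.map_tmul, h1, Module.End.one_apply, Module.End.one_apply, h2,
    TensorProduct.smul_tmul_smul, map_smul, map_smul, totalEmb_tmul, emb_delta, emb_delta,
    smul_eq_mul] at h
  have h3 : ((fockW n / fockW 0 : ℝ) : ℂ) * ((discW κ m / discW κ 0 : ℝ) : ℂ) ≠ 0 :=
    mul_ne_zero (Complex.ofReal_ne_zero.mpr (div_pos (fockW_pos _) (fockW_pos _)).ne')
      (Complex.ofReal_ne_zero.mpr (div_pos (discW_pos hκ _) (discW_pos hκ _)).ne')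
  exact (mul_eq_zero.mp h).resolve_left h3

end Density

lemma clm_ext_totalCoh {κ : ℝ} (hκ : 0 < κ) {U V : TotalSpace →L[ℂ] TotalSpace}
    (h : ∀ z w, ‖w‖ < 1 → U (totalCoh κ z w) = V (totalCoh κ z w)) : U = V := by
  refine ContinuousLinearMap.ext fun x => ext_inner_left ℂ fun v => ?_
  have h1 : (innerSL ℂ v).comp (U - V) = 0 := eq_zero_of_totalCoh hκ fun z w hw => by
    rw [ContinuousLinearMap.comp_apply, sub_apply, h z w hw, sub_self, map_zero]
  have h2 := DFunLike.congr_fun h1 x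
  rw [ContinuousLinearMap.comp_apply, sub_apply, innerSL_apply_apply, inner_sub_right] at h2
  exact sub_eq_zero.mp h2

/-! ### The operators `T(g)` of the total space -/

/-- Both `e_{z,w}` and the multiplier factorize, the latter because `k = κ + 1/4` splits additively
in the exponent. -/
lemma isTotalT_tensOp {κ : ℝ} (hκ : 0 < κ) (g : CoverSU11) :
    IsTotalT κ g (tensOp (oscT g) (discT κ g)) := fun z w hw => by
  have hd := isDiscT_comp hκ g w hw
  rw [← discT_eq hκ] at hd
  rw [totalCoh_eq hκ _ hw, totalCoh_eq hκ _ (g.norm_mobius_lt hw), tensOp_tens, oscT_fockE g z hw,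
    hd, g.multiplier_add _ _ hw]
  change tensL (_ • _) (_ • _) = _ • tensL _ _
  rw [map_smul, map_smul, smul_apply, smul_smul]
  congr 1
  ring

lemma existsUnique_totalT {κ : ℝ} (hκ : 0 < κ) (g : CoverSU11) : ∃! U, IsTotalT κ g U :=
  ⟨_, isTotalT_tensOp hκ g, fun V hV => clm_ext_totalCoh hκ fun z w hw => by
    rw [hV z w hw, isTotalT_tensOp hκ g z w hw]⟩

lemma totalT_eq {κ : ℝ} (hκ : 0 < κ) (g : CoverSU11) :
    totalT κ g = tensOp (oscT g) (discT κ g) :=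
  theOp_eq (existsUnique_totalT hκ g) (isTotalT_tensOp hκ g)

lemma oscT_phi (g : CoverSU11) (s ε : ℕ) : oscT g (φ (2 * s + ε)) =
    phase g (1 / 4 + ε / 2 + s) • oscS (g.b / conj g.a) (φ (2 * s + ε)) := by
  rw [oscT, ContinuousLinearMap.comp_apply, oscR, rotation_phi, map_smul, phase]
  congr 3
  push_cast
  ring

lemma totalT_phi {κ : ℝ} (hκ : 0 < κ) (g : CoverSU11) (s m ε : ℕ) :
    totalT κ g (tens (φ (2 * s + ε)) (φ m)) =
      (phase g (1 / 4 + ε / 2 + s) * phase g (κ + m)) •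
        totalS κ (g.b / conj g.a) (tens (φ (2 * s + ε)) (φ m)) := by
  rw [totalT_eq hκ, tensOp_tens, oscT_phi, discT_phi hκ, totalS_eq hκ g.norm_zeta_lt, auxS,
    tensOp_tens]
  change tensL (_ • _) (_ • _) = _ • tensL _ _
  rw [map_smul, map_smul, smul_apply, smul_smul]
  congr 1
  ring

lemma totalT_totalD {κ : ℝ} (hκ : 0 < κ) (g : CoverSU11) (α : ℂ) :
    (totalT κ g).comp (totalD α) = (totalD (g.a * α + g.b * conj α)).comp (totalT κ g) := by
  refine clm_ext_tens fun n m => ?_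
  rw [ContinuousLinearMap.comp_apply, ContinuousLinearMap.comp_apply, totalT_eq hκ, totalD_eq,
    totalD_eq, tensOp_tens, tensOp_tens, tensOp_tens, tensOp_tens, oscT_fockD]
  rfl

/-- Covariance moves the displacement to the left of `T(g)`, which then acts on a basis vector as a
phase times `S(b/ā)`; this is the situation of `inner_totalD_auxS`. -/
lemma inner_piOp {κ : ℝ} (hκ : 0 < κ) (g : CoverSU11) (α : ℂ) (n' m' s m : ℕ) {ε : ℕ}
    (hε : ε < 2) :
    inner ℂ (tens (φ n') (φ m')) (piOp κ g α (tens (φ (2 * s + ε)) (φ m))) =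
      phase g (1 / 4 + ε / 2 + s) * phase g (κ + m) * elemS κ (g.b / conj g.a) m' m *
        ∑' s' : ℕ, elemD (g.a * α + g.b * conj α) n' (2 * s' + ε) *
          elemS (1 / 4 + ε / 2) (g.b / conj g.a) s' s := by
  rw [piOp, totalT_totalD hκ, ContinuousLinearMap.comp_apply, totalT_phi hκ, map_smul,
    inner_smul_right, totalS_eq hκ g.norm_zeta_lt,
    inner_totalD_auxS _ _ g.norm_zeta_lt _ _ _ _ hε, mul_assoc _ (elemS _ _ _ _)]

end JacobiGroup

end

theorem mainTheorem2 (κ : ℝ) (hκ : 0 < κ) :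
    -- all the operators involved are well defined bounded operators
    (∀ α : ℂ, (∃! U, IsDisplacement emb cre ann α U) ∧
      (∃! U, IsDisplacement totalEmb totalCre totalAnn α U)) ∧
    (∀ w : ℂ, ‖w‖ < 1 →
      (∀ k : ℝ, 0 < k → ∃! U, IsSqueeze emb (discKp k) (discK0 k) (discKm k) w U) ∧
      (∃! U, IsSqueeze emb oscKp oscK0 oscKm w U) ∧
      (∃! U, IsSqueeze totalEmb (totalKp κ) (totalK0 κ) (totalKm κ) w U)) ∧
    (∀ k : ℝ, 0 < k → ∀ w : ℂ, ‖w‖ < 1 →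
      ∃ y, ExpMaps emb (w • discKp k) (φ 0) y) ∧
    (∀ z w : ℂ, ‖w‖ < 1 →
      ∃ y, ExpMaps totalEmb (z • totalCre + w • totalKp κ) (tens (φ 0) (φ 0)) y) ∧
    (∀ g : CoverSU11, (∀ k : ℝ, 0 < k → ∃! U, IsDiscT k g U) ∧ (∃! U, IsTotalT κ g U)) ∧
    -- the Heisenberg-Weyl matrix elements
    (∀ (α : ℂ) (m n : ℕ),
      (n ≤ m → elemD α m n =
        ((√((n.factorial : ℝ) / (m.factorial : ℝ)) : ℝ) : ℂ) * α ^ (m - n) *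
          ((laguerre n (m - n) (‖α‖ ^ 2) * Real.exp (-‖α‖ ^ 2 / 2) : ℝ) : ℂ)) ∧
      elemD α m n = elemD (-(conj α)) n m) ∧
    -- the matrix elements of the squeeze operator of the discrete series
    (∀ (k : ℝ) (w : ℂ) (m' m : ℕ), 0 < k → ‖w‖ < 1 →
      (m ≤ m' →
        elemS k w m' m =
          ((√((m'.factorial : ℝ) * Real.Gamma (2 * k + m') /
            ((m.factorial : ℝ) * Real.Gamma (2 * k + m))) : ℝ) : ℂ) *
            (w ^ (m' - m) / ((m' - m).factorial : ℂ)) *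
            (((1 - ‖w‖ ^ 2) ^ (k + m) *
              ordinaryHypergeometric (-(m : ℝ)) (1 - 2 * k - m) ((m' : ℝ) - m + 1)
                (-‖w‖ ^ 2 / (1 - ‖w‖ ^ 2)) : ℝ) : ℂ) ∧
        elemS k w m' m =
          ((√((m'.factorial : ℝ) * Real.Gamma (2 * k + m') /
            ((m.factorial : ℝ) * Real.Gamma (2 * k + m))) : ℝ) : ℂ) *
            (w ^ (m' - m) / ((m' - m).factorial : ℂ)) *
            (((1 - ‖w‖ ^ 2) ^ k *
              ordinaryHypergeometric (-(m : ℝ)) (2 * k + m') ((m' : ℝ) - m + 1)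
                (‖w‖ ^ 2) : ℝ) : ℂ)) ∧
      elemS k w m' m = elemS k (-(conj w)) m m') ∧
    -- the matrix elements of `D(α) S(w, w')`
    (∀ (α w w' : ℂ) (n' m' s m ε : ℕ), ‖w‖ < 1 → ‖w'‖ < 1 → ε < 2 →
      Summable (fun s' : ℕ => elemD α n' (2 * s' + ε) * elemS (1 / 4 + ε / 2) w s' s) ∧
      inner ℂ (tens (φ n') (φ m')) (totalD α (auxS κ w w' (tens (φ (2 * s + ε)) (φ m)))) =
        elemS κ w' m' m *
          ∑' s' : ℕ, elemD α n' (2 * s' + ε) * elemS (1 / 4 + ε / 2) w s' s) ∧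
    -- the matrix elements of `D(α) S(w)`
    (∀ w : ℂ, ‖w‖ < 1 → totalS κ w = auxS κ w w) ∧
    (∀ (α w : ℂ) (n' m' s m ε : ℕ), ‖w‖ < 1 → ε < 2 →
      inner ℂ (tens (φ n') (φ m')) (totalD α (totalS κ w (tens (φ (2 * s + ε)) (φ m)))) =
        elemS κ w m' m *
          ∑' s' : ℕ, elemD α n' (2 * s' + ε) * elemS (1 / 4 + ε / 2) w s' s) ∧
    -- the relation of `T(g)` and `S(b/ā)`, in the discrete series and on the total space
    (∀ (k : ℝ) (g : CoverSU11) (m : ℕ), 0 < k →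
      discT k g (φ m) = phase g (k + m) • discS k (g.b / conj g.a) (φ m)) ∧
    (∀ (g : CoverSU11) (s m ε : ℕ), ε < 2 →
      totalT κ g (tens (φ (2 * s + ε)) (φ m)) =
        (phase g (1 / 4 + ε / 2 + s) * phase g (κ + m)) •
          totalS κ (g.b / conj g.a) (tens (φ (2 * s + ε)) (φ m))) ∧
    -- the matrix elements of `π(h) = T(g) D(α)`
    (∀ (g : CoverSU11) (α : ℂ) (n' m' s m ε : ℕ), ε < 2 →
      inner ℂ (tens (φ n') (φ m')) (piOp κ g α (tens (φ (2 * s + ε)) (φ m))) =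
        phase g (1 / 4 + ε / 2 + s) * phase g (κ + m) * elemS κ (g.b / conj g.a) m' m *
          ∑' s' : ℕ, elemD (g.a * α + g.b * conj α) n' (2 * s' + ε) *
            elemS (1 / 4 + ε / 2) (g.b / conj g.a) s' s) := by
  refine ⟨fun α => ⟨fockD_unique α, totalD_unique α⟩,
    fun w hw => ⟨fun k hk => existsUnique_discS hk hw, existsUnique_oscS hw,
      existsUnique_totalS hκ hw⟩,
    fun k hk w hw => exists_expMaps_discKp hk hw,
    fun z w hw => exists_expMaps_total hκ z hw,
    fun g => ⟨fun k hk => existsUnique_discT hk g, existsUnique_totalT hκ g⟩,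
    fun α m n => ⟨fun hmn => elemD_laguerre α hmn, elemD_symm α m n⟩,
    fun k w m' m hk hw => ⟨fun hm => elemS_hypergeometric hk hw hm, elemS_symm hk hw m' m⟩,
    fun α w w' n' m' s m ε hw _ hε => ⟨(hasSum_fockD_oscS α hw n' s hε).summable,
      inner_totalD_auxS α w' hw n' m' s m hε⟩,
    fun w hw => totalS_eq hκ hw,
    fun α w n' m' s m ε hw hε => ?_,
    fun k g m hk => discT_phi hk g m,
    fun g s m ε _ => totalT_phi hκ g s m ε,
    fun g α n' m' s m ε hε => inner_piOp hκ g α n' m' s m hε⟩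
  rw [totalS_eq hκ hw]
  exact inner_totalD_auxS α w hw n' m' s m hε
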